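/- **Setting.** Let $G$ be a connected graph with $m\ge 2$ nodes, $\bar W$ its Laplacian, $W=\bar W\otimes I_n$, $\lambda_{\max}$ and $\lambda_{\min}^+$ the largest and the smallest positive eigenvalue of $W$, and $\chi=\lambda_{\max}/\lambda_{\min}^+$. Let $Q\subseteq\mathbb R^n$ be closed and convex, $f=\frac1m\sum_{k=1}^m f_k$, let $x^*$ be a minimizer of $f$ on $Q$, $x^0\in Q$, and for $\mathbf x=(x_1,\dots,x_m)\in Q^m$ let $F(\mathbf x)=\frac1m\sum_k f_k(x_k)$. In one communication round the nodes compute $W\mathbf x$ from $\mathbf x$ (node $i$ needs only its neighbours' blocks); in one oracle call node $k$ computes $\nabla f_k(x_k)$, in the non-smooth case a subgradient $g_k(x_k)$. All norms are Euclidean. For $M>0$ put $R_y=M/\sqrt{m\lambda_{\min}^+}$. A point $\mathbf x\in Q^m$ is an $\varepsilon$-solution if $$F(\mathbf x)-f(x^*)\le\varepsilon,\qquad \|\sqrt W\mathbf x\|\le \varepsilon/R_y .$$ For $\mu\ge0$, that $f_k$ is $\mu$-strongly convex on $Q$ (convex, if $\mu=0$) with (sub)gradient $g_k$ means $f_k(y)\ge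 f_k(x)+\langle g_k(x),y-x\rangle+\frac\mu2\|y-x\|^2$ for all $x,y\in Q$. **Algorithms.** All start from $\mathbf x^0=(x^0,\dots,x^0)$ and work on the penalized function $F(\mathbf x)+\rho\|\sqrt W\mathbf x\|^2$ with $\rho=R_y^2/\delta$. *PSTM* ($Q=\mathbb R^n$; parameters $\delta,N,T$). With $L_F=L/m$, $\mu_F=\mu/m$, $A_0=0$, $z^0=\mathbf x^0$, for $k=0,\dots,N-1$: let $\alpha_{k+1}$ be the positive root of $L_F\alpha^2=(A_k+\alpha)(1+A_k\mu_F)$, $A_{k+1}=A_k+\alpha_{k+1}$, $\tilde{\mathbf x}^{k+1}=(A_k\mathbf x^k+\alpha_{k+1}z^k)/A_{k+1}$; let $z^{k+1}$ be the approximate minimizer, found as described next, of $$\sum_{l=1}^{k+1}\alpha_l\Big\{\langle\nabla F(\tilde{\mathbf x}^l),z-\tilde{\mathbf x}^l\rangle+\rho\|\sqrt Wz\|^2+\tfrac{\mu_F}{2}\|z-\tilde{\mathbf x}^l\|^2\Big\}+\tfrac12\|z-\mathbf x^0\|^2 ;$$ $\mathbf x^{k+1}=(A_k\mathbf x^k+\alpha_{k+1}z^{k+1})/A_{k+1}$.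 The output is $\mathbf x^N$. The auxiliary function equals, up to a constant, $a\langle z,Wz\rangle+\frac c2\|z\|^2-\langle b,z\rangle$ with $a=\rho A_{k+1}$, $c=1+A_{k+1}\mu_F$; it is minimized approximately by $T$ steps of the same method without penalty and with exact $z$-steps, started at $b/c$, with smoothness constant $c+2a\lambda_{\max}$ and strong convexity constant $c+2a\lambda_{\min}^+$ (the constants on $b/c+(\ker W)^\perp$). Each such step takes one communication round. *Sliding* (parameters $\delta,N,T_1,\dots,T_N$). With $\Lambda=2\rho\lambda_{\max}$, $\mathbf x_0=\bar{\mathbf x}_0=\mathbf x^0$, for $k=1,\dots,N$ with $\gamma_k=\frac2{k+1}$, $\beta_k=\frac{2\Lambda}{k}$: compute $w=W((1-\gamma_k)\bar{\mathbf x}_{k-1}+\gamma_k\mathbf x_{k-1})$ in one communication round; put $u_0=\tilde u_0=\mathbf x_{k-1}$, and for $t=1,\dots,T_k$, with $F'(\mathbf x)=\frac1m(g_1(x_1),\dots,g_m(x_m))$, $$u_t=\arg\min_{u\in Q^m}\Big\{\langle 2\rho w+F'(u_{t-1}),u\rangle+\tfrac{\beta_k}{2}\|u-\mathbf x_{k-1}\|^2+\tfrac{\beta_kt}{4}\|u-u_{t-1}\|^2\Big\},$$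 $\tilde u_t=(1-\theta_t)\tilde u_{t-1}+\theta_tu_t$, $\theta_t=\frac{2(t+1)}{t(t+3)}$; put $\mathbf x_k=u_{T_k}$, $\bar{\mathbf x}_k=(1-\gamma_k)\bar{\mathbf x}_{k-1}+\gamma_k\tilde u_{T_k}$. The output is $\bar{\mathbf x}_N$. *R-Sliding* runs Sliding finitely many times, each time from the previous output, with parameters $\delta,N,T_1,\dots,T_N$ of its own for each run. **Claim.** There are universal constants $C>0$ and $p\in\mathbb N$ such that the following holds for all such $G,n$ and all $\varepsilon,M>0$. In each case the parameters of the algorithm can be chosen depending only on $G,n,\varepsilon,M$ and those of $\mu,L,R>0$ that occur in the case, so that for all $f_k$, $x^0$, $x^*$ (and in 3, 4 all $Q$ and $g_k$) as described the algorithm outputs an $\varepsilon$-solution within the stated numbers of communication rounds and of oracle calls per node. The accuracies $\delta$ are positive, and in 1, 2, 4 $\delta\le\varepsilon$. 1. $Q=\mathbb R^n$, $f_k$ $\mu$-strongly convex with $L$-Lipschitz gradient, $\|\nabla f_k(x^*)\|\le M$ for all $k$, $\|x^0-x^*\|\le R$. PSTM: at most $C\sqrt{\frac L\mu\chi}\,\ell^p$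 rounds and $C\sqrt{\frac L\mu}\,\ell^p$ calls, where $\ell=\ln\big(2+\frac L\mu+\frac{LR^2}\varepsilon+\frac{MR}\varepsilon+\chi\big)$. 2. $Q=\mathbb R^n$, $f_k$ convex with $L$-Lipschitz gradient, $\|\nabla f_k(x^*)\|\le M$ for all $k$, $\|x^0-x^*\|\le R$. PSTM with $\mu=0$: at most $C\sqrt{\frac{LR^2}\varepsilon\chi}\,\ell^p$ rounds and $C\sqrt{\frac{LR^2}\varepsilon}$ calls, where $\ell=\ln\big(2+\frac{LR^2}\varepsilon+\frac{MR}\varepsilon+\chi\big)$. 3. $f_k$ $\mu$-strongly convex on $Q$ with subgradients $g_k$, $\|g_k\|\le M$ on $Q$. R-Sliding: at most $C\sqrt{\frac{M^2}{\mu\varepsilon}\chi}$ rounds and $C\max\Big\{\frac{M^2}{\mu\varepsilon},\sqrt{\frac{M^2}{\mu\varepsilon}\chi}\Big\}$ calls; the latter is $C\frac{M^2}{\mu\varepsilon}$ as soon as $\varepsilon\le\frac{M^2}{\mu\chi}$. 4. $f_k$ convex on $Q$ with subgradients $g_k$, $\|g_k\|\le M$ on $Q$, $\|x^0-x^*\|\le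 R$. Sliding: at most $C\sqrt{\frac{M^2R^2}{\varepsilon^2}\chi}$ rounds and $C\max\Big\{\frac{M^2R^2}{\varepsilon^2},\sqrt{\frac{M^2R^2}{\varepsilon^2}\chi}\Big\}$ calls; the latter is $C\frac{M^2R^2}{\varepsilon^2}$ as soon as $\varepsilon\le\frac{MR}{\sqrt\chi}$. -/

import Mathlib

open scoped MatrixOrder

noncomputable section

namespace Decentralized

/-- The space `ℝⁿ` with its Euclidean norm. -/
abbrev Vec (n : ℕ) : Type := EuclideanSpace ℝ (Fin n)

/-- Stacked vectors `𝐱 = (x₁, …, x_m) ∈ ℝ^{mn}` with the Euclidean norm; block `x k` is stored at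
node `k` of the network. -/
abbrev Blocks (m n : ℕ) : Type := PiLp 2 (fun _ : Fin m => Vec n)

/-- The stacked vector `(x, …, x)`. -/
def consensus (m : ℕ) {n : ℕ} (x : Vec n) : Blocks m n := WithLp.toLp 2 fun _ => x

/-- `(S ⊗ Iₙ) 𝐱` for an `m × m` matrix `S`. -/
def kronApply {m n : ℕ} (S : Matrix (Fin m) (Fin m) ℝ) (x : Blocks m n) : Blocks m n :=
  WithLp.toLp 2 fun i => ∑ j, S i j • x j

/-! ### The network -/

section Network

variable {m : ℕ} (G : SimpleGraph (Fin m)) [DecidableRel G.Adj]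

/-- The largest eigenvalue of the graph Laplacian (which is also that of `W = W̄ ⊗ Iₙ`). -/
def lamMax : ℝ := sSup (spectrum ℝ (G.lapMatrix ℝ))

/-- The smallest positive eigenvalue of the graph Laplacian. -/
def lamMinPos : ℝ := sInf {l : ℝ | l ∈ spectrum ℝ (G.lapMatrix ℝ) ∧ 0 < l}

/-- The condition number of the network. -/
def condNumber : ℝ := lamMax G / lamMinPos G

/-- `√W 𝐱`, where `W = W̄ ⊗ Iₙ` and `W̄` is the graph Laplacian, so that `√W = √W̄ ⊗ Iₙ`. -/
def sqrtLapApply {n : ℕ} (x : Blocks m n) : Blocks m n :=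
  kronApply (CFC.sqrt (G.lapMatrix ℝ)) x

/-- The bound `M / √(m λ⁺_min(W))` for the norm of the smallest dual solution. -/
def dualRadius (M : ℝ) : ℝ := M / √(m * lamMinPos G)

/-- The coefficient `R_y² / δ` of the penalty `(R_y² / δ) ‖√W 𝐱‖²`. -/
def penaltyCoeff (M δ : ℝ) : ℝ := dualRadius G M ^ 2 / δ

end Network

/-! ### Computations with a count of their communication rounds and oracle calls -/

/-- The outcome of a decentralized computation: the result, the number of communication rounds,
and the number of oracle calls made by each node. -/
structure Run (α : Type) where
  val : α
  rounds : ℕ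
  calls : ℕ

/-- Sequential composition: the costs add up. -/
instance : Monad Run where
  pure a := ⟨a, 0, 0⟩
  bind r f := ⟨(f r.val).val, r.rounds + (f r.val).rounds, r.calls + (f r.val).calls⟩

/-- One communication round: each node sends its block to its neighbours, and node `i` obtains
block `i` of `W 𝐱`, which is `deg(i) x_i - ∑_{j ∼ i} x_j`. -/
def gossip {m n : ℕ} (G : SimpleGraph (Fin m)) [DecidableRel G.Adj] (x : Blocks m n) :
    Run (Blocks m n) :=
  ⟨kronApply (G.lapMatrix ℝ) x, 1, 0⟩

/-- One oracle call at every node: node `k` evaluates `g k`, the (sub)gradient of `f_k`, at its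
own block. The result is the (sub)gradient of `F(𝐱) = (1/m) ∑ f_k(x_k)`. -/
def oracle {m n : ℕ} (g : Fin m → Vec n → Vec n) (x : Blocks m n) : Run (Blocks m n) :=
  ⟨WithLp.toLp 2 fun k => (m : ℝ)⁻¹ • g k (x k), 0, 1⟩

/-! ### The similar triangles method and its penalty version -/

/-- The positive root `α` of `L α² = (A + α) (1 + A μ)`. -/
def stmAlpha (L μ A : ℝ) : ℝ :=
  (1 + A * μ) / (2 * L) + √((1 + A * μ) ^ 2 / (4 * L ^ 2) + A * (1 + A * μ) / L)

/-- The state of the similar triangles method after `k` steps: `A = A_k`, `x = x^k`, `z = z^k` and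
`b = x⁰ - ∑_{l ≤ k} α_l (∇φ(x̃^l) - μ x̃^l)`. -/
structure STMState (X : Type) where
  A : ℝ
  b : X
  x : X
  z : X

/-- `N` steps of the similar triangles method for `φ + h`, where `φ` is `L`-smooth and `μ`-strongly
convex with gradient `grad`. The call `prox A b` computes (exactly or approximately)
`argmin_z { A h(z) + (1 + A μ)/2 ‖z‖² - ⟪b, z⟫ }`; for `A = A_{k+1}` and `b` as in `STMState` this
is, up to an additive constant, the problem
`min_z ∑_{l ≤ k+1} α_l (⟪∇φ(x̃^l), z - x̃^l⟫ + h(z) + μ/2 ‖z - x̃^l‖²) + 1/2 ‖z - x⁰‖²`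
that defines `z^{k+1}`. -/
def stm {m n : ℕ} (L μ : ℝ) (grad : Blocks m n → Run (Blocks m n))
    (prox : ℝ → Blocks m n → Run (Blocks m n)) (x₀ : Blocks m n) :
    ℕ → Run (STMState (Blocks m n))
  | 0 => pure ⟨0, x₀, x₀, x₀⟩
  | N + 1 => do
    let s ← stm L μ grad prox x₀ N
    let α := stmAlpha L μ s.A
    let A' := s.A + α
    let y := (s.A / A') • s.x + (α / A') • s.z
    let g ← grad y
    let b' := s.b - α • (g - μ • y)
    let z' ← prox A' b'
    pure ⟨A', b', (s.A / A') • s.x + (α / A') • z', z'⟩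

/-- The similar triangles method without composite term; its `z`-step is explicit. -/
def stmPlain {m n : ℕ} (L μ : ℝ) (grad : Blocks m n → Run (Blocks m n)) (x₀ : Blocks m n) (N : ℕ) :
    Run (STMState (Blocks m n)) :=
  stm L μ grad (fun A b => pure ((1 + A * μ)⁻¹ • b)) x₀ N

/-- The auxiliary problem of the penalty method:
minimize `a ⟪z, W z⟫ + c/2 ‖z‖² - ⟪b, z⟫` by `T` steps of the similar triangles method, started
from `b / c`. On `b / c + (ker W)ᗮ`, where all iterates lie, the function is
`(c + 2 a λ_max)`-smooth and `(c + 2 a λ⁺_min)`-strongly convex. -/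
def auxSolve {m n : ℕ} (G : SimpleGraph (Fin m)) [DecidableRel G.Adj] (T : ℕ) (a c : ℝ)
    (b : Blocks m n) : Run (Blocks m n) := do
  let s ← stmPlain (c + 2 * a * lamMax G) (c + 2 * a * lamMinPos G)
    (fun z => do
      let w ← gossip G z
      pure (c • z + (2 * a) • w - b))
    (c⁻¹ • b) T
  pure s.x

/-- PSTM: `N` steps of the similar triangles method for the penalized problem
`F(𝐱) + ρ ‖√W 𝐱‖²`, in which the penalty `h(𝐱) = ρ ‖√W 𝐱‖² = ρ ⟪𝐱, W 𝐱⟫` is the composite term and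
`F(𝐱) = (1/m) ∑ f_k(x_k)` is `L/m`-smooth and `μ/m`-strongly convex; every auxiliary problem is
solved by `T` inner steps. -/
def pstm {m n : ℕ} (G : SimpleGraph (Fin m)) [DecidableRel G.Adj] (g : Fin m → Vec n → Vec n)
    (L μ ρ : ℝ) (N T : ℕ) (x₀ : Vec n) : Run (Blocks m n) := do
  let s ← stm (L / m) (μ / m) (oracle g)
    (fun A b => auxSolve G T (ρ * A) (1 + A * (μ / m)) b) (consensus m x₀) N
  pure s.x

/-! ### Gradient sliding and its restarted version -/

/-- A minimizer of `φ` on `Q` (when there is one). -/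
def argminOn {n : ℕ} (Q : Set (Vec n)) (φ : Vec n → ℝ) : Vec n :=
  Classical.epsilon fun u => u ∈ Q ∧ ∀ v ∈ Q, φ u ≤ φ v

/-- The inner loop of gradient sliding: `T` prox steps with the linear term `⟪l, ·⟫`, the
(sub)gradients of `F`, and prox center `x`. With `p_t = t/2` and `θ_t = 2(t+1)/(t(t+3))`,
`u_t = argmin_{u ∈ Q^m} ⟪l + F'(u_{t-1}), u⟫ + β/2 ‖u - x‖² + β p_t/2 ‖u - u_{t-1}‖²` (which each
node computes for its own block) and `ũ_t = (1 - θ_t) ũ_{t-1} + θ_t u_t`.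
It returns `(u_T, ũ_T)`. -/
def proxSliding {m n : ℕ} (Q : Set (Vec n)) (g : Fin m → Vec n → Vec n) (l x : Blocks m n)
    (β : ℝ) : ℕ → Run (Blocks m n × Blocks m n)
  | 0 => pure (x, x)
  | T + 1 => do
    let s ← proxSliding Q g l x β T
    let t : ℝ := T + 1
    let p := t / 2
    let θ := 2 * (t + 1) / (t * (t + 3))
    let d ← oracle g s.1
    let u : Blocks m n := WithLp.toLp 2 fun i => argminOn Q fun v =>
      inner ℝ (l i + d i) v + β / 2 * ‖v - x i‖ ^ 2 + β * p / 2 * ‖v - s.1 i‖ ^ 2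
    pure (u, (1 - θ) • s.2 + θ • u)

/-- `N` outer steps of gradient sliding for `F(𝐱) + ρ ‖√W 𝐱‖²` on `Q^m`, started at `x₀`, with
`T k` inner steps in outer step `k`. The gradient of the penalty is `2 ρ W 𝐱`, and its Lipschitz
constant is `Λ = 2 ρ λ_max`; `γ_k = 2/(k+1)` and `β_k = 2 Λ/k`. The state after `k` steps is the
pair of the prox center `x_k` and the output `x̄_k`. -/
def slidingLoop {m n : ℕ} (G : SimpleGraph (Fin m)) [DecidableRel G.Adj] (Q : Set (Vec n))
    (g : Fin m → Vec n → Vec n) (ρ : ℝ) (T : ℕ → ℕ) (x₀ : Blocks m n) :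
    ℕ → Run (Blocks m n × Blocks m n)
  | 0 => pure (x₀, x₀)
  | N + 1 => do
    let s ← slidingLoop G Q g ρ T x₀ N
    let k : ℝ := N + 1
    let γ := 2 / (k + 1)
    let β := 2 * (2 * ρ * lamMax G) / k
    let w ← gossip G ((1 - γ) • s.2 + γ • s.1)
    let u ← proxSliding Q g ((2 * ρ) • w) s.1 β (T (N + 1))
    pure (u.1, (1 - γ) • s.2 + γ • u.2)

/-- Sliding: the last `x̄_N` of `slidingLoop`. -/
def sliding {m n : ℕ} (G : SimpleGraph (Fin m)) [DecidableRel G.Adj] (Q : Set (Vec n))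
    (g : Fin m → Vec n → Vec n) (ρ : ℝ) (N : ℕ) (T : ℕ → ℕ) (x₀ : Blocks m n) :
    Run (Blocks m n) := do
  let s ← slidingLoop G Q g ρ T x₀ N
  pure s.2

/-- The parameters of one stage of the restarted method: the working accuracy (which sets the
penalty coefficient), the number of outer steps and the numbers of inner steps. -/
structure Stage where
  δ : ℝ
  N : ℕ
  T : ℕ → ℕ

/-- R-Sliding: Sliding is run for each stage of a list in turn, from the last stage's output, with
the penalty coefficient `R_y² / δ` for the accuracy `δ` of the stage. -/
def rSliding {m n : ℕ} (G : SimpleGraph (Fin m)) [DecidableRel G.Adj] (Q : Set (Vec n))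
    (g : Fin m → Vec n → Vec n) (M : ℝ) : List Stage → Blocks m n → Run (Blocks m n)
  | [], x => pure x
  | s :: S, x => do
    let y ← sliding G Q g (penaltyCoeff G M s.δ) s.N s.T x
    rSliding G Q g M S y

/-! ### The problem -/

/-- `f = (1/m) ∑ f_k`. -/
def avg {m n : ℕ} (f : Fin m → Vec n → ℝ) (x : Vec n) : ℝ := (m : ℝ)⁻¹ * ∑ k, f k x

/-- `F(𝐱) = (1/m) ∑ f_k(x_k)`. -/
def avgBlocks {m n : ℕ} (f : Fin m → Vec n → ℝ) (x : Blocks m n) : ℝ :=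
  (m : ℝ)⁻¹ * ∑ k, f k (x k)

/-- `f` is `μ`-strongly convex on `Q` (convex, if `μ = 0`), and `g` is its gradient, or a selection
of its subgradients. -/
def StronglyConvexWith {n : ℕ} (μ : ℝ) (Q : Set (Vec n)) (f : Vec n → ℝ) (g : Vec n → Vec n) :
    Prop :=
  ∀ x ∈ Q, ∀ y ∈ Q, f x + inner ℝ (g x) (y - x) + μ / 2 * ‖y - x‖ ^ 2 ≤ f y

/-- `f` is differentiable on `ℝⁿ` with `L`-Lipschitz gradient. -/
def IsSmoothWith {n : ℕ} (L : ℝ) (f : Vec n → ℝ) : Prop :=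
  Differentiable ℝ f ∧ ∀ x y, ‖gradient f x - gradient f y‖ ≤ L * ‖x - y‖

/-- `𝐱` is an `ε`-solution: it is in `Q^m`, its functional gap with respect to the minimizer `xs` of
`f` on `Q` is at most `ε`, and `‖√W 𝐱‖ ≤ ε / R_y`. -/
def IsEpsSolution {m n : ℕ} (G : SimpleGraph (Fin m)) [DecidableRel G.Adj] (Q : Set (Vec n))
    (f : Fin m → Vec n → ℝ) (M : ℝ) (xs : Vec n) (ε : ℝ) (x : Blocks m n) : Prop :=
  (∀ k, x k ∈ Q) ∧ avgBlocks f x - avg f xs ≤ ε ∧ ‖sqrtLapApply G x‖ ≤ ε / dualRadius G M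

/-- The run `r` returns an `ε`-solution, with at most `rounds` communication rounds and at most
`calls` oracle calls per node. -/
def Achieves {m n : ℕ} (r : Run (Blocks m n)) (G : SimpleGraph (Fin m)) [DecidableRel G.Adj]
    (Q : Set (Vec n)) (f : Fin m → Vec n → ℝ) (M : ℝ) (xs : Vec n) (ε rounds calls : ℝ) : Prop :=
  IsEpsSolution G Q f M xs ε r.val ∧ (r.rounds : ℝ) ≤ rounds ∧ (r.calls : ℝ) ≤ calls

end Decentralized

end

open scoped MatrixOrder

noncomputable section

namespace Decentralized

/-! ### The network -/

section Spectral

open Matrix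

variable {ι : Type*} [Fintype ι] [DecidableEq ι] {A : Matrix ι ι ℝ}

/-! Consensus is replaced by a quadratic penalty, and everything rests on the exact penalty
inequality $f(x^*)\le F(\mathbf x)+R_y\|\sqrt W\mathbf x\|$ (`exact_penalty_lipschitz`,
`exact_penalty_smooth`). For bounded subgradients, linearize $F$ at the consensus vector of the mean
of $\mathbf x$: the loss is at most $M/\sqrt m$ times the distance to consensus. In the smooth case
linearize at $(x^*,\dots,x^*)$, where the gradients are bounded by $M$ and sum to zero, so that only
the deviation from the mean counts. In both cases the spectral gap bounds that deviation by $\|\sqrt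
W\mathbf x\|/\sqrt{\lambda_{\min}^+}$.

With $\rho=R_y^2/\delta$, a penalized gap of at most $2\delta$ then gives, for $t=R_y\|\sqrt
W\mathbf x\|$, $t^2/\delta-t\le2\delta$, that is $(t-2\delta)(t+\delta)\le0$ and $t\le2\delta$. So
$\delta=\varepsilon/2$ is the right accuracy, and it remains to count the steps that bring the
penalized gap down to $2\delta$ (`isEpsSolution_of_gap`).

Non-smooth case. Sliding pays for the penalty, whose smoothness constant is
$\Lambda=2M^2\chi/(m\delta)$, with outer steps and for $F$ with inner ones. Two telescoping
potentials (`proxSliding_spec`, `slidingLoop_spec`) show that $N\sim MR\sqrt\chi/\delta$ outer steps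
with $T\sim N/\chi$ inner steps each suffice. Under strong convexity the exact penalty inequality
also bounds the distance to the solution, so a stage of accuracy $\delta$ prepares the start of a
stage of accuracy $\delta/4$; the costs of the stages form a geometric series.

Smooth case. The similar triangles method is analysed with estimating sequences (`EstimateAt.step`)
whose prox steps have a small residual. `stm_inexact_spec` keeps all iterates in a ball fixed in
advance, so that one tolerance serves all auxiliary problems. These have condition number at most
$\chi$ on the affine subspace where the inner iterates live, so the inner method converges linearly
at rate $1/\sqrt\chi$ (`auxSolve_spec`). All the ratios that enter the tolerance are polynomial in
the quantity under the logarithm, hence $O(\sqrt\chi\,\ell)$ inner steps are enough. -/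

lemma dotProduct_eq_sum_sq (hA : A.IsHermitian) (v : ι → ℝ) :
    v ⬝ᵥ v = ∑ i, (v ⬝ᵥ (hA.eigenvectorBasis i : ι → ℝ)) ^ 2 := by
  have h := hA.eigenvectorBasis.sum_inner_mul_inner (WithLp.toLp 2 v) (WithLp.toLp 2 v)
  simp only [EuclideanSpace.inner_eq_star_dotProduct] at h
  simp only [star_trivial] at h
  rw [← h]
  refine Finset.sum_congr rfl fun i _ => ?_
  rw [sq, dotProduct_comm v]

lemma dotProduct_mulVec_eq_sum (hA : A.IsHermitian) (v : ι → ℝ) :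
    v ⬝ᵥ A *ᵥ v = ∑ i, hA.eigenvalues i * (v ⬝ᵥ (hA.eigenvectorBasis i : ι → ℝ)) ^ 2 := by
  have h := hA.eigenvectorBasis.sum_inner_mul_inner (WithLp.toLp 2 v) (WithLp.toLp 2 (A *ᵥ v))
  simp only [EuclideanSpace.inner_eq_star_dotProduct] at h
  simp only [star_trivial] at h
  rw [dotProduct_comm, ← h]
  refine Finset.sum_congr rfl fun i _ => ?_
  have hT : Aᵀ = A := by simpa [Matrix.IsHermitian, conjTranspose_eq_transpose_of_trivial] using hA
  have : A *ᵥ v ⬝ᵥ (hA.eigenvectorBasis i : ι → ℝ) =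
      hA.eigenvalues i * (v ⬝ᵥ (hA.eigenvectorBasis i : ι → ℝ)) := by
    have h2 := hA.mulVec_eigenvectorBasis i
    rw [dotProduct_comm, dotProduct_mulVec, ← mulVec_transpose, hT, h2, smul_dotProduct,
      dotProduct_comm, smul_eq_mul]
  rw [this, dotProduct_comm (hA.eigenvectorBasis i : ι → ℝ)]
  ring

end Spectral

/-! ### The action of `S ⊗ I` on stacked vectors -/

section Kron

variable {m n : ℕ}

@[simp] lemma kronApply_apply (S : Matrix (Fin m) (Fin m) ℝ) (x : Blocks m n) (i : Fin m) :
    kronApply S x i = ∑ j, S i j • x j := rfl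

@[simp] lemma consensus_apply (x : Vec n) (i : Fin m) : consensus m x i = x := rfl

/-- `kronApply S` as a linear map. -/
def kronLin (S : Matrix (Fin m) (Fin m) ℝ) : Blocks m n →ₗ[ℝ] Blocks m n where
  toFun := kronApply S
  map_add' x y := by
    ext i c
    simp [Finset.sum_add_distrib]
  map_smul' r x := by
    ext i c
    simp [Finset.mul_sum, mul_left_comm]

lemma kronApply_eq (S : Matrix (Fin m) (Fin m) ℝ) (x : Blocks m n) :
    kronApply S x = kronLin S x := rfl

lemma blocks_inner (x y : Blocks m n) : inner ℝ x y = ∑ i, inner ℝ (x i) (y i) :=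
  PiLp.inner_apply x y

lemma blocks_norm_sq (x : Blocks m n) : ‖x‖ ^ 2 = ∑ i, ‖x i‖ ^ 2 :=
  PiLp.norm_sq_eq_of_L2 _ x

lemma consensus_norm_sq (x : Vec n) : ‖consensus m x‖ ^ 2 = m * ‖x‖ ^ 2 := by
  simp [blocks_norm_sq]

lemma consensus_sub (x y : Vec n) : consensus m (x - y) = consensus m x - consensus m y := rfl

open Matrix in
-- Splitting by coordinate `c` reduces spectral estimates for $S\otimes I$ to estimates for $S$
-- itself.
lemma inner_kronApply (S : Matrix (Fin m) (Fin m) ℝ) (x y : Blocks m n) :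
    inner ℝ y (kronApply S x) = ∑ c, (fun i => y i c) ⬝ᵥ S *ᵥ (fun i => x i c) := by
  simp only [PiLp.inner_apply, kronApply_apply, dotProduct, mulVec]
  rw [Finset.sum_comm]
  refine Finset.sum_congr rfl fun c _ => Finset.sum_congr rfl fun i _ => ?_
  simp [mul_comm]

open Matrix in
lemma blocks_norm_sq_col (x : Blocks m n) :
    ‖x‖ ^ 2 = ∑ c, (fun i => x i c) ⬝ᵥ (fun i => x i c) := by
  rw [← real_inner_self_eq_norm_sq]
  simp only [PiLp.inner_apply, dotProduct]
  rw [Finset.sum_comm]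
  simp [sq]

open Matrix in
lemma inner_kronApply_symm {S : Matrix (Fin m) (Fin m) ℝ} (hS : S.IsHermitian) (x y : Blocks m n) :
    inner ℝ (kronApply S x) y = inner ℝ x (kronApply S y) := by
  have hT : Sᵀ = S := by simpa [Matrix.IsHermitian, conjTranspose_eq_transpose_of_trivial] using hS
  rw [real_inner_comm, inner_kronApply, inner_kronApply]
  refine Finset.sum_congr rfl fun c _ => ?_
  rw [dotProduct_mulVec, ← mulVec_transpose, hT, dotProduct_comm]

lemma kronApply_kronApply (S T : Matrix (Fin m) (Fin m) ℝ) (x : Blocks m n) :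
    kronApply S (kronApply T x) = kronApply (S * T) x := by
  ext i c
  simp only [kronApply_apply, PiLp.smul_apply, WithLp.ofLp_sum, Finset.sum_apply,
    smul_eq_mul, Matrix.mul_apply, Finset.mul_sum, Finset.sum_mul]
  rw [Finset.sum_comm]
  simp [mul_assoc]

/-- The mean of the blocks of `x`. -/
def mean (x : Blocks m n) : Vec n := (m : ℝ)⁻¹ • ∑ i, x i

end Kron

/-! ### Spectral bounds for the Laplacian -/

section Laplacian

variable {m n : ℕ} (G : SimpleGraph (Fin m)) [DecidableRel G.Adj]

lemma lap_isHermitian : (G.lapMatrix ℝ).IsHermitian := (G.posSemidef_lapMatrix (R := ℝ)).isHermitian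

lemma norm_sqrtLapApply_sq (x : Blocks m n) :
    ‖sqrtLapApply G x‖ ^ 2 = inner ℝ x (kronApply (G.lapMatrix ℝ) x) := by
  have h0 : 0 ≤ G.lapMatrix ℝ := Matrix.nonneg_iff_posSemidef.2 (G.posSemidef_lapMatrix (R := ℝ))
  have hs : (CFC.sqrt (G.lapMatrix ℝ)).IsHermitian :=
    (Matrix.nonneg_iff_posSemidef.1 (CFC.sqrt_nonneg _)).isHermitian
  rw [← real_inner_self_eq_norm_sq, sqrtLapApply, inner_kronApply_symm hs, kronApply_kronApply,
    CFC.sqrt_mul_sqrt_self _ h0]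

lemma lap_inner_nonneg (x : Blocks m n) : 0 ≤ inner ℝ x (kronApply (G.lapMatrix ℝ) x) := by
  rw [← norm_sqrtLapApply_sq]; positivity

lemma kronApply_lap_consensus (x : Vec n) : kronApply (G.lapMatrix ℝ) (consensus m x) = 0 := by
  ext i c
  have h := congrFun (G.lapMatrix_mulVec_const_eq_zero (R := ℝ)) i
  simp only [Matrix.mulVec, dotProduct, mul_one] at h
  simp only [kronApply_apply, consensus_apply, ← Finset.sum_smul, Pi.zero_apply] at h ⊢
  rw [h]; simp

/-- The Laplacian is symmetric and kills consensus vectors, so its range is orthogonal to them. -/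
lemma sum_kronApply_lap (x : Blocks m n) : ∑ i, kronApply (G.lapMatrix ℝ) x i = 0 := by
  have h (v : Vec n) : inner ℝ v (∑ i, kronApply (G.lapMatrix ℝ) x i) = 0 := by
    rw [inner_sum]
    have := inner_kronApply_symm (lap_isHermitian G) (consensus m v) x
    rw [kronApply_lap_consensus, inner_zero_left, blocks_inner] at this
    simpa using this.symm
  exact inner_self_eq_zero.1 (h _)

lemma sqrtLapApply_consensus (x : Vec n) : sqrtLapApply G (consensus m x) = 0 := by
  have := norm_sqrtLapApply_sq G (consensus m x)
  rw [kronApply_lap_consensus, inner_zero_right] at this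
  simpa using this

lemma eigenvalue_le_lamMax (i : Fin m) : (lap_isHermitian G).eigenvalues i ≤ lamMax G :=
  le_csSup (Matrix.finite_real_spectrum).bddAbove
    ((lap_isHermitian G).eigenvalues_mem_spectrum_real i)

lemma eigenvalue_nonneg (i : Fin m) : 0 ≤ (lap_isHermitian G).eigenvalues i :=
  (G.posSemidef_lapMatrix (R := ℝ)).eigenvalues_nonneg i

lemma lamMinPos_le_eigenvalue (i : Fin m) (h : 0 < (lap_isHermitian G).eigenvalues i) :
    lamMinPos G ≤ (lap_isHermitian G).eigenvalues i :=
  csInf_le ⟨0, fun _ h => h.2.le⟩ ⟨(lap_isHermitian G).eigenvalues_mem_spectrum_real i, h⟩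

lemma inner_lap_le (x : Blocks m n) :
    inner ℝ x (kronApply (G.lapMatrix ℝ) x) ≤ lamMax G * ‖x‖ ^ 2 := by
  rw [inner_kronApply, blocks_norm_sq_col, Finset.mul_sum]
  refine Finset.sum_le_sum fun c _ => ?_
  rw [dotProduct_mulVec_eq_sum (lap_isHermitian G), dotProduct_eq_sum_sq (lap_isHermitian G),
    Finset.mul_sum]
  gcongr
  exact eigenvalue_le_lamMax G _

variable {G} (hm : 2 ≤ m) (hG : G.Connected)
include hm hG

/-- Otherwise the Laplacian would vanish and its kernel would contain the indicator of a node. On a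
connected graph the kernel consists of constants, and there are two nodes. -/
lemma exists_pos_eigenvalue : ∃ i, 0 < (lap_isHermitian G).eigenvalues i := by
  by_contra! h
  have h0 : (lap_isHermitian G).eigenvalues = 0 :=
    funext fun i => le_antisymm (h i) (eigenvalue_nonneg G i)
  have hz : G.lapMatrix ℝ = 0 := (lap_isHermitian G).eigenvalues_eq_zero_iff.1 h0
  let i0 : Fin m := ⟨0, by omega⟩
  let i1 : Fin m := ⟨1, by omega⟩
  have := (G.lapMatrix_mulVec_eq_zero_iff_forall_reachable (x := Pi.single i0 1)).1
    (by rw [hz, Matrix.zero_mulVec]) i0 i1 (hG.preconnected i0 i1)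
  have hne : i1 ≠ i0 := by simp [i0, i1]
  simp [Pi.single_eq_of_ne hne] at this

lemma lamMinPos_pos : 0 < lamMinPos G := by
  obtain ⟨i, hi⟩ := exists_pos_eigenvalue hm hG
  have hne : {l : ℝ | l ∈ spectrum ℝ (G.lapMatrix ℝ) ∧ 0 < l}.Nonempty :=
    ⟨_, (lap_isHermitian G).eigenvalues_mem_spectrum_real i, hi⟩
  have hfin : {l : ℝ | l ∈ spectrum ℝ (G.lapMatrix ℝ) ∧ 0 < l}.Finite :=
    (Matrix.finite_real_spectrum).subset fun _ h => h.1
  exact (hne.csInf_mem hfin).2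

lemma lamMinPos_le_lamMax : lamMinPos G ≤ lamMax G := by
  obtain ⟨i, hi⟩ := exists_pos_eigenvalue hm hG
  exact (lamMinPos_le_eigenvalue G i hi).trans (eigenvalue_le_lamMax G i)

lemma lamMax_pos : 0 < lamMax G := (lamMinPos_pos hm hG).trans_le (lamMinPos_le_lamMax hm hG)

lemma one_le_condNumber : 1 ≤ condNumber G :=
  (one_le_div (lamMinPos_pos hm hG)).2 (lamMinPos_le_lamMax hm hG)

/-- An eigenvector of eigenvalue $0$ is constant because the graph is connected, hence orthogonal to
every coordinate column of `x`; only positive eigenvalues contribute. -/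
lemma le_inner_lap_of_sum_eq_zero (x : Blocks m n) (hx : ∑ i, x i = 0) :
    lamMinPos G * ‖x‖ ^ 2 ≤ inner ℝ x (kronApply (G.lapMatrix ℝ) x) := by
  rw [inner_kronApply, blocks_norm_sq_col, Finset.mul_sum]
  refine Finset.sum_le_sum fun c _ => ?_
  rw [dotProduct_mulVec_eq_sum (lap_isHermitian G), dotProduct_eq_sum_sq (lap_isHermitian G),
    Finset.mul_sum]
  refine Finset.sum_le_sum fun i _ => ?_
  rcases (eigenvalue_nonneg G i).eq_or_lt with h | h
  · have hv := (lap_isHermitian G).mulVec_eigenvectorBasis i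
    rw [← h, zero_smul, G.lapMatrix_mulVec_eq_zero_iff_forall_reachable] at hv
    have i0 : Fin m := ⟨0, by omega⟩
    have hc : (fun i => x i c) ⬝ᵥ ((lap_isHermitian G).eigenvectorBasis i : Fin m → ℝ) = 0 := by
      simp only [dotProduct]
      rw [Finset.sum_congr rfl fun j _ => by rw [hv j i0 (hG.preconnected j i0)],
        ← Finset.sum_mul]
      have := congrArg (fun v : Vec n => v c) hx
      simp only [WithLp.ofLp_sum, Finset.sum_apply] at this
      rw [this]; simp
    rw [hc]; simp
  · gcongr
    exact lamMinPos_le_eigenvalue G i h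

omit hG in
lemma sum_sub_mean (x : Blocks m n) : ∑ i, (x - consensus m (mean x)) i = 0 := by
  have hm' : (m : ℝ) ≠ 0 := by positivity
  simp only [PiLp.sub_apply, consensus_apply, Finset.sum_sub_distrib, Finset.sum_const,
    Finset.card_univ, Fintype.card_fin, mean, ← Nat.cast_smul_eq_nsmul ℝ, smul_smul,
    mul_inv_cancel₀ hm', one_smul, sub_self]

lemma norm_sub_mean_le (x : Blocks m n) :
    lamMinPos G * ‖x - consensus m (mean x)‖ ^ 2 ≤ ‖sqrtLapApply G x‖ ^ 2 := by
  refine (le_inner_lap_of_sum_eq_zero hm hG _ (sum_sub_mean hm x)).trans_eq ?_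
  rw [norm_sqrtLapApply_sq, kronApply_eq, map_sub, ← kronApply_eq, ← kronApply_eq,
    kronApply_lap_consensus, sub_zero, inner_sub_left,
    ← inner_kronApply_symm (lap_isHermitian G) (consensus m (mean x)), kronApply_lap_consensus,
    inner_zero_left, sub_zero]

omit hm hG in
lemma inner_lap_mul_le (x y : Blocks m n) :
    inner ℝ x (kronApply (G.lapMatrix ℝ) y) ≤ ‖sqrtLapApply G x‖ * ‖sqrtLapApply G y‖ := by
  have h0 : 0 ≤ G.lapMatrix ℝ := Matrix.nonneg_iff_posSemidef.2 (G.posSemidef_lapMatrix (R := ℝ))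
  have hs : (CFC.sqrt (G.lapMatrix ℝ)).IsHermitian :=
    (Matrix.nonneg_iff_posSemidef.1 (CFC.sqrt_nonneg _)).isHermitian
  have := real_inner_le_norm (sqrtLapApply G x) (sqrtLapApply G y)
  rwa [sqrtLapApply, sqrtLapApply, inner_kronApply_symm hs, kronApply_kronApply,
    CFC.sqrt_mul_sqrt_self _ h0] at this

/-- For $w=Wx$, $\|w\|^2=\langle w,Wx\rangle\le\|\sqrt Ww\|\,\|\sqrt
Wx\|\le\lambda_{\max}\|w\|\,\|x\|$. -/
lemma norm_lap_le (x : Blocks m n) : ‖kronApply (G.lapMatrix ℝ) x‖ ≤ lamMax G * ‖x‖ := by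
  set w := kronApply (G.lapMatrix ℝ) x with hw
  have hl := lamMax_pos hm hG
  have bound (y : Blocks m n) : ‖sqrtLapApply G y‖ ≤ √(lamMax G) * ‖y‖ := by
    refine abs_le_of_sq_le_sq' ?_ (by positivity) |>.2
    rw [norm_sqrtLapApply_sq, mul_pow, Real.sq_sqrt hl.le]
    exact inner_lap_le G y
  have h1 := inner_lap_mul_le (G := G) w x
  rw [← hw, real_inner_self_eq_norm_sq] at h1
  have h2 : ‖w‖ ^ 2 ≤ (√(lamMax G) * ‖w‖) * (√(lamMax G) * ‖x‖) :=
    h1.trans (mul_le_mul (bound w) (bound x) (norm_nonneg _) (by positivity))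
  have h3 : ‖w‖ * ‖w‖ ≤ (lamMax G * ‖x‖) * ‖w‖ := by
    have := Real.mul_self_sqrt hl.le
    calc ‖w‖ * ‖w‖ = ‖w‖ ^ 2 := by ring
      _ ≤ _ := h2
      _ = (√(lamMax G) * √(lamMax G)) * ‖x‖ * ‖w‖ := by ring
      _ = _ := by rw [this]
  rcases (norm_nonneg w).eq_or_lt with h | h
  · rw [← h]; positivity
  · exact le_of_mul_le_mul_right h3 h

end Laplacian

/-! ### Convex analysis -/

lemma add_le_of_forall_one_sub_mul {X Y Z : ℝ}
    (h : ∀ t : ℝ, 0 < t → t < 1 → X + (1 - t) * Y ≤ Z) : X + Y ≤ Z := by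
  have h1 : Filter.Tendsto (fun t : ℝ => X + (1 - t) * Y) (nhdsWithin 0 (Set.Ioi 0))
      (nhds (X + (1 - 0) * Y)) := by
    have : Continuous fun t : ℝ => X + (1 - t) * Y := by fun_prop
    exact this.continuousAt.tendsto.mono_left nhdsWithin_le_nhds
  have h2 := le_of_tendsto h1 (b := Z) ?_
  · simpa using h2
  · filter_upwards [Ioo_mem_nhdsGT (show (0 : ℝ) < 1 by norm_num)] with t ht
    exact h t ht.1 ht.2

section InnerProduct

variable {E : Type*} [NormedAddCommGroup E] [InnerProductSpace ℝ E]

lemma norm_sq_convexCombo (a b : E) (t : ℝ) :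
    ‖(1 - t) • a + t • b‖ ^ 2 = (1 - t) * ‖a‖ ^ 2 + t * ‖b‖ ^ 2 - t * (1 - t) * ‖b - a‖ ^ 2 := by
  rw [norm_add_sq_real, norm_sub_sq_real, inner_smul_left, inner_smul_right, norm_smul, norm_smul,
    mul_pow, mul_pow, Real.norm_eq_abs, Real.norm_eq_abs, sq_abs, sq_abs, real_inner_comm a b]
  simp only [conj_trivial]
  ring

/-- A minimizer of a function that satisfies the inequality of strong convexity has quadratic
growth. -/
lemma quadratic_growth {Q : Set E} (hQ : Convex ℝ Q) {φ : E → ℝ} {κ : ℝ}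
    (hφ : ∀ a ∈ Q, ∀ b ∈ Q, ∀ t : ℝ, 0 < t → t < 1 →
      φ ((1 - t) • a + t • b) + t * (1 - t) * (κ / 2 * ‖b - a‖ ^ 2) ≤ (1 - t) * φ a + t * φ b)
    {x : E} (hx : x ∈ Q) (hmin : ∀ v ∈ Q, φ x ≤ φ v) {v : E} (hv : v ∈ Q) :
    φ x + κ / 2 * ‖v - x‖ ^ 2 ≤ φ v := by
  -- Compare $x$ with the point at parameter $t$ of the segment to $v$, divide by $t$, and let
  -- $t\to0$.
  refine add_le_of_forall_one_sub_mul fun t ht ht1 => ?_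
  have h1 := hφ x hx v hv t ht ht1
  have h2 := hmin _ (hQ hx hv (by linarith) ht.le (by ring) : (1 - t) • x + t • v ∈ Q)
  have h3 : t * (φ x + (1 - t) * (κ / 2 * ‖v - x‖ ^ 2)) ≤ t * φ v := by linarith
  exact le_of_mul_le_mul_left h3 ht

end InnerProduct

section Single

variable {n : ℕ} {Q : Set (Vec n)}

/-- Average the two subgradient inequalities taken at the combination $z$; the linear terms cancel.
-/
lemma StronglyConvexWith.convexCombo_le {μ : ℝ} (hQ : Convex ℝ Q) {f : Vec n → ℝ}
    {g : Vec n → Vec n} (h : StronglyConvexWith μ Q f g) {a b : Vec n} (ha : a ∈ Q) (hb : b ∈ Q)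
    {t : ℝ} (ht : 0 ≤ t) (ht1 : t ≤ 1) :
    f ((1 - t) • a + t • b) + t * (1 - t) * (μ / 2 * ‖b - a‖ ^ 2) ≤ (1 - t) * f a + t * f b := by
  set z := (1 - t) • a + t • b with hz
  have hzQ : z ∈ Q := hQ ha hb (by linarith) ht (by ring)
  have h1 := h z hzQ a ha
  have h2 := h z hzQ b hb
  have e1 : a - z = (-t) • (b - a) := by rw [hz]; module
  have e2 : b - z = (1 - t) • (b - a) := by rw [hz]; module
  rw [e1, inner_smul_right, norm_smul, mul_pow, Real.norm_eq_abs, sq_abs] at h1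
  rw [e2, inner_smul_right, norm_smul, mul_pow, Real.norm_eq_abs, sq_abs] at h2
  have h3 := mul_le_mul_of_nonneg_left h1 (sub_nonneg.2 ht1)
  have h4 := mul_le_mul_of_nonneg_left h2 ht
  linarith

/-- Completing the square turns the prox problem into the projection of a point `c` onto the closed
set $Q$. -/
lemma exists_argmin (hQ : IsClosed Q) (hne : Q.Nonempty) (a x s : Vec n) {β p : ℝ}
    (hβ : 0 < β) (hp : 0 ≤ p) :
    ∃ u ∈ Q, ∀ v ∈ Q, inner ℝ a u + β / 2 * ‖u - x‖ ^ 2 + β * p / 2 * ‖u - s‖ ^ 2 ≤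
      inner ℝ a v + β / 2 * ‖v - x‖ ^ 2 + β * p / 2 * ‖v - s‖ ^ 2 := by
  have hp1 : 1 + p ≠ 0 := by positivity
  have hβ1 : β ≠ 0 := hβ.ne'
  let c : Vec n := (1 + p)⁻¹ • (x + p • s - β⁻¹ • a)
  obtain ⟨u, hu, hmin⟩ := hQ.exists_infDist_eq_dist hne c
  refine ⟨u, hu, fun v hv => ?_⟩
  have key (v : Vec n) : inner ℝ a v + β / 2 * ‖v - x‖ ^ 2 + β * p / 2 * ‖v - s‖ ^ 2 =
      β * (1 + p) / 2 * ‖v - c‖ ^ 2 + (β / 2 * ‖x‖ ^ 2 + β * p / 2 * ‖s‖ ^ 2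
        - β * (1 + p) / 2 * ‖c‖ ^ 2) := by
    have hc : inner ℝ v c = (1 + p)⁻¹ * (inner ℝ v x + p * inner ℝ v s - β⁻¹ * inner ℝ v a) := by
      simp only [c, inner_smul_right, inner_sub_right, inner_add_right]
    rw [norm_sub_sq_real, norm_sub_sq_real, norm_sub_sq_real, hc, real_inner_comm v a]
    field_simp
    ring
  have hd : ‖u - c‖ ≤ ‖v - c‖ := by
    rw [← dist_eq_norm, ← dist_eq_norm, dist_comm u, dist_comm v, ← hmin]
    exact Metric.infDist_le_dist_of_mem hv
  rw [key, key]
  gcongr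

/-- The prox step is well defined, and its result satisfies the three-point inequality. -/
lemma argminOn_spec (hQ : IsClosed Q) (hQc : Convex ℝ Q) (hne : Q.Nonempty) (a x s : Vec n)
    {β p : ℝ} (hβ : 0 < β) (hp : 0 ≤ p) {u : Vec n}
    (hu : u = argminOn Q fun v =>
      inner ℝ a v + β / 2 * ‖v - x‖ ^ 2 + β * p / 2 * ‖v - s‖ ^ 2) :
    u ∈ Q ∧ ∀ v ∈ Q, inner ℝ a u + β / 2 * ‖u - x‖ ^ 2 + β * p / 2 * ‖u - s‖ ^ 2
      + β * (1 + p) / 2 * ‖v - u‖ ^ 2 ≤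
      inner ℝ a v + β / 2 * ‖v - x‖ ^ 2 + β * p / 2 * ‖v - s‖ ^ 2 := by
  have h : u ∈ Q ∧ ∀ v ∈ Q, inner ℝ a u + β / 2 * ‖u - x‖ ^ 2 + β * p / 2 * ‖u - s‖ ^ 2 ≤
      inner ℝ a v + β / 2 * ‖v - x‖ ^ 2 + β * p / 2 * ‖v - s‖ ^ 2 := by
    rw [hu]
    exact Classical.epsilon_spec (exists_argmin hQ hne a x s hβ hp)
  refine ⟨h.1, fun v hv => ?_⟩
  refine quadratic_growth (φ := fun v => inner ℝ a v + β / 2 * ‖v - x‖ ^ 2 +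
    β * p / 2 * ‖v - s‖ ^ 2) hQc (fun a' _ b' _ t _ _ => ?_) h.1 h.2 hv
  have e (y : Vec n) : (1 - t) • a' + t • b' - y = (1 - t) • (a' - y) + t • (b' - y) := by module
  rw [e x, e s, norm_sq_convexCombo, norm_sq_convexCombo, inner_add_right, inner_smul_right,
    inner_smul_right, sub_sub_sub_cancel_right, sub_sub_sub_cancel_right]
  apply le_of_eq
  ring

/-- Along the segment, $f$ minus its quadratic model has nonpositive derivative, by the Lipschitz
bound on the gradient. -/
lemma IsSmoothWith.le_quadratic {L : ℝ} {f : Vec n → ℝ} (h : IsSmoothWith L f) (x y : Vec n) :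
    f y ≤ f x + inner ℝ (gradient f x) (y - x) + L / 2 * ‖y - x‖ ^ 2 := by
  let ψ : ℝ → ℝ := fun t => f (x + t • (y - x)) - t * inner ℝ (gradient f x) (y - x)
    - t ^ 2 * (L / 2 * ‖y - x‖ ^ 2)
  have hd (t : ℝ) : HasDerivAt ψ (inner ℝ (gradient f (x + t • (y - x))) (y - x)
      - inner ℝ (gradient f x) (y - x) - 2 * t * (L / 2 * ‖y - x‖ ^ 2)) t := by
    have h1 : HasDerivAt (fun t : ℝ => x + t • (y - x)) (y - x) t := by
      simpa using ((hasDerivAt_id t).smul_const (y - x)).const_add x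
    have h2 := (h.1 (x + t • (y - x))).hasFDerivAt.comp_hasDerivAt t h1
    rw [← inner_gradient_left] at h2
    have h3 := (hasDerivAt_id t).mul_const (inner ℝ (gradient f x) (y - x))
    have h4 := (hasDerivAt_pow 2 t).mul_const (L / 2 * ‖y - x‖ ^ 2)
    refine ((h2.sub h3).sub h4).congr_deriv ?_
    simp
  have hanti : AntitoneOn ψ (Set.Icc 0 1) := by
    refine antitoneOn_of_deriv_nonpos (convex_Icc 0 1)
      (fun t _ => (hd t).continuousAt.continuousWithinAt)
      (fun t _ => (hd t).differentiableAt.differentiableWithinAt) fun t ht => ?_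
    rw [interior_Icc] at ht
    rw [(hd t).deriv, ← inner_sub_left]
    have h5 := real_inner_le_norm (gradient f (x + t • (y - x)) - gradient f x) (y - x)
    have h6 := h.2 (x + t • (y - x)) x
    rw [add_sub_cancel_left, norm_smul, Real.norm_eq_abs, abs_of_pos ht.1] at h6
    have h7 := mul_le_mul_of_nonneg_right h6 (norm_nonneg (y - x))
    nlinarith
  have := hanti (Set.left_mem_Icc.2 zero_le_one) (Set.right_mem_Icc.2 zero_le_one) zero_le_one
  simp only [ψ, one_smul, zero_smul, add_zero, add_sub_cancel] at this
  linarith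

end Single

/-! ### The averaged problem -/

section Problem

variable {m n : ℕ} {Q : Set (Vec n)} {f : Fin m → Vec n → ℝ} {g : Fin m → Vec n → Vec n}

lemma inner_oracle (x v : Blocks m n) :
    inner ℝ (oracle g x).val v = (m : ℝ)⁻¹ * ∑ k, inner ℝ (g k (x k)) (v k) := by
  simp only [blocks_inner, oracle, inner_smul_left, conj_trivial, Finset.mul_sum]

lemma avgBlocks_consensus (x : Vec n) : avgBlocks f (consensus m x) = avg f x := rfl

lemma avgBlocks_lower {μ : ℝ} (h : ∀ k, StronglyConvexWith μ Q (f k) (g k)) {x y : Blocks m n}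
    (hx : ∀ k, x k ∈ Q) (hy : ∀ k, y k ∈ Q) :
    avgBlocks f x + inner ℝ (oracle g x).val (y - x) + μ / m / 2 * ‖y - x‖ ^ 2 ≤
      avgBlocks f y := by
  rw [inner_oracle, blocks_norm_sq, avgBlocks, avgBlocks]
  have : ∑ k, (f k (x k) + inner ℝ (g k (x k)) ((y - x) k) + μ / 2 * ‖(y - x) k‖ ^ 2) ≤
      ∑ k, f k (y k) := Finset.sum_le_sum fun k _ => h k _ (hx k) _ (hy k)
  rw [Finset.sum_add_distrib, Finset.sum_add_distrib, ← Finset.mul_sum] at this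
  have := mul_le_mul_of_nonneg_left this (show 0 ≤ (m : ℝ)⁻¹ by positivity)
  refine le_trans (le_of_eq ?_) this
  ring

lemma avgBlocks_upper {L : ℝ} (h : ∀ k, IsSmoothWith L (f k)) (x y : Blocks m n) :
    avgBlocks f y ≤ avgBlocks f x + inner ℝ (oracle (fun k => gradient (f k)) x).val (y - x)
      + L / m / 2 * ‖y - x‖ ^ 2 := by
  rw [inner_oracle, blocks_norm_sq, avgBlocks, avgBlocks]
  have : ∑ k, f k (y k) ≤ ∑ k, (f k (x k) + inner ℝ (gradient (f k) (x k)) ((y - x) k)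
      + L / 2 * ‖(y - x) k‖ ^ 2) :=
    Finset.sum_le_sum fun k _ => (h k).le_quadratic _ _
  rw [Finset.sum_add_distrib, Finset.sum_add_distrib, ← Finset.mul_sum] at this
  have := mul_le_mul_of_nonneg_left this (show 0 ≤ (m : ℝ)⁻¹ by positivity)
  refine this.trans (le_of_eq ?_)
  ring

lemma avgBlocks_convexCombo_le (hQ : Convex ℝ Q) (h : ∀ k, StronglyConvexWith 0 Q (f k) (g k))
    {x y : Blocks m n} (hx : ∀ k, x k ∈ Q) (hy : ∀ k, y k ∈ Q) {t : ℝ} (ht : 0 ≤ t)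
    (ht1 : t ≤ 1) :
    avgBlocks f ((1 - t) • x + t • y) ≤ (1 - t) * avgBlocks f x + t * avgBlocks f y := by
  have : ∑ k, f k (((1 - t) • x + t • y) k) ≤ ∑ k, ((1 - t) * f k (x k) + t * f k (y k)) :=
    Finset.sum_le_sum fun k _ => by
      simpa using (h k).convexCombo_le hQ (hx k) (hy k) ht ht1
  rw [Finset.sum_add_distrib, ← Finset.mul_sum, ← Finset.mul_sum] at this
  have := mul_le_mul_of_nonneg_left this (show 0 ≤ (m : ℝ)⁻¹ by positivity)
  rw [avgBlocks, avgBlocks, avgBlocks]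
  refine this.trans (le_of_eq ?_)
  ring

lemma norm_oracle_le {M : ℝ} (hM : 0 ≤ M) {x : Blocks m n} (h : ∀ k, ‖g k (x k)‖ ≤ M) :
    ‖(oracle g x).val‖ ≤ M / √m := by
  refine abs_le_of_sq_le_sq' ?_ (by positivity) |>.2
  rw [div_pow, Real.sq_sqrt (by positivity), blocks_norm_sq]
  have : ∑ k, ‖(oracle g x).val k‖ ^ 2 ≤ ∑ _k : Fin m, ((m : ℝ)⁻¹ * M) ^ 2 := by
    refine Finset.sum_le_sum fun k _ => ?_
    simp only [oracle, norm_smul, norm_inv, Real.norm_natCast]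
    gcongr
    exact h k
  refine this.trans (le_of_eq ?_)
  rcases eq_or_ne (m : ℝ) 0 with h0 | h0
  · simp [h0]
  · simp only [Finset.sum_const, Finset.card_univ, Fintype.card_fin, nsmul_eq_mul]
    field_simp

lemma norm_oracle_sub_le {L : ℝ} (hL : 0 ≤ L) (h : ∀ k x y, ‖g k x - g k y‖ ≤ L * ‖x - y‖)
    (x y : Blocks m n) : ‖(oracle g x).val - (oracle g y).val‖ ≤ L / m * ‖x - y‖ := by
  refine abs_le_of_sq_le_sq' ?_ (by positivity) |>.2
  rw [mul_pow, blocks_norm_sq, blocks_norm_sq, Finset.mul_sum]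
  refine Finset.sum_le_sum fun k _ => ?_
  rw [← mul_pow]
  simp only [oracle, PiLp.sub_apply, ← smul_sub, norm_smul, norm_inv, Real.norm_natCast]
  have := h k (x k) (y k)
  have h2 := mul_le_mul_of_nonneg_left this (show 0 ≤ (m : ℝ)⁻¹ by positivity)
  refine pow_le_pow_left₀ (by positivity) (h2.trans (le_of_eq ?_)) 2
  ring

lemma avg_stronglyConvex (hm : m ≠ 0) {μ : ℝ} (h : ∀ k, StronglyConvexWith μ Q (f k) (g k)) :
    StronglyConvexWith μ Q (avg f) (fun x => (m : ℝ)⁻¹ • ∑ k, g k x) := by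
  intro x hx y hy
  have hm' : (m : ℝ) ≠ 0 := by exact_mod_cast hm
  have := avgBlocks_lower h (x := consensus m x) (y := consensus m y) (fun _ => hx) (fun _ => hy)
  rw [inner_oracle, ← consensus_sub, consensus_norm_sq, avgBlocks_consensus,
    avgBlocks_consensus] at this
  rw [inner_smul_left, sum_inner]
  refine le_trans (le_of_eq ?_) this
  simp only [conj_trivial, consensus_apply]
  field_simp

lemma avg_growth (hm : m ≠ 0) {μ : ℝ} (hQ : Convex ℝ Q)
    (h : ∀ k, StronglyConvexWith μ Q (f k) (g k)) {xs : Vec n} (hxs : xs ∈ Q)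
    (hmin : IsMinOn (avg f) Q xs) {x : Vec n} (hx : x ∈ Q) :
    avg f xs + μ / 2 * ‖x - xs‖ ^ 2 ≤ avg f x :=
  quadratic_growth hQ (fun _ ha _ hb _ ht ht1 =>
    (avg_stronglyConvex hm h).convexCombo_le hQ ha hb ht.le ht1.le) hxs (fun _ hv => hmin hv) hx

lemma sum_gradient_eq_zero (hm : m ≠ 0) (hd : ∀ k, Differentiable ℝ (f k)) {xs : Vec n}
    (hmin : IsMinOn (avg f) Set.univ xs) : ∑ k, gradient (f k) xs = 0 := by
  have hm' : (m : ℝ) ≠ 0 := by exact_mod_cast hm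
  have h1 : HasFDerivAt (avg f) ((m : ℝ)⁻¹ • ∑ k, fderiv ℝ (f k) xs) xs := by
    unfold avg
    exact (HasFDerivAt.fun_sum fun k _ => (hd k xs).hasFDerivAt).const_mul _
  have h2 : IsLocalMin (avg f) xs := hmin.isLocalMin Filter.univ_mem
  have h3 := h2.hasFDerivAt_eq_zero h1
  rw [smul_eq_zero_iff_right (inv_ne_zero hm')] at h3
  have h4 : ∀ v, inner ℝ (∑ k, gradient (f k) xs) v = 0 := fun v => by
    rw [sum_inner, Finset.sum_congr rfl fun k _ => inner_gradient_left,
      ← sum_apply, h3, zero_apply]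
  exact inner_self_eq_zero.1 (h4 _)

variable {G : SimpleGraph (Fin m)} [DecidableRel G.Adj]

lemma norm_sub_consensus_sq (hm : 2 ≤ m) (x : Blocks m n) (v : Vec n) :
    ‖x - consensus m v‖ ^ 2 = ‖x - consensus m (mean x)‖ ^ 2 + m * ‖mean x - v‖ ^ 2 := by
  have e : x - consensus m v = (x - consensus m (mean x)) + consensus m (mean x - v) := by
    rw [consensus_sub]; abel
  have h0 : inner ℝ (x - consensus m (mean x)) (consensus m (mean x - v)) = 0 := by
    rw [blocks_inner]
    simp only [consensus_apply]
    rw [← sum_inner, sum_sub_mean hm, inner_zero_left]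
  rw [e, norm_add_sq_real, h0, consensus_norm_sq]
  ring

lemma mul_norm_sub_mean_le (hm : 2 ≤ m) (hG : G.Connected) {M : ℝ} (hM : 0 < M)
    (x : Blocks m n) :
    M / √m * ‖x - consensus m (mean x)‖ ≤ dualRadius G M * ‖sqrtLapApply G x‖ := by
  have hl := lamMinPos_pos hm hG
  have h1 := norm_sub_mean_le hm hG x
  have hm' : (0 : ℝ) < m := by positivity
  have h2 : √(lamMinPos G) * ‖x - consensus m (mean x)‖ ≤ ‖sqrtLapApply G x‖ := by
    refine abs_le_of_sq_le_sq' ?_ (by positivity) |>.2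
    rwa [mul_pow, Real.sq_sqrt hl.le]
  have h3 : dualRadius G M = M / √m / √(lamMinPos G) := by
    rw [dualRadius, Real.sqrt_mul hm'.le, div_div]
  have hs : 0 < √(lamMinPos G) := Real.sqrt_pos.2 hl
  rw [h3, div_mul_eq_mul_div (M / √m), le_div_iff₀ hs, mul_assoc]
  gcongr
  linarith

lemma dualRadius_pos (hm : 2 ≤ m) (hG : G.Connected) {M : ℝ} (hM : 0 < M) :
    0 < dualRadius G M := by
  have hl := lamMinPos_pos hm hG
  have hm' : (0 : ℝ) < m := by positivity
  exact div_pos hM (Real.sqrt_pos.2 (by positivity))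

/-- The exact penalty property of `‖√W 𝐱‖`, for bounded subgradients. -/
lemma exact_penalty_lipschitz (hm : 2 ≤ m) (hG : G.Connected) {M μ : ℝ} (hM : 0 < M)
    (hQ : Convex ℝ Q) (h : ∀ k, StronglyConvexWith μ Q (f k) (g k))
    (hg : ∀ k, ∀ x ∈ Q, ‖g k x‖ ≤ M) {xs : Vec n} (hxs : xs ∈ Q)
    (hmin : IsMinOn (avg f) Q xs) {x : Blocks m n} (hx : ∀ k, x k ∈ Q) :
    avg f xs + μ / m / 2 * ‖x - consensus m xs‖ ^ 2 ≤
      avgBlocks f x + dualRadius G M * ‖sqrtLapApply G x‖ := by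
  have hm' : (0 : ℝ) < m := by positivity
  have hmean : mean x ∈ Q := by
    rw [mean, Finset.smul_sum]
    refine hQ.sum_mem (fun _ _ => by positivity) ?_ fun k _ => hx k
    simp [hm'.ne']
  have h1 := avg_growth (by omega) hQ h hxs hmin hmean
  -- Linearization at the mean: its subgradients are bounded by $M$, so the linear term costs at
  -- most $M/\sqrt m$ times the deviation. The strong convexity here and the growth of $f$ at the
  -- mean add up, by Pythagoras, to the full distance from `xs`.
  have h2 := avgBlocks_lower h (x := consensus m (mean x)) (fun _ => hmean) hx
  have h3 := norm_oracle_le hM.le (g := g) (x := consensus m (mean x)) fun k => hg k _ hmean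
  have h4 := abs_le.1 (abs_real_inner_le_norm (oracle g (consensus m (mean x))).val
    (x - consensus m (mean x))) |>.1
  have h5 := mul_le_mul_of_nonneg_right h3 (norm_nonneg (x - consensus m (mean x)))
  have h6 := mul_norm_sub_mean_le hm hG hM x
  rw [norm_sub_consensus_sq hm, mul_add]
  rw [avgBlocks_consensus] at h2
  have h7 : μ / m / 2 * (m * ‖mean x - xs‖ ^ 2) = μ / 2 * ‖mean x - xs‖ ^ 2 := by
    field_simp
  linarith

/-- The exact penalty property of `‖√W 𝐱‖`, for gradients bounded at the solution. -/
lemma exact_penalty_smooth (hm : 2 ≤ m) (hG : G.Connected) {M : ℝ} (hM : 0 < M)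
    (h : ∀ k, StronglyConvexWith 0 Set.univ (f k) (gradient (f k)))
    (hd : ∀ k, Differentiable ℝ (f k)) {xs : Vec n} (hmin : IsMinOn (avg f) Set.univ xs)
    (hg : ∀ k, ‖gradient (f k) xs‖ ≤ M) (x : Blocks m n) :
    avg f xs ≤ avgBlocks f x + dualRadius G M * ‖sqrtLapApply G x‖ := by
  have h2 := avgBlocks_lower h (x := consensus m xs) (y := x) (fun _ => trivial) fun _ => trivial
  set d := (oracle (fun k => gradient (f k)) (consensus m xs)).val with hdd
  -- Optimality makes the gradients at `xs` sum to zero, so moving along consensus directions has no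
  -- first-order effect.
  have h0 : inner ℝ d (consensus m (mean x - xs)) = 0 := by
    rw [hdd, inner_oracle]
    simp only [consensus_apply]
    rw [← sum_inner, sum_gradient_eq_zero (by omega) hd hmin, inner_zero_left, mul_zero]
  have e : x - consensus m xs = (x - consensus m (mean x)) + consensus m (mean x - xs) := by
    rw [consensus_sub]; abel
  rw [e, inner_add_right, h0, add_zero, avgBlocks_consensus] at h2
  have h3 : ‖d‖ ≤ M / √m := norm_oracle_le hM.le hg
  have h4 := abs_le.1 (abs_real_inner_le_norm d (x - consensus m (mean x))) |>.1
  have h5 := mul_le_mul_of_nonneg_right h3 (norm_nonneg (x - consensus m (mean x)))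
  have h6 := mul_norm_sub_mean_le hm hG hM x
  simp only [zero_div, zero_mul, add_zero] at h2
  linarith

/-- The penalized objective. -/
def penalized (G : SimpleGraph (Fin m)) [DecidableRel G.Adj] (f : Fin m → Vec n → ℝ) (ρ : ℝ)
    (x : Blocks m n) : ℝ :=
  avgBlocks f x + ρ * ‖sqrtLapApply G x‖ ^ 2

lemma penalized_consensus (ρ : ℝ) (x : Vec n) : penalized G f ρ (consensus m x) = avg f x := by
  simp [penalized, sqrtLapApply_consensus, avgBlocks_consensus]

/-- Subtracting the exact penalty inequality from the gap leaves $(rs)^2-\delta\,rs\le2\delta^2$, a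
quadratic inequality in $rs$ whose positive root is $2\delta$. -/
lemma norm_sqrtLapApply_le_of_gap {M δ ρ : ℝ} (hR : 0 < dualRadius G M) (hδ : 0 < δ)
    (hρ : ρ = penaltyCoeff G M δ) {xs : Vec n} {x : Blocks m n}
    (hex : avg f xs ≤ avgBlocks f x + dualRadius G M * ‖sqrtLapApply G x‖)
    (hgap : penalized G f ρ x - avg f xs ≤ 2 * δ) :
    ‖sqrtLapApply G x‖ ≤ 2 * δ / dualRadius G M := by
  set s := ‖sqrtLapApply G x‖
  set r := dualRadius G M
  have h1 : r ^ 2 / δ * s ^ 2 - r * s ≤ 2 * δ := by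
    have : penalized G f ρ x = avgBlocks f x + r ^ 2 / δ * s ^ 2 := by rw [hρ]; rfl
    linarith
  have h2 : (r * s) ^ 2 - δ * (r * s) ≤ 2 * δ * δ := by
    have := mul_le_mul_of_nonneg_right h1 hδ.le
    have e : (r ^ 2 / δ * s ^ 2 - r * s) * δ = (r * s) ^ 2 - δ * (r * s) := by field_simp
    linarith
  have h3 : r * s ≤ 2 * δ := by
    by_contra! h
    nlinarith
  rw [le_div_iff₀ hR]
  linarith

lemma isEpsSolution_of_gap {M δ ρ ε : ℝ} (hR : 0 < dualRadius G M) (hδ : 0 < δ)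
    (hρ : ρ = penaltyCoeff G M δ) {xs : Vec n} {x : Blocks m n} (hx : ∀ k, x k ∈ Q)
    (hex : avg f xs ≤ avgBlocks f x + dualRadius G M * ‖sqrtLapApply G x‖)
    (hgap : penalized G f ρ x - avg f xs ≤ 2 * δ) (hε : 2 * δ ≤ ε) :
    IsEpsSolution G Q f M xs ε x := by
  refine ⟨hx, ?_, (norm_sqrtLapApply_le_of_gap hR hδ hρ hex hgap).trans (by gcongr)⟩
  have : 0 ≤ ρ * ‖sqrtLapApply G x‖ ^ 2 := by rw [hρ, penaltyCoeff]; positivity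
  rw [penalized] at hgap
  linarith

lemma isEpsSolution_consensus {M ε : ℝ} (hR : 0 < dualRadius G M) (hε : 0 ≤ ε)
    {xs x : Vec n} (hx : x ∈ Q) (hgap : avg f x - avg f xs ≤ ε) :
    IsEpsSolution G Q f M xs ε (consensus m x) :=
  ⟨fun _ => hx, hgap, by rw [sqrtLapApply_consensus, norm_zero]; positivity⟩

lemma avg_gap_le_of_smooth (hm : m ≠ 0) {L : ℝ} (h : ∀ k, IsSmoothWith L (f k)) {xs : Vec n}
    (hmin : IsMinOn (avg f) Set.univ xs) (x : Vec n) :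
    avg f x - avg f xs ≤ L / 2 * ‖x - xs‖ ^ 2 := by
  have hm' : (m : ℝ) ≠ 0 := by exact_mod_cast hm
  have h1 := avgBlocks_upper h (consensus m xs) (consensus m x)
  rw [inner_oracle, ← consensus_sub, consensus_norm_sq, avgBlocks_consensus,
    avgBlocks_consensus] at h1
  simp only [consensus_apply] at h1
  rw [← sum_inner, sum_gradient_eq_zero hm (fun k => (h k).1) hmin, inner_zero_left] at h1
  have e : L / m / 2 * (m * ‖x - xs‖ ^ 2) = L / 2 * ‖x - xs‖ ^ 2 := by field_simp
  linarith

lemma avg_gap_le_of_lipschitz (hm : 2 ≤ m) {M μ : ℝ}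
    (h : ∀ k, StronglyConvexWith μ Q (f k) (g k))
    {x xs : Vec n} (hx : x ∈ Q) (hxs : xs ∈ Q) (hg : ∀ k, ‖g k x‖ ≤ M) :
    avg f x - avg f xs ≤ M * ‖x - xs‖ - μ / 2 * ‖x - xs‖ ^ 2 := by
  have hm' : (0 : ℝ) < m := by positivity
  have h1 := avg_stronglyConvex (by omega) h x hx xs hxs
  have h2 := abs_le.1 (abs_real_inner_le_norm ((m : ℝ)⁻¹ • ∑ k, g k x) (xs - x)) |>.1
  have h3 : ‖(m : ℝ)⁻¹ • ∑ k, g k x‖ ≤ M := by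
    rw [norm_smul, norm_inv, Real.norm_natCast, inv_mul_le_iff₀ hm']
    refine (norm_sum_le _ _).trans ((Finset.sum_le_sum fun k _ => hg k).trans (le_of_eq ?_))
    simp
  have h4 := mul_le_mul_of_nonneg_right h3 (norm_nonneg (xs - x))
  rw [norm_sub_rev xs x] at *
  linarith

end Problem

/-! ### Bookkeeping of values and costs -/

section RunLemmas

variable {α β : Type}

@[simp] lemma run_pure_val (a : α) : (pure a : Run α).val = a := rfl
@[simp] lemma run_pure_rounds (a : α) : (pure a : Run α).rounds = 0 := rfl
@[simp] lemma run_pure_calls (a : α) : (pure a : Run α).calls = 0 := rfl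
@[simp] lemma run_bind_val (r : Run α) (f : α → Run β) : (r >>= f).val = (f r.val).val := rfl
@[simp] lemma run_bind_rounds (r : Run α) (f : α → Run β) :
    (r >>= f).rounds = r.rounds + (f r.val).rounds := rfl
@[simp] lemma run_bind_calls (r : Run α) (f : α → Run β) :
    (r >>= f).calls = r.calls + (f r.val).calls := rfl

end RunLemmas

/-! ### The penalty as a quadratic function -/

section Gossip

variable {m n : ℕ} {G : SimpleGraph (Fin m)} [DecidableRel G.Adj]

@[simp] lemma gossip_rounds (x : Blocks m n) : (gossip G x).rounds = 1 := rfl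
@[simp] lemma gossip_calls (x : Blocks m n) : (gossip G x).calls = 0 := rfl
@[simp] lemma oracle_rounds (g : Fin m → Vec n → Vec n) (x : Blocks m n) :
    (oracle g x).rounds = 0 := rfl
@[simp] lemma oracle_calls (g : Fin m → Vec n → Vec n) (x : Blocks m n) :
    (oracle g x).calls = 1 := rfl

lemma sqrtLap_sq_expand (a b : Blocks m n) :
    ‖sqrtLapApply G b‖ ^ 2 = ‖sqrtLapApply G a‖ ^ 2
      + 2 * inner ℝ (kronApply (G.lapMatrix ℝ) a) (b - a) + ‖sqrtLapApply G (b - a)‖ ^ 2 := by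
  have h : sqrtLapApply G b = sqrtLapApply G a + sqrtLapApply G (b - a) := by
    simp only [sqrtLapApply, kronApply_eq]
    rw [← map_add, add_sub_cancel]
  have hi (x y : Blocks m n) : inner ℝ (sqrtLapApply G x) (sqrtLapApply G y) =
      inner ℝ (kronApply (G.lapMatrix ℝ) x) y := by
    have h0 : 0 ≤ G.lapMatrix ℝ :=
      Matrix.nonneg_iff_posSemidef.2 (G.posSemidef_lapMatrix (R := ℝ))
    have hs : (CFC.sqrt (G.lapMatrix ℝ)).IsHermitian :=
      (Matrix.nonneg_iff_posSemidef.1 (CFC.sqrt_nonneg _)).isHermitian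
    rw [sqrtLapApply, sqrtLapApply, inner_kronApply_symm hs, kronApply_kronApply,
      CFC.sqrt_mul_sqrt_self _ h0, inner_kronApply_symm (lap_isHermitian G)]
  rw [h, norm_add_sq_real, hi]

lemma sqrtLap_sq_le (x : Blocks m n) : ‖sqrtLapApply G x‖ ^ 2 ≤ lamMax G * ‖x‖ ^ 2 := by
  rw [norm_sqrtLapApply_sq]
  exact inner_lap_le G x

lemma sqrtLap_sq_convexCombo_le (a b : Blocks m n) {t : ℝ} (ht : 0 ≤ t) (ht1 : t ≤ 1) :
    ‖sqrtLapApply G ((1 - t) • a + t • b)‖ ^ 2 ≤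
      (1 - t) * ‖sqrtLapApply G a‖ ^ 2 + t * ‖sqrtLapApply G b‖ ^ 2 := by
  have h : sqrtLapApply G ((1 - t) • a + t • b) =
      (1 - t) • sqrtLapApply G a + t • sqrtLapApply G b := by
    simp only [sqrtLapApply, kronApply_eq, map_add, map_smul]
  rw [h, norm_sq_convexCombo]
  have : 0 ≤ t * (1 - t) * ‖sqrtLapApply G b - sqrtLapApply G a‖ ^ 2 := by
    have := sub_nonneg.2 ht1
    positivity
  linarith

end Gossip

/-! ### Gradient sliding -/

section Sliding

variable {m n : ℕ} {Q : Set (Vec n)} {f : Fin m → Vec n → ℝ} {g : Fin m → Vec n → Vec n}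

lemma proxSliding_rounds (l x : Blocks m n) (β : ℝ) (T : ℕ) :
    (proxSliding Q g l x β T).rounds = 0 := by
  induction T with
  | zero => rfl
  | succ T ih => simp [proxSliding, ih]

lemma proxSliding_calls (l x : Blocks m n) (β : ℝ) (T : ℕ) :
    (proxSliding Q g l x β T).calls = T := by
  induction T with
  | zero => rfl
  | succ T ih => simp [proxSliding, ih]

/-- The prox step of all nodes together. -/
lemma blocks_argminOn_spec (hQ : IsClosed Q) (hQc : Convex ℝ Q) (hne : Q.Nonempty)
    (a x s : Blocks m n) {β p : ℝ} (hβ : 0 < β) (hp : 0 ≤ p) {u : Blocks m n}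
    (hu : u = WithLp.toLp 2 fun i => argminOn Q fun v =>
      inner ℝ (a i) v + β / 2 * ‖v - x i‖ ^ 2 + β * p / 2 * ‖v - s i‖ ^ 2) :
    (∀ i, u i ∈ Q) ∧ ∀ v : Blocks m n, (∀ i, v i ∈ Q) →
      inner ℝ a u + β / 2 * ‖u - x‖ ^ 2 + β * p / 2 * ‖u - s‖ ^ 2
        + β * (1 + p) / 2 * ‖v - u‖ ^ 2 ≤
      inner ℝ a v + β / 2 * ‖v - x‖ ^ 2 + β * p / 2 * ‖v - s‖ ^ 2 := by
  have h (i : Fin m) := argminOn_spec hQ hQc hne (a i) (x i) (s i) hβ hp (u := u i) (by rw [hu])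
  refine ⟨fun i => (h i).1, fun v hv => ?_⟩
  have := Finset.sum_le_sum fun i (_ : i ∈ Finset.univ) => (h i).2 (v i) (hv i)
  simp only [Finset.sum_add_distrib, ← Finset.mul_sum] at this
  simpa only [blocks_inner, blocks_norm_sq, PiLp.sub_apply] using this

/-- Absorbs the non-smoothness error $2Br$ of one inner step into its proximal quadratic. -/
lemma mul_sub_mul_sq_le {B κ : ℝ} (hκ : 0 < κ) (r : ℝ) :
    2 * B * r - κ / 2 * r ^ 2 ≤ 2 * B ^ 2 / κ := by
  rw [le_div_iff₀ hκ]
  nlinarith [sq_nonneg (κ * r - 2 * B)]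

/-- The iterate $u_t$ gets weight $t+1$; these weights sum to $T(T+3)/2$, and $\theta_t$ is the
share of the last one. After multiplication by $t+1$, the choice $p_t=t/2$ gives the squared
distances from $v$ to $u_{t-1}$ and $u_t$ the coefficients $\frac\beta2\cdot\frac{t(t+1)}2$ and
$\frac\beta2\cdot\frac{(t+1)(t+2)}2$, so the steps telescope. Each step leaves an error of at most
$8B^2/\beta$. -/
lemma proxSliding_spec (hQ : IsClosed Q) (hQc : Convex ℝ Q)
    (h : ∀ k, StronglyConvexWith 0 Q (f k) (g k)) {B β : ℝ} (hβ : 0 < β)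
    (hB : ∀ y : Blocks m n, (∀ i, y i ∈ Q) → ‖(oracle g y).val‖ ≤ B)
    (l x : Blocks m n) (hx : ∀ i, x i ∈ Q) (hne : Q.Nonempty) (T : ℕ) :
    (∀ i, (proxSliding Q g l x β T).val.1 i ∈ Q) ∧
    (∀ i, (proxSliding Q g l x β T).val.2 i ∈ Q) ∧
    ∀ v : Blocks m n, (∀ i, v i ∈ Q) →
      T * (T + 3) / 2 * ((inner ℝ l (proxSliding Q g l x β T).val.2
          + avgBlocks f (proxSliding Q g l x β T).val.2
          + β / 2 * ‖(proxSliding Q g l x β T).val.2 - x‖ ^ 2)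
        - (inner ℝ l v + avgBlocks f v + β / 2 * ‖v - x‖ ^ 2))
        + β / 2 * ((T + 1) * (T + 2) / 2) * ‖v - (proxSliding Q g l x β T).val.1‖ ^ 2 ≤
      β / 2 * ‖v - x‖ ^ 2 + 8 * T * B ^ 2 / β := by
  induction T with
  | zero =>
    refine ⟨hx, hx, fun v _ => ?_⟩
    simp [proxSliding]
  | succ T ih =>
    set s := (proxSliding Q g l x β T).val with hs
    obtain ⟨hs1, hs2, hs3⟩ := ih
    set t : ℝ := T + 1 with ht
    have ht0 : 1 ≤ t := by rw [ht]; linarith [T.cast_nonneg (α := ℝ)]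
    set θ : ℝ := 2 * (t + 1) / (t * (t + 3)) with hθ
    have hval : (proxSliding Q g l x β (T + 1)).val =
      (WithLp.toLp 2 fun i => argminOn Q fun v =>
        inner ℝ ((l + (oracle g s.1).val) i) v + β / 2 * ‖v - x i‖ ^ 2
          + β * (t / 2) / 2 * ‖v - s.1 i‖ ^ 2,
        (1 - θ) • s.2 + θ • WithLp.toLp 2 fun i => argminOn Q fun v =>
        inner ℝ ((l + (oracle g s.1).val) i) v + β / 2 * ‖v - x i‖ ^ 2
          + β * (t / 2) / 2 * ‖v - s.1 i‖ ^ 2) := rfl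
    set u : Blocks m n := WithLp.toLp 2 fun i => argminOn Q fun v =>
        inner ℝ ((l + (oracle g s.1).val) i) v + β / 2 * ‖v - x i‖ ^ 2
          + β * (t / 2) / 2 * ‖v - s.1 i‖ ^ 2 with hu
    obtain ⟨huQ, hu3⟩ := blocks_argminOn_spec hQ hQc hne (l + (oracle g s.1).val) x s.1 hβ
      (p := t / 2) (by positivity) hu
    have hθ0 : 0 ≤ θ := by positivity
    have hθ1 : θ ≤ 1 := by
      rw [hθ, div_le_one (by positivity)]; nlinarith
    rw [hval]
    have hcomb : ∀ i, ((1 - θ) • s.2 + θ • u) i ∈ Q := fun i =>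
      hQc (hs2 i) (huQ i) (by linarith) hθ0 (by ring)
    refine ⟨huQ, hcomb, fun v hv => ?_⟩
    dsimp only
    have h1 := hu3 v hv
    have h2 := hs3 v hv
    have h3 := avgBlocks_lower h hs1 hv
    have h4 := avgBlocks_lower h huQ hs1
    -- $F$ has no smoothness, so $F(u)$ is compared with its linearization at the previous point by
    -- two subgradient bounds; together they cost $2B\|u-u_{t-1}\|$.
    have h5 : inner ℝ (oracle g u).val (s.1 - u) ≥ - (B * ‖u - s.1‖) := by
      have := abs_le.1 (abs_real_inner_le_norm (oracle g u).val (s.1 - u)) |>.1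
      have h' := mul_le_mul_of_nonneg_right (hB u huQ) (norm_nonneg (s.1 - u))
      rw [norm_sub_rev s.1 u] at *
      linarith
    have h6 : inner ℝ (oracle g s.1).val (u - s.1) ≥ - (B * ‖u - s.1‖) := by
      have := abs_le.1 (abs_real_inner_le_norm (oracle g s.1).val (u - s.1)) |>.1
      have h' := mul_le_mul_of_nonneg_right (hB s.1 hs1) (norm_nonneg (u - s.1))
      linarith
    have h7 := avgBlocks_convexCombo_le hQc h hs2 huQ hθ0 hθ1
    have h8 : ‖(1 - θ) • s.2 + θ • u - x‖ ^ 2 ≤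
        (1 - θ) * ‖s.2 - x‖ ^ 2 + θ * ‖u - x‖ ^ 2 := by
      have e : (1 - θ) • s.2 + θ • u - x = (1 - θ) • (s.2 - x) + θ • (u - x) := by module
      rw [e, norm_sq_convexCombo]
      have : 0 ≤ θ * (1 - θ) * ‖u - x - (s.2 - x)‖ ^ 2 := by
        have := sub_nonneg.2 hθ1
        positivity
      linarith
    have h9 := mul_sub_mul_sq_le (B := B) (κ := β * (t / 2)) (by positivity) ‖u - s.1‖
    -- one step, for the last iterate
    have hstep : (inner ℝ l u + avgBlocks f u + β / 2 * ‖u - x‖ ^ 2)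
        - (inner ℝ l v + avgBlocks f v + β / 2 * ‖v - x‖ ^ 2) ≤
        β * (t / 2) / 2 * ‖v - s.1‖ ^ 2 - β * (1 + t / 2) / 2 * ‖v - u‖ ^ 2
          + 2 * B ^ 2 / (β * (t / 2)) := by
      rw [inner_add_left, inner_add_left] at h1
      rw [inner_sub_right] at h3 h6
      simp only [zero_div, zero_mul, add_zero] at h3 h4
      linarith
    have hW : (t + 1) * (2 * B ^ 2 / (β * (t / 2))) ≤ 8 * B ^ 2 / β := by
      have e : (t + 1) * (2 * B ^ 2 / (β * (t / 2))) = 4 * B ^ 2 / β * ((t + 1) / t) := by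
        field_simp; ring
      have h2t : (t + 1) / t ≤ 2 := by rw [div_le_iff₀ (by linarith)]; linarith
      have : 4 * B ^ 2 / β * ((t + 1) / t) ≤ 4 * B ^ 2 / β * 2 := by gcongr
      rw [e]
      refine this.trans (le_of_eq ?_)
      ring
    have hstep2 := mul_le_mul_of_nonneg_left hstep (show 0 ≤ t + 1 by linarith)
    -- $\theta_t$ is the weight $t+1$ divided by the cumulative weight.
    have ha : (t * (t + 3) / 2) * θ = t + 1 := by
      rw [hθ]; field_simp
    have hT : (T : ℝ) = t - 1 := by rw [ht]; ring
    set Φv := inner ℝ l v + avgBlocks f v + β / 2 * ‖v - x‖ ^ 2 with hΦv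
    set Φu := inner ℝ l u + avgBlocks f u + β / 2 * ‖u - x‖ ^ 2 with hΦu
    set Φs := inner ℝ l s.2 + avgBlocks f s.2 + β / 2 * ‖s.2 - x‖ ^ 2 with hΦs
    have hconv : inner ℝ l ((1 - θ) • s.2 + θ • u) + avgBlocks f ((1 - θ) • s.2 + θ • u)
        + β / 2 * ‖(1 - θ) • s.2 + θ • u - x‖ ^ 2 ≤ (1 - θ) * Φs + θ * Φu := by
      have := mul_le_mul_of_nonneg_left h8 (show 0 ≤ β / 2 by linarith)
      rw [inner_add_right, inner_smul_right, inner_smul_right, hΦs, hΦu]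
      linarith
    have hconv2 := mul_le_mul_of_nonneg_left hconv (show 0 ≤ t * (t + 3) / 2 by positivity)
    have e1 : t * (t + 3) / 2 * ((1 - θ) * Φs + θ * Φu) =
        (t * (t + 3) / 2 - (t + 1)) * Φs + (t + 1) * Φu := by
      linear_combination (Φu - Φs) * ha
    push_cast
    rw [hT] at h2 ⊢
    have e2 : 8 * (t - 1 + 1) * B ^ 2 / β = 8 * (t - 1) * B ^ 2 / β + 8 * B ^ 2 / β := by ring
    rw [e2]
    have e3 : t - 1 + 1 = t := by ring
    rw [e3]
    rw [e1] at hconv2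
    ring_nf at *
    linarith

variable {G : SimpleGraph (Fin m)} [DecidableRel G.Adj]

lemma slidingLoop_rounds (ρ : ℝ) (T : ℕ → ℕ) (x₀ : Blocks m n) (N : ℕ) :
    (slidingLoop G Q g ρ T x₀ N).rounds = N := by
  induction N with
  | zero => rfl
  | succ N ih => simp [slidingLoop, ih, proxSliding_rounds]

lemma slidingLoop_calls (ρ : ℝ) (T : ℕ) (x₀ : Blocks m n) (N : ℕ) :
    (slidingLoop G Q g ρ (fun _ => T) x₀ N).calls = N * T := by
  induction N with
  | zero => simp [slidingLoop]
  | succ N ih => simp [slidingLoop, ih, proxSliding_calls, add_mul]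

/-- With the weight $k(k+1)$ on outer step $k$, the gap terms telescope and the coefficient of the
prox distance is $2\Lambda$ for every $k$. The accumulated errors $\sum k^2$ are bounded by $N^3$.
-/
lemma sliding_coefficients {k Λ γ β t B : ℝ} (hk : 1 ≤ k) (hΛ : 0 < Λ) (ht : 0 < t)
    (hγ : γ = 2 / (k + 1)) (hβ : β = 2 * Λ / k) :
    Λ * γ ^ 2 ≤ γ * β ∧ k * (k + 1) * (1 - γ) = (k - 1) * k ∧
      k * (k + 1) * (γ * (β / 2)) = 2 * Λ ∧
      k * (k + 1) * (γ * (16 * B ^ 2 / (β * t))) = 16 * k ^ 2 * B ^ 2 / (Λ * t) ∧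
      16 * (k - 1) ^ 3 * B ^ 2 / (Λ * t) + 16 * k ^ 2 * B ^ 2 / (Λ * t) ≤
        16 * k ^ 3 * B ^ 2 / (Λ * t) := by
  have hk0 : 0 < k := by linarith
  refine ⟨?_, ?_, ?_, ?_, ?_⟩
  · have h1 : γ ≤ 2 / k := by rw [hγ]; gcongr; simp
    have h2 : 0 < γ := by rw [hγ]; positivity
    calc Λ * γ ^ 2 = Λ * γ * γ := by ring
      _ ≤ Λ * γ * (2 / k) := by gcongr
      _ = γ * β := by rw [hβ]; ring
  · rw [hγ]; field_simp; ring
  · rw [hγ, hβ]; field_simp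
  · rw [hγ, hβ]; field_simp
  · rw [← add_div]
    apply div_le_div_of_nonneg_right _ (by positivity)
    have : (k - 1) ^ 3 + k ^ 2 ≤ k ^ 3 := by nlinarith
    have := mul_le_mul_of_nonneg_right this (show 0 ≤ 16 * B ^ 2 by positivity)
    linarith

set_option maxHeartbeats 1000000 in
-- The number of inner steps is the same in all outer steps, so that the factor $1+c$ is constant
-- and the distances to the prox centers telescope.
lemma slidingLoop_spec (hQ : IsClosed Q) (hQc : Convex ℝ Q)
    (h : ∀ k, StronglyConvexWith 0 Q (f k) (g k)) {B ρ Λ c : ℝ}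
    (hB : ∀ y : Blocks m n, (∀ i, y i ∈ Q) → ‖(oracle g y).val‖ ≤ B) (hρ : 0 ≤ ρ)
    (hΛ : Λ = 2 * ρ * lamMax G) (hΛ0 : 0 < Λ) {T : ℕ} (hT : 1 ≤ T)
    (hc : c = 2 / (T * (T + 3))) (x₀ : Blocks m n) (hx₀ : ∀ i, x₀ i ∈ Q) (hne : Q.Nonempty)
    (N : ℕ) :
    (∀ i, (slidingLoop G Q g ρ (fun _ => T) x₀ N).val.1 i ∈ Q) ∧
    (∀ i, (slidingLoop G Q g ρ (fun _ => T) x₀ N).val.2 i ∈ Q) ∧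
    ∀ v : Blocks m n, (∀ i, v i ∈ Q) →
      N * (N + 1) * (penalized G f ρ (slidingLoop G Q g ρ (fun _ => T) x₀ N).val.2
          - penalized G f ρ v)
        + 2 * Λ * (1 + c) * ‖v - (slidingLoop G Q g ρ (fun _ => T) x₀ N).val.1‖ ^ 2 ≤
      2 * Λ * (1 + c) * ‖v - x₀‖ ^ 2 + 16 * N ^ 3 * B ^ 2 / (Λ * (T + 3)) := by
  have hT' : (1 : ℝ) ≤ T := by exact_mod_cast hT
  induction N with
  | zero =>
    refine ⟨hx₀, hx₀, fun v _ => ?_⟩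
    simp [slidingLoop]
  | succ N ih =>
    set s := (slidingLoop G Q g ρ (fun _ => T) x₀ N).val with hs
    obtain ⟨hs1, hs2, hs3⟩ := ih
    set k : ℝ := N + 1 with hk
    have hk0 : 1 ≤ k := by rw [hk]; linarith [N.cast_nonneg (α := ℝ)]
    set γ : ℝ := 2 / (k + 1) with hγ
    set β : ℝ := 2 * (2 * ρ * lamMax G) / k with hβ
    have hβ0 : 0 < β := by rw [hβ, ← hΛ]; positivity
    set y : Blocks m n := (1 - γ) • s.2 + γ • s.1 with hy
    set w := kronApply (G.lapMatrix ℝ) y with hw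
    have hval : (slidingLoop G Q g ρ (fun _ => T) x₀ (N + 1)).val =
      ((proxSliding Q g ((2 * ρ) • w) s.1 β T).val.1,
        (1 - γ) • s.2 + γ • (proxSliding Q g ((2 * ρ) • w) s.1 β T).val.2) := rfl
    obtain ⟨hp1, hp2, hp3⟩ := proxSliding_spec hQ hQc h hβ0 hB ((2 * ρ) • w) s.1 hs1 hne T
    set p := (proxSliding Q g ((2 * ρ) • w) s.1 β T).val with hp
    have hγ0 : 0 < γ := by positivity
    have hγ1 : γ ≤ 1 := by
      rw [hγ, div_le_one (by positivity)]; linarith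
    rw [hval]
    refine ⟨hp1, fun i => hQc (hs2 i) (hp2 i) (by linarith) hγ0.le (by ring), fun v hv => ?_⟩
    dsimp only
    have hc0 : 0 ≤ c := by rw [hc]; positivity
    have h1 := hp3 v hv
    have h2 := hs3 v hv
    -- The inner estimate divided by its total weight $T(T+3)/2=1/c$. The end weight $(T+1)(T+2)/2$
    -- becomes $1+c$, which equals the coefficient $c$ on the right plus the $1$ from the prox term
    -- of $v$.
    have hin : (inner ℝ ((2 * ρ) • w) p.2 + avgBlocks f p.2 + β / 2 * ‖p.2 - s.1‖ ^ 2)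
        - (inner ℝ ((2 * ρ) • w) v + avgBlocks f v + β / 2 * ‖v - s.1‖ ^ 2)
        + β / 2 * (1 + c) * ‖v - p.1‖ ^ 2 ≤
        β / 2 * c * ‖v - s.1‖ ^ 2 + 16 * B ^ 2 / (β * (T + 3)) := by
      have := mul_le_mul_of_nonneg_left h1 hc0
      have e1 : c * (T * (T + 3) / 2) = 1 := by rw [hc]; field_simp
      have e2 : c * ((T + 1) * (T + 2) / 2) = 1 + c := by rw [hc]; field_simp; ring
      have e3 : c * (8 * T * B ^ 2 / β) = 16 * B ^ 2 / (β * (T + 3)) := by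
        rw [hc]; field_simp; ring
      have e4 (X Y : ℝ) : c * (T * (T + 3) / 2 * X + β / 2 * ((T + 1) * (T + 2) / 2) * Y)
          = X + β / 2 * (1 + c) * Y := by
        linear_combination X * e1 + β / 2 * Y * e2
      rw [e4, mul_add c, e3] at this
      linarith
    -- the penalty
    have hpen1 := sqrtLap_sq_expand (G := G) y ((1 - γ) • s.2 + γ • p.2)
    have hpen2 := sqrtLap_sq_le (G := G) ((1 - γ) • s.2 + γ • p.2 - y)
    have hpen3 := sqrtLap_sq_expand (G := G) y s.2
    have hpen4 := sqrtLap_sq_expand (G := G) y v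
    have ey : (1 - γ) • s.2 + γ • p.2 - y = γ • (p.2 - s.1) := by rw [hy]; module
    have ey2 : (1 - γ) • s.2 + γ • p.2 - y = (1 - γ) • (s.2 - y) + γ • (p.2 - y) := by module
    have hF := avgBlocks_convexCombo_le hQc h hs2 hp2 hγ0.le hγ1
    rw [← hw] at hpen1 hpen3 hpen4
    have hq : ‖(1 - γ) • s.2 + γ • p.2 - y‖ ^ 2 = γ ^ 2 * ‖p.2 - s.1‖ ^ 2 := by
      rw [ey, norm_smul, mul_pow, Real.norm_eq_abs, sq_abs]
    have hi : inner ℝ w ((1 - γ) • s.2 + γ • p.2 - y) =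
        (1 - γ) * inner ℝ w (s.2 - y) + γ * inner ℝ w (p.2 - y) := by
      rw [ey2, inner_add_right, inner_smul_right, inner_smul_right]
    rw [hi] at hpen1
    rw [hq] at hpen2
    have hn3 : 0 ≤ ‖sqrtLapApply G (s.2 - y)‖ ^ 2 := sq_nonneg _
    have hn4 : 0 ≤ ‖sqrtLapApply G (v - y)‖ ^ 2 := sq_nonneg _
    rw [inner_smul_left, inner_smul_left] at hin
    simp only [conj_trivial] at hin
    rw [inner_sub_right w v y] at hpen4
    rw [inner_sub_right w p.2 y] at hpen1
    set N1 := ‖sqrtLapApply G ((1 - γ) • s.2 + γ • p.2)‖ ^ 2 with hN1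
    set D := ‖p.2 - s.1‖ ^ 2 with hD
    have hD0 : 0 ≤ D := sq_nonneg _
    obtain ⟨hΛγ, b1, b2, b3, herr⟩ := sliding_coefficients (B := B) hk0 hΛ0
      (show (0 : ℝ) < T + 3 by linarith) hγ (show β = 2 * Λ / k by rw [hβ, hΛ])
    have hΛD := mul_le_mul_of_nonneg_right hΛγ hD0
    -- Acceleration: the new point differs from $y$ by $\gamma(\tilde u-x_{k-1})$, so the curvature
    -- of the penalty costs $\frac\Lambda2\gamma^2D\le\gamma\frac\beta2D$, which the prox term of
    -- the inner problem covers.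
    have hpN1 : ρ * N1 ≤ (1 - γ) * (ρ * ‖sqrtLapApply G s.2‖ ^ 2)
        + γ * (ρ * ‖sqrtLapApply G v‖ ^ 2)
        + γ * (2 * ρ * inner ℝ w p.2 - 2 * ρ * inner ℝ w v) + γ * (β / 2 * D) := by
      have a1 := mul_le_mul_of_nonneg_left hpen2 hρ
      have a3 := mul_nonneg (mul_nonneg (sub_nonneg.2 hγ1) hρ) hn3
      have a4 := mul_nonneg (mul_nonneg hγ0.le hρ) hn4
      rw [hpen1, hpen3, hpen4]
      rw [hΛ] at hΛD
      linarith
    have hgap : penalized G f ρ ((1 - γ) • s.2 + γ • p.2) - penalized G f ρ v ≤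
        (1 - γ) * (penalized G f ρ s.2 - penalized G f ρ v)
        + γ * (β / 2) * (1 + c) * (‖v - s.1‖ ^ 2 - ‖v - p.1‖ ^ 2)
        + γ * (16 * B ^ 2 / (β * (T + 3))) := by
      have a5 := mul_le_mul_of_nonneg_left hin hγ0.le
      simp only [penalized]
      linarith
    have hgap2 := mul_le_mul_of_nonneg_left hgap
      (mul_nonneg (by linarith) (by linarith) : 0 ≤ k * (k + 1))
    have hN : (N : ℝ) = k - 1 := by rw [hk]; ring
    push_cast
    rw [← hk]
    rw [hN] at h2
    have e6 : k * (k + 1) * ((1 - γ) * (penalized G f ρ s.2 - penalized G f ρ v)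
        + γ * (β / 2) * (1 + c) * (‖v - s.1‖ ^ 2 - ‖v - p.1‖ ^ 2)
        + γ * (16 * B ^ 2 / (β * (T + 3)))) =
        (k - 1) * k * (penalized G f ρ s.2 - penalized G f ρ v)
        + 2 * Λ * (1 + c) * (‖v - s.1‖ ^ 2 - ‖v - p.1‖ ^ 2)
        + 16 * k ^ 2 * B ^ 2 / (Λ * (T + 3)) := by
      rw [← b1, ← b2, ← b3]; ring
    rw [e6] at hgap2
    linarith

lemma penaltyCoeff_mul_lamMax {M δ : ℝ} (hm : 2 ≤ m) (hG : G.Connected) :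
    penaltyCoeff G M δ * lamMax G = M ^ 2 * condNumber G / (m * δ) := by
  have hl := lamMinPos_pos hm hG
  have hm' : (0 : ℝ) < m := by positivity
  rw [penaltyCoeff, dualRadius, div_pow, Real.sq_sqrt (by positivity), condNumber]
  field_simp

/-- One run of Sliding, from any starting point at distance at most `√m R` from the solution. -/
lemma sliding_spec (hm : 2 ≤ m) (hG : G.Connected) (hQ : IsClosed Q) (hQc : Convex ℝ Q)
    (h : ∀ k, StronglyConvexWith 0 Q (f k) (g k)) {M δ R : ℝ} (hM : 0 < M) (hδ : 0 < δ)
    (hg : ∀ k, ∀ x ∈ Q, ‖g k x‖ ≤ M) {N T : ℕ} (hN : 1 ≤ N) (hT : 1 ≤ T)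
    (hNb : 6 * M ^ 2 * R ^ 2 * condNumber G ≤ (N * δ) ^ 2) (hTb : 8 * N ≤ condNumber G * (T + 3))
    {x₀ : Blocks m n} (hx₀ : ∀ i, x₀ i ∈ Q) {xs : Vec n} (hxs : xs ∈ Q)
    (hR : ‖x₀ - consensus m xs‖ ^ 2 ≤ m * R ^ 2) :
    (∀ i, (sliding G Q g (penaltyCoeff G M δ) N (fun _ => T) x₀).val i ∈ Q) ∧
    penalized G f (penaltyCoeff G M δ)
      (sliding G Q g (penaltyCoeff G M δ) N (fun _ => T) x₀).val - avg f xs ≤ 2 * δ := by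
  set ρ := penaltyCoeff G M δ with hρ
  have hχ := one_le_condNumber hm hG
  have hm' : (0 : ℝ) < m := by positivity
  have hN' : (1 : ℝ) ≤ N := by exact_mod_cast hN
  have hT' : (1 : ℝ) ≤ T := by exact_mod_cast hT
  have hρ0 : 0 ≤ ρ := by rw [hρ, penaltyCoeff]; positivity
  have hΛ : 2 * ρ * lamMax G = 2 * M ^ 2 * condNumber G / (m * δ) := by
    rw [mul_assoc, hρ, penaltyCoeff_mul_lamMax hm hG]; ring
  set Λ := 2 * ρ * lamMax G with hΛdef
  have hΛ0 : 0 < Λ := by rw [hΛ]; positivity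
  have hB (y : Blocks m n) (hy : ∀ i, y i ∈ Q) : ‖(oracle g y).val‖ ≤ M / √m :=
    norm_oracle_le hM.le fun k => hg k _ (hy k)
  obtain ⟨-, h2, h3⟩ := slidingLoop_spec (G := G) hQ hQc h hB hρ0 hΛdef hΛ0 hT rfl x₀ hx₀
    ⟨xs, hxs⟩ N
  refine ⟨h2, ?_⟩
  have h4 := h3 (consensus m xs) fun _ => hxs
  rw [penalized_consensus, div_pow, Real.sq_sqrt hm'.le, norm_sub_rev _ x₀] at h4
  change penalized G f ρ (slidingLoop G Q g ρ (fun _ => T) x₀ N).val.2 - avg f xs ≤ 2 * δ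
  set gap := penalized G f ρ (slidingLoop G Q g ρ (fun _ => T) x₀ N).val.2 - avg f xs
  have hc : (2 : ℝ) / (T * (T + 3)) ≤ 1 / 2 := by
    rw [div_le_div_iff₀ (by positivity) (by norm_num)]; nlinarith
  -- The right-hand side of the outer estimate splits into an initial distance and a subgradient
  -- error; the choices of $N$ and $T$ make each at most $N^2\delta$. The factor $6$ is
  -- $2\cdot2\cdot\frac32$, since $1+c\le\frac32$.
  have a1 : 2 * Λ * (1 + 2 / (T * (T + 3))) * ‖x₀ - consensus m xs‖ ^ 2 ≤ N ^ 2 * δ := by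
    calc 2 * Λ * (1 + 2 / (T * (T + 3))) * ‖x₀ - consensus m xs‖ ^ 2
        ≤ 2 * Λ * (1 + 1 / 2) * (m * R ^ 2) := by gcongr
      _ = 6 * M ^ 2 * R ^ 2 * condNumber G / δ := by rw [hΛ]; field_simp; ring
      _ ≤ (N * δ) ^ 2 / δ := by gcongr
      _ = N ^ 2 * δ := by field_simp
  have a2 : 16 * N ^ 3 * (M ^ 2 / m) / (Λ * (T + 3)) ≤ N ^ 2 * δ := by
    have e : 16 * N ^ 3 * (M ^ 2 / m) / (Λ * (T + 3)) =
        N ^ 2 * δ * (8 * N / (condNumber G * (T + 3))) := by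
      rw [hΛ]; field_simp; ring
    rw [e]
    refine mul_le_of_le_one_right (by positivity) ?_
    rwa [div_le_one (by positivity)]
  have a3 : 0 ≤ 2 * Λ * (1 + 2 / (T * (T + 3))) *
      ‖consensus m xs - (slidingLoop G Q g ρ (fun _ => T) x₀ N).val.1‖ ^ 2 := by positivity
  by_contra! hgap
  have : N * (N + 1) * (2 * δ) < N * (N + 1) * gap := by gcongr
  nlinarith

end Sliding

/-! ### Complexity of Sliding and R-Sliding -/

section SlidingComplexity

variable {m n : ℕ} {Q : Set (Vec n)} {f : Fin m → Vec n → ℝ} {g : Fin m → Vec n → Vec n}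
  {G : SimpleGraph (Fin m)} [DecidableRel G.Adj]

lemma StronglyConvexWith.mono {μ ν : ℝ} (hν : ν ≤ μ) {f : Vec n → ℝ} {g : Vec n → Vec n}
    (h : StronglyConvexWith μ Q f g) : StronglyConvexWith ν Q f g := by
  intro x hx y hy
  have h1 := h x hx y hy
  have h2 : ν / 2 * ‖y - x‖ ^ 2 ≤ μ / 2 * ‖y - x‖ ^ 2 := by gcongr
  linarith

/-- Take $N=\lceil\sqrt K\rceil$ and $T=\lceil8N/\chi\rceil$. Rounding $T$ up to at least $1$
produces the term $2\sqrt K$ in the number of calls, hence the maximum in the final bounds. -/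
lemma exists_sliding_parameters {K χ : ℝ} (hK : 1 ≤ K) (hχ : 1 ≤ χ) :
    ∃ N T : ℕ, 1 ≤ N ∧ 1 ≤ T ∧ K ≤ N ^ 2 ∧ 8 * N ≤ χ * (T + 3) ∧ (N : ℝ) ≤ 2 * √K ∧
      (N : ℝ) * T ≤ 32 * (K / χ) + 2 * √K := by
  have hs : 1 ≤ √K := Real.one_le_sqrt.2 hK
  have hN0 : 0 < ⌈√K⌉₊ := Nat.ceil_pos.2 (by linarith)
  have hN1 := Nat.le_ceil √K
  have hN2 : (⌈√K⌉₊ : ℝ) ≤ 2 * √K := by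
    linarith [Nat.ceil_lt_add_one (show 0 ≤ √K by linarith)]
  set N := ⌈√K⌉₊
  have hN0' : (0 : ℝ) < N := by exact_mod_cast hN0
  have hT0 : 0 < ⌈8 * N / χ⌉₊ := Nat.ceil_pos.2 (by positivity)
  have hT1 := Nat.le_ceil (8 * N / χ)
  have hT2 := (Nat.ceil_lt_add_one (show 0 ≤ 8 * N / χ by positivity)).le
  set T := ⌈8 * N / χ⌉₊
  have hKs : √K ^ 2 = K := Real.sq_sqrt (by linarith)
  refine ⟨N, T, hN0, hT0, ?_, ?_, hN2, ?_⟩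
  · rw [← hKs]; gcongr
  · rw [div_le_iff₀ (by linarith)] at hT1
    nlinarith
  · calc (N : ℝ) * T ≤ N * (8 * N / χ + 1) := by gcongr
      _ = 8 * N ^ 2 / χ + N := by ring
      _ ≤ 8 * (2 * √K) ^ 2 / χ + 2 * √K := by gcongr
      _ = 32 * (K / χ) + 2 * √K := by rw [mul_pow, hKs]; ring

theorem sliding_complexity (hm : 2 ≤ m) (hG : G.Connected) {ε M R : ℝ} (hε : 0 < ε) (hM : 0 < M)
    (hR : 0 < R) :
    ∃ (δ : ℝ) (N : ℕ) (T : ℕ → ℕ), 0 < δ ∧ δ ≤ ε ∧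
      ∀ (Q : Set (Vec n)) (f : Fin m → Vec n → ℝ) (g : Fin m → Vec n → Vec n)
        (x₀ xs : Vec n),
        IsClosed Q → Convex ℝ Q →
        (∀ k, StronglyConvexWith 0 Q (f k) (g k)) → (∀ k, ∀ x ∈ Q, ‖g k x‖ ≤ M) →
        x₀ ∈ Q → xs ∈ Q → IsMinOn (avg f) Q xs → ‖x₀ - xs‖ ≤ R →
        Achieves (sliding G Q g (penaltyCoeff G M δ) N T (consensus m x₀)) G Q f M xs ε
          (20000 * √(M ^ 2 * R ^ 2 / ε ^ 2 * condNumber G))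
          (20000 * max (M ^ 2 * R ^ 2 / ε ^ 2)
            √(M ^ 2 * R ^ 2 / ε ^ 2 * condNumber G)) := by
  have hχ := one_le_condNumber hm hG
  have hr := dualRadius_pos hm hG hM
  -- If $MR\le\varepsilon$, the starting point is already a solution; otherwise $K\ge1$, so rounding
  -- up costs only a constant factor.
  rcases le_total (M * R) ε with hs | hl
  · refine ⟨ε / 2, 0, fun _ => 0, by linarith, by linarith, ?_⟩
    intro Q f g x₀ xs hQ hQc h hg hx₀ hxs hmin hxR
    refine ⟨isEpsSolution_consensus hr hε.le hx₀ ?_, ?_, ?_⟩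
    · have h1 := avg_gap_le_of_lipschitz hm h hx₀ hxs fun k => hg k _ hx₀
      have h2 : M * ‖x₀ - xs‖ ≤ M * R := by gcongr
      linarith
    · simp [sliding, slidingLoop]
    · simp [sliding, slidingLoop]
  · have hq : 1 ≤ M ^ 2 * R ^ 2 / ε ^ 2 := by
      rw [one_le_div (by positivity), ← mul_pow]; gcongr
    set q := M ^ 2 * R ^ 2 / ε ^ 2 with hqd
    have hX : 1 ≤ q * condNumber G := one_le_mul_of_one_le_of_one_le hq hχ
    -- $24=6\cdot4$: the requirement $6M^2R^2\chi\le(N\delta)^2$ with $\delta=\varepsilon/2$.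
    obtain ⟨N, T, hN, hT, hNK, hTb, hNr, hNT⟩ :=
      exists_sliding_parameters (K := 24 * (q * condNumber G)) (by linarith) hχ
    have hs : √(24 * (q * condNumber G)) ≤ 5 * √(q * condNumber G) := by
      rw [Real.sqrt_mul (by norm_num)]
      gcongr
      rw [Real.sqrt_le_left (by norm_num)]; norm_num
    refine ⟨ε / 2, N, fun _ => T, by linarith, by linarith, ?_⟩
    intro Q f g x₀ xs hQ hQc h hg hx₀ hxs hmin hxR
    have hNb : 6 * M ^ 2 * R ^ 2 * condNumber G ≤ (N * (ε / 2)) ^ 2 := by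
      have := mul_le_mul_of_nonneg_right hNK (show 0 ≤ (ε / 2) ^ 2 by positivity)
      rw [mul_pow]
      refine le_trans (le_of_eq ?_) this
      rw [hqd]; field_simp; ring
    obtain ⟨hyQ, hgap⟩ := sliding_spec (x₀ := consensus m x₀) hm hG hQ hQc h hM
      (half_pos hε) hg hN hT hNb hTb (fun _ => hx₀) hxs (R := R) (by
        rw [← consensus_sub, consensus_norm_sq]; gcongr)
    refine ⟨isEpsSolution_of_gap hr (half_pos hε) rfl hyQ ?_ hgap (by linarith), ?_, ?_⟩
    · have := exact_penalty_lipschitz hm hG hM hQc h hg hxs hmin hyQ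
      simpa using this
    · simp only [sliding, run_bind_rounds, slidingLoop_rounds, run_pure_rounds, add_zero]
      have := Real.sqrt_nonneg (q * condNumber G)
      linarith
    · simp only [sliding, run_bind_calls, slidingLoop_calls, run_pure_calls, add_zero]
      push_cast
      have e : 24 * (q * condNumber G) / condNumber G = 24 * q := by field_simp
      rw [e] at hNT
      have h1 := le_max_left q √(q * condNumber G)
      have h2 := le_max_right q √(q * condNumber G)
      linarith

/-- Since $r-r^2/\delta\le\delta/4$, the strongly convex exact penalty inequality leaves at most
$2\delta+\delta/4\le\frac52\delta$ for the quadratic term. This controls the distance at a restart.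
-/
lemma norm_sub_consensus_sq_le_of_gap (hm : 2 ≤ m) {M δ μ : ℝ}
    (hδ : 0 < δ) (hμ : 0 < μ) {xs : Vec n} {x : Blocks m n}
    (hex : avg f xs + μ / m / 2 * ‖x - consensus m xs‖ ^ 2 ≤
      avgBlocks f x + dualRadius G M * ‖sqrtLapApply G x‖)
    (hgap : penalized G f (penaltyCoeff G M δ) x - avg f xs ≤ 2 * δ) :
    ‖x - consensus m xs‖ ^ 2 ≤ m * (5 * δ / μ) := by
  have hm' : (0 : ℝ) < m := by positivity
  set r := dualRadius G M * ‖sqrtLapApply G x‖ with hr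
  have h1 : penalized G f (penaltyCoeff G M δ) x = avgBlocks f x + r ^ 2 / δ := by
    rw [penalized, penaltyCoeff, hr]; ring
  have h2 : r - r ^ 2 / δ ≤ δ / 4 := by
    rw [sub_le_iff_le_add, ← sub_le_iff_le_add', le_div_iff₀ hδ]
    nlinarith [sq_nonneg (2 * r - δ)]
  have h3 : μ / m / 2 * ‖x - consensus m xs‖ ^ 2 ≤ 5 / 2 * δ := by linarith
  have e : ‖x - consensus m xs‖ ^ 2 =
      2 * m / μ * (μ / m / 2 * ‖x - consensus m xs‖ ^ 2) := by field_simp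
  rw [e]
  calc _ ≤ 2 * m / μ * (5 / 2 * δ) := by gcongr
    _ = _ := by ring

/-- Restarts with accuracies `4ⁱ ε / 2`, for `i = j, …, 0`. -/
lemma exists_stages (hm : 2 ≤ m) (hG : G.Connected) {ε M μ : ℝ} (hε : 0 < ε) (hM : 0 < M)
    (hμ : 0 < μ) (j : ℕ) (hj : (4 : ℝ) ^ j ≤ M ^ 2 / (μ * ε)) :
    ∃ S : List Stage, (∀ s ∈ S, 0 < s.δ) ∧
      ∀ (Q : Set (Vec n)) (f : Fin m → Vec n → ℝ) (g : Fin m → Vec n → Vec n)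
        (x₀ : Blocks m n) (xs : Vec n),
        IsClosed Q → Convex ℝ Q →
        (∀ k, StronglyConvexWith μ Q (f k) (g k)) → (∀ k, ∀ x ∈ Q, ‖g k x‖ ≤ M) →
        (∀ i, x₀ i ∈ Q) → xs ∈ Q → IsMinOn (avg f) Q xs →
        ‖x₀ - consensus m xs‖ ^ 2 ≤ m * (20 * (4 ^ j * (ε / 2)) / μ) →
        (∀ i, (rSliding G Q g M S x₀).val i ∈ Q) ∧
        penalized G f (penaltyCoeff G M (ε / 2)) (rSliding G Q g M S x₀).val - avg f xs ≤ ε ∧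
        ((rSliding G Q g M S x₀).rounds : ℝ) ≤
          2 * (32 * √(M ^ 2 / (μ * ε) * condNumber G))
            - 32 * √(M ^ 2 / (μ * ε) * condNumber G) / 2 ^ j ∧
        ((rSliding G Q g M S x₀).calls : ℝ) ≤
          2 * (7680 * (M ^ 2 / (μ * ε)) + 32 * √(M ^ 2 / (μ * ε) * condNumber G))
            - (7680 * (M ^ 2 / (μ * ε)) + 32 * √(M ^ 2 / (μ * ε) * condNumber G)) / 2 ^ j := by
  have hχ := one_le_condNumber hm hG
  -- One stage shrinks the squared distance bound from $20m\delta/\mu$ to $5m\delta/\mu$, which is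
  -- the starting bound of a stage with $\delta/4$.
  have stage (i : ℕ) (hi : (4 : ℝ) ^ i ≤ M ^ 2 / (μ * ε)) :
      ∃ N T : ℕ, (N : ℝ) ≤ 32 * √(M ^ 2 / (μ * ε) * condNumber G) / 2 ^ i ∧
        (N : ℝ) * T ≤
          (7680 * (M ^ 2 / (μ * ε)) + 32 * √(M ^ 2 / (μ * ε) * condNumber G)) / 2 ^ i ∧
      ∀ (Q : Set (Vec n)) (f : Fin m → Vec n → ℝ) (g : Fin m → Vec n → Vec n)
        (x₀ : Blocks m n) (xs : Vec n),
        IsClosed Q → Convex ℝ Q →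
        (∀ k, StronglyConvexWith μ Q (f k) (g k)) → (∀ k, ∀ x ∈ Q, ‖g k x‖ ≤ M) →
        (∀ i, x₀ i ∈ Q) → xs ∈ Q → IsMinOn (avg f) Q xs →
        ‖x₀ - consensus m xs‖ ^ 2 ≤ m * (20 * (4 ^ i * (ε / 2)) / μ) →
        ∀ y, y = (sliding G Q g (penaltyCoeff G M (4 ^ i * (ε / 2))) N (fun _ => T) x₀).val →
        (∀ i, y i ∈ Q) ∧
        penalized G f (penaltyCoeff G M (4 ^ i * (ε / 2))) y - avg f xs
          ≤ 2 * (4 ^ i * (ε / 2)) ∧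
        ‖y - consensus m xs‖ ^ 2 ≤ m * (5 * (4 ^ i * (ε / 2)) / μ) := by
    set q := M ^ 2 / (μ * ε) with hq
    have hq0 : 0 < q := by positivity
    have h4 : (0 : ℝ) < 4 ^ i := by positivity
    have h22 : (4 : ℝ) ^ i = 2 ^ i * 2 ^ i := by rw [← mul_pow]; norm_num
    have h21 : (1 : ℝ) ≤ 2 ^ i := one_le_pow₀ (by norm_num)
    have hX : 1 ≤ q * condNumber G / 4 ^ i := by
      rw [le_div_iff₀ h4, one_mul]
      exact hi.trans (le_mul_of_one_le_right hq0.le hχ)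
    -- $240=6\cdot20\cdot2$: the requirement on $N$ with $R^2=20\delta/\mu$ and
    -- $\delta=4^i\varepsilon/2$.
    obtain ⟨N, T, hN, hT, hNK, hTb, hNr, hNT⟩ :=
      exists_sliding_parameters (K := 240 * (q * condNumber G / 4 ^ i)) (by linarith) hχ
    have hs : √(240 * (q * condNumber G / 4 ^ i)) ≤ 16 * √(q * condNumber G) / 2 ^ i := by
      rw [Real.sqrt_mul (by norm_num), Real.sqrt_div (by positivity), h22,
        Real.sqrt_mul_self (by positivity), mul_div_assoc]
      gcongr
      rw [Real.sqrt_le_left (by norm_num)]; norm_num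
    refine ⟨N, T, ?_, ?_, ?_⟩
    · refine hNr.trans ((mul_le_mul_of_nonneg_left hs zero_le_two).trans (le_of_eq ?_))
      ring
    · have e : 32 * (240 * (q * condNumber G / 4 ^ i) / condNumber G) ≤ 7680 * q / 2 ^ i := by
        have : 32 * (240 * (q * condNumber G / 4 ^ i) / condNumber G) = 7680 * q / 4 ^ i := by
          field_simp; norm_num
        rw [this, h22]
        gcongr
        exact le_mul_of_one_le_left (by positivity) h21
      rw [add_div]
      refine hNT.trans (add_le_add e ?_)
      refine (mul_le_mul_of_nonneg_left hs zero_le_two).trans (le_of_eq ?_)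
      ring
    · intro Q f g x₀ xs hQ hQc h hg hx₀ hxs hmin hx y hy
      set δ := 4 ^ i * (ε / 2) with hδ
      have hδ0 : 0 < δ := by positivity
      have hR : √(20 * δ / μ) ^ 2 = 20 * δ / μ := Real.sq_sqrt (by positivity)
      have hNb : 6 * M ^ 2 * √(20 * δ / μ) ^ 2 * condNumber G ≤ (N * δ) ^ 2 := by
        have := mul_le_mul_of_nonneg_right hNK (show 0 ≤ δ ^ 2 by positivity)
        rw [mul_pow, hR]
        refine le_trans (le_of_eq ?_) this
        rw [hq, hδ]; field_simp; ring
      obtain ⟨hyQ, hgap⟩ := sliding_spec (x₀ := x₀) hm hG hQ hQc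
        (fun k => (h k).mono hμ.le) hM hδ0 hg hN hT hNb hTb hx₀ hxs (by rw [hR]; exact hx)
      rw [← hy] at hyQ hgap
      exact ⟨hyQ, hgap, norm_sub_consensus_sq_le_of_gap hm hδ0 hμ
        (exact_penalty_lipschitz hm hG hM hQc h hg hxs hmin hyQ) hgap⟩
  have scost (Q : Set (Vec n)) (g : Fin m → Vec n → Vec n) (ρ : ℝ) (N T : ℕ) (x : Blocks m n) :
      (sliding G Q g ρ N (fun _ => T) x).rounds = N ∧
      (sliding G Q g ρ N (fun _ => T) x).calls = N * T := by
    simp [sliding, slidingLoop_rounds, slidingLoop_calls]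
  induction j with
  | zero =>
    obtain ⟨N, T, hN, hNT, H⟩ := stage 0 hj
    refine ⟨[⟨4 ^ 0 * (ε / 2), N, fun _ => T⟩], by simp [hε], ?_⟩
    intro Q f g x₀ xs hQ hQc h hg hx₀ hxs hmin hx
    obtain ⟨h1, h2, -⟩ := H Q f g x₀ xs hQ hQc h hg hx₀ hxs hmin hx _ rfl
    obtain ⟨c1, c2⟩ := scost Q g (penaltyCoeff G M (4 ^ 0 * (ε / 2))) N T x₀
    simp only [rSliding, run_bind_val, run_pure_val, run_bind_rounds, run_pure_rounds, add_zero,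
      run_bind_calls, run_pure_calls, c1, c2]
    refine ⟨h1, ?_, ?_, ?_⟩
    · simp only [pow_zero, one_mul] at h2 ⊢
      linarith
    · simp only [pow_zero, div_one] at hN ⊢
      linarith
    · simp only [pow_zero, div_one] at hNT ⊢
      push_cast
      linarith
  | succ j ih =>
    obtain ⟨S, hS, HS⟩ := ih (le_trans (by gcongr <;> norm_num) hj)
    obtain ⟨N, T, hN, hNT, H⟩ := stage (j + 1) hj
    refine ⟨⟨4 ^ (j + 1) * (ε / 2), N, fun _ => T⟩ :: S, ?_, ?_⟩
    · simp only [List.mem_cons, forall_eq_or_imp]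
      exact ⟨by positivity, hS⟩
    intro Q f g x₀ xs hQ hQc h hg hx₀ hxs hmin hx
    obtain ⟨h1, h2, h3⟩ := H Q f g x₀ xs hQ hQc h hg hx₀ hxs hmin hx _ rfl
    obtain ⟨c1, c2⟩ := scost Q g (penaltyCoeff G M (4 ^ (j + 1) * (ε / 2))) N T x₀
    obtain ⟨k1, k2, k3, k4⟩ := HS Q f g _ xs hQ hQc h hg h1 hxs hmin
      (h3.trans (le_of_eq (by ring)))
    simp only [rSliding, run_bind_val, run_bind_rounds, run_bind_calls, c1, c2]
    refine ⟨k1, k2, ?_, ?_⟩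
    · push_cast
      -- Geometric sum: $a/2^{j+1}+(2a-a/2^j)=2a-a/2^{j+1}$.
      refine (add_le_add hN k3).trans (le_of_eq ?_)
      rw [pow_succ]; field_simp; ring
    · push_cast
      refine (add_le_add hNT k4).trans (le_of_eq ?_)
      rw [pow_succ]; field_simp; ring

theorem rSliding_complexity (hm : 2 ≤ m) (hG : G.Connected) {ε M μ : ℝ} (hε : 0 < ε)
    (hM : 0 < M) (hμ : 0 < μ) :
    ∃ S : List Stage, (∀ s ∈ S, 0 < s.δ) ∧
      ∀ (Q : Set (Vec n)) (f : Fin m → Vec n → ℝ) (g : Fin m → Vec n → Vec n)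
        (x₀ xs : Vec n),
        IsClosed Q → Convex ℝ Q →
        (∀ k, StronglyConvexWith μ Q (f k) (g k)) → (∀ k, ∀ x ∈ Q, ‖g k x‖ ≤ M) →
        x₀ ∈ Q → xs ∈ Q → IsMinOn (avg f) Q xs →
        Achieves (rSliding G Q g M S (consensus m x₀)) G Q f M xs ε
          (20000 * √(M ^ 2 / (μ * ε) * condNumber G))
          (20000 * max (M ^ 2 / (μ * ε)) √(M ^ 2 / (μ * ε) * condNumber G)) := by
  have hr := dualRadius_pos hm hG hM
  set q := M ^ 2 / (μ * ε) with hq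
  have hq0 : 0 < q := by positivity
  have hsq := Real.sqrt_nonneg (q * condNumber G)
  -- If $M^2<\mu\varepsilon$, no step is needed: the gap is at most
  -- $\max_r(Mr-\frac\mu2r^2)=\frac{M^2}{2\mu}$.
  rcases lt_or_ge q 1 with hs | hl
  · refine ⟨[], by simp, ?_⟩
    intro Q f g x₀ xs hQ hQc h hg hx₀ hxs hmin
    refine ⟨isEpsSolution_consensus hr hε.le hx₀ ?_, ?_, ?_⟩
    · have h1 := avg_gap_le_of_lipschitz hm h hx₀ hxs fun k => hg k _ hx₀
      have h2 : M ^ 2 < μ * ε := by rwa [hq, div_lt_one (by positivity)] at hs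
      refine h1.trans ?_
      have h3 : μ * (M * ‖x₀ - xs‖ - μ / 2 * ‖x₀ - xs‖ ^ 2) ≤ μ * ε := by
        nlinarith [sq_nonneg (μ * ‖x₀ - xs‖ - M)]
      exact le_of_mul_le_mul_left h3 hμ
    · simp [rSliding]
    · simp [rSliding, hq0.le]
  · obtain ⟨j, hj1, hj2⟩ := exists_nat_pow_near hl (show (1 : ℝ) < 4 by norm_num)
    obtain ⟨S, hS, H⟩ := exists_stages (n := n) hm hG hε hM hμ j hj1
    refine ⟨S, hS, ?_⟩
    intro Q f g x₀ xs hQ hQc h hg hx₀ hxs hmin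
    have hstart : ‖consensus m x₀ - consensus m xs‖ ^ 2 ≤ m * (20 * (4 ^ j * (ε / 2)) / μ) := by
      rw [← consensus_sub, consensus_norm_sq]
      gcongr
      have h1 := avg_gap_le_of_lipschitz hm h hx₀ hxs fun k => hg k _ hx₀
      have h2 := avg_growth (by omega) hQc h hxs hmin hx₀
      -- No bound on the initial distance is assumed: quadratic growth against the Lipschitz bound
      -- gives $\mu\|x_0-x_s\|\le M$, and the maximal $j$ with $4^j\le q$ makes this fit the first
      -- stage.
      have h3 : μ * ‖x₀ - xs‖ ≤ M := by
        rcases (norm_nonneg (x₀ - xs)).eq_or_lt with h0 | h0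
        · rw [← h0]; linarith
        · refine le_of_mul_le_mul_right ?_ h0
          nlinarith
      have h4 : (μ * ‖x₀ - xs‖) ^ 2 ≤ M ^ 2 := by gcongr
      have h5 : M ^ 2 < 4 ^ (j + 1) * (μ * ε) := by
        rwa [hq, div_lt_iff₀ (by positivity)] at hj2
      rw [le_div_iff₀ hμ]
      have h6 : μ * (‖x₀ - xs‖ ^ 2 * μ) ≤ μ * (20 * (4 ^ j * (ε / 2))) := by
        rw [pow_succ (4 : ℝ)] at h5
        have : 0 < 4 ^ j * (μ * ε) := by positivity
        linarith
      exact le_of_mul_le_mul_left h6 hμ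
    obtain ⟨h1, h2, h3, h4⟩ := H Q f g (consensus m x₀) xs hQ hQc h hg (fun _ => hx₀) hxs hmin
      hstart
    refine ⟨isEpsSolution_of_gap hr (half_pos hε) rfl h1 ?_ (h2.trans (by linarith))
      (by linarith), ?_, ?_⟩
    · have := exact_penalty_lipschitz hm hG hM hQc h hg hxs hmin h1
      have h0 : 0 ≤ μ / m / 2 * ‖(rSliding G Q g M S (consensus m x₀)).val
        - consensus m xs‖ ^ 2 := by positivity
      linarith
    · have : 0 ≤ 32 * √(q * condNumber G) / 2 ^ j := by positivity
      linarith
    · have : 0 ≤ (7680 * q + 32 * √(q * condNumber G)) / 2 ^ j := by positivity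
      have h1 := le_max_left q √(q * condNumber G)
      have h2 := le_max_right q √(q * condNumber G)
      linarith

end SlidingComplexity

/-! ### The similar triangles method -/

/-! ### Growth of the coefficients $A_k$ -/

section Coefficients

variable {L μ A : ℝ}

lemma stmAlpha_pos (hL : 0 < L) (hμ : 0 ≤ μ) (hA : 0 ≤ A) : 0 < stmAlpha L μ A := by
  rw [stmAlpha]
  have : 0 < (1 + A * μ) / (2 * L) := by positivity
  positivity

lemma stmAlpha_rel (hL : 0 < L) (hμ : 0 ≤ μ) (hA : 0 ≤ A) :
    L * stmAlpha L μ A ^ 2 = (A + stmAlpha L μ A) * (1 + A * μ) := by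
  have h0 : 0 ≤ (1 + A * μ) ^ 2 / (4 * L ^ 2) + A * (1 + A * μ) / L := by positivity
  have h1 : (stmAlpha L μ A - (1 + A * μ) / (2 * L)) ^ 2 =
      (1 + A * μ) ^ 2 / (4 * L ^ 2) + A * (1 + A * μ) / L := by
    rw [stmAlpha, add_sub_cancel_left, Real.sq_sqrt h0]
  field_simp at h1
  nlinarith

/-- The coefficients `A_k` of the similar triangles method. -/
def stmCoeff (L μ : ℝ) : ℕ → ℝ
  | 0 => 0
  | k + 1 => stmCoeff L μ k + stmAlpha L μ (stmCoeff L μ k)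

variable (hL : 0 < L) (hμ : 0 ≤ μ)
include hL hμ

lemma stmCoeff_nonneg (k : ℕ) : 0 ≤ stmCoeff L μ k := by
  induction k with
  | zero => exact le_rfl
  | succ k ih => exact add_nonneg ih (stmAlpha_pos hL hμ ih).le

lemma stmCoeff_mono : Monotone (stmCoeff L μ) :=
  monotone_nat_of_le_succ fun k =>
    le_add_of_nonneg_right (stmAlpha_pos hL hμ (stmCoeff_nonneg hL hμ k)).le

/-- With $r=\sqrt{(1+A\mu)/L}$ the defining relation says $A'-A=\alpha=\sqrt{A'}\,r$. Dividing by
$\sqrt{A'}+\sqrt A$, which lies between $\sqrt{A'}$ and $2\sqrt{A'}$, puts the increment of $\sqrt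
A$ between $r/2$ and $r$. -/
lemma sqrt_stmCoeff_succ (k : ℕ) :
    √(stmCoeff L μ k) + √((1 + stmCoeff L μ k * μ) / L) / 2 ≤ √(stmCoeff L μ (k + 1)) ∧
      √(stmCoeff L μ (k + 1)) ≤ √(stmCoeff L μ k) + √((1 + stmCoeff L μ k * μ) / L) := by
  have hA := stmCoeff_nonneg hL hμ k
  have hα := stmAlpha_pos hL hμ hA
  have hrel := stmAlpha_rel hL hμ hA
  have hA' : stmCoeff L μ (k + 1) = stmCoeff L μ k + stmAlpha L μ (stmCoeff L μ k) := rfl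
  set A := stmCoeff L μ k
  set α := stmAlpha L μ A
  have hA'0 : 0 < stmCoeff L μ (k + 1) := by rw [hA']; linarith
  set A' := stmCoeff L μ (k + 1)
  have ha : √A ^ 2 = A := Real.sq_sqrt hA
  have ha' : √A' ^ 2 = A' := Real.sq_sqrt hA'0.le
  have hr : √((1 + A * μ) / L) ^ 2 = (1 + A * μ) / L := Real.sq_sqrt (by positivity)
  have h0 : 0 < √A' := Real.sqrt_pos.2 hA'0
  have h1 : 0 ≤ √A := Real.sqrt_nonneg _
  have h2 : 0 ≤ √((1 + A * μ) / L) := Real.sqrt_nonneg _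
  set r := √((1 + A * μ) / L)
  have h3 : α = √A' * r := by
    refine (pow_left_inj₀ hα.le (by positivity) two_ne_zero).1 ?_
    rw [mul_pow, ha', hr, hA', ← mul_div_assoc, ← hrel]
    field_simp
  have h4 : √A' ^ 2 - √A ^ 2 = √A' * r := by rw [ha, ha', ← h3, hA']; ring
  have h5 : √A ≤ √A' := Real.sqrt_le_sqrt (by rw [hA']; linarith)
  constructor
  · by_contra! h
    nlinarith
  · by_contra! h
    nlinarith

lemma le_stmCoeff (k : ℕ) : (k : ℝ) ^ 2 / (4 * L) ≤ stmCoeff L μ k := by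
  have h : (k : ℝ) / (2 * √L) ≤ √(stmCoeff L μ k) := by
    induction k with
    | zero => simp
    | succ k ih =>
      have h1 := (sqrt_stmCoeff_succ hL hμ k).1
      have h2 : 1 / √L ≤ √((1 + stmCoeff L μ k * μ) / L) := by
        rw [← Real.sqrt_one, ← Real.sqrt_div zero_le_one, Real.sqrt_one]
        have := mul_nonneg (stmCoeff_nonneg hL hμ k) hμ
        gcongr
        linarith
      push_cast
      have e : ((k : ℝ) + 1) / (2 * √L) = k / (2 * √L) + 1 / √L / 2 := by
        have := Real.sqrt_pos.2 hL
        field_simp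
      linarith
  have h2 := pow_le_pow_left₀ (by positivity) h 2
  rw [Real.sq_sqrt (stmCoeff_nonneg hL hμ k), div_pow, mul_pow, Real.sq_sqrt hL.le] at h2
  refine le_trans (le_of_eq ?_) h2
  norm_num

lemma pow_le_stmCoeff (k : ℕ) :
    (1 + √(μ / L) / 2) ^ (2 * k) / L ≤ stmCoeff L μ (k + 1) := by
  have hs := Real.sqrt_nonneg (μ / L)
  have h : (1 + √(μ / L) / 2) ^ k / √L ≤ √(stmCoeff L μ (k + 1)) := by
    induction k with
    | zero =>
      have h1 := stmAlpha_rel hL hμ le_rfl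
      have h2 := stmAlpha_pos hL hμ (le_refl (0 : ℝ))
      have h3 : stmCoeff L μ (0 + 1) = 1 / L := by
        change 0 + stmAlpha L μ 0 = 1 / L
        rw [eq_div_iff hL.ne']
        have : stmAlpha L μ 0 * (stmAlpha L μ 0 * L - 1) = 0 := by linarith
        rcases mul_eq_zero.1 this with h | h
        · exact absurd h h2.ne'
        · linarith
      rw [h3, Real.sqrt_div zero_le_one]
      simp
    | succ k ih =>
      have h1 := (sqrt_stmCoeff_succ hL hμ (k + 1)).1
      have h2 : √(stmCoeff L μ (k + 1)) * √(μ / L) ≤ √((1 + stmCoeff L μ (k + 1) * μ) / L) := by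
        rw [← Real.sqrt_mul (stmCoeff_nonneg hL hμ _), ← mul_div_assoc]
        gcongr
        linarith
      have h3 := mul_le_mul_of_nonneg_right ih (show 0 ≤ 1 + √(μ / L) / 2 by positivity)
      rw [pow_succ, mul_div_right_comm]
      linarith
  have h2 := pow_le_pow_left₀ (by positivity) h 2
  rw [Real.sq_sqrt (stmCoeff_nonneg hL hμ _), div_pow, Real.sq_sqrt hL.le, ← pow_mul,
    mul_comm k] at h2
  exact h2

/-- An upper bound on $A_N$ is needed because the conditioning and the tolerance of the auxiliary
problems deteriorate with $A_N$. -/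
lemma stmCoeff_le (k : ℕ) :
    stmCoeff L μ k ≤ (k : ℝ) ^ 2 / L * (1 + √(μ / L)) ^ (2 * k) := by
  have hs := Real.sqrt_nonneg (μ / L)
  have hL' := Real.sqrt_pos.2 hL
  have h : √(stmCoeff L μ k) ≤ k / √L * (1 + √(μ / L)) ^ k := by
    induction k with
    | zero => simp [stmCoeff]
    | succ k ih =>
      have h1 := (sqrt_stmCoeff_succ hL hμ k).2
      have hA := stmCoeff_nonneg hL hμ k
      have h2 : √((1 + stmCoeff L μ k * μ) / L) ≤ 1 / √L + √(stmCoeff L μ k) * √(μ / L) := by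
        rw [Real.sqrt_le_left (by positivity), add_sq, mul_pow, div_pow, Real.sq_sqrt hA,
          Real.sq_sqrt hL.le, Real.sq_sqrt (by positivity)]
        have : 0 ≤ 2 * (1 / √L) * (√(stmCoeff L μ k) * √(μ / L)) := by positivity
        have e : (1 + stmCoeff L μ k * μ) / L = 1 ^ 2 / L + stmCoeff L μ k * (μ / L) := by ring
        linarith
      have h3 := mul_le_mul_of_nonneg_right ih (show 0 ≤ 1 + √(μ / L) by positivity)
      have h4 : 1 / √L ≤ 1 / √L * (1 + √(μ / L)) ^ (k + 1) :=
        le_mul_of_one_le_right (by positivity) (one_le_pow₀ (by linarith))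
      push_cast
      have e : ((k : ℝ) + 1) / √L * (1 + √(μ / L)) ^ (k + 1) =
        k / √L * (1 + √(μ / L)) ^ k * (1 + √(μ / L)) + 1 / √L * (1 + √(μ / L)) ^ (k + 1) := by
        rw [pow_succ]; ring
      linarith
  have h2 := pow_le_pow_left₀ (by positivity) h 2
  rw [Real.sq_sqrt (stmCoeff_nonneg hL hμ _), mul_pow, div_pow, Real.sq_sqrt hL.le, ← pow_mul,
    mul_comm k] at h2
  exact h2

end Coefficients

/-! ### Estimating sequences with inexact prox steps -/

section Step

variable {E : Type} [NormedAddCommGroup E] [InnerProductSpace ℝ E]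

/-- `z` is an approximate minimizer of `A h + c/2 ‖·‖² - ⟪b, ·⟫`, up to an error `e` in its
gradient. -/
def IsApproxProx (h : E → ℝ) (A c : ℝ) (b : E) (e : ℝ) (z : E) : Prop :=
  ∀ w, A * h z + c / 2 * ‖z‖ ^ 2 - inner ℝ b z - e * ‖w - z‖ + c / 2 * ‖w - z‖ ^ 2 ≤
    A * h w + c / 2 * ‖w‖ ^ 2 - inner ℝ b w

lemma isApproxProx_zero {A c : ℝ} (hc : c ≠ 0) (b : E) :
    IsApproxProx (fun _ => 0) A c b 0 (c⁻¹ • b) := by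
  intro w
  have h1 : inner ℝ (c⁻¹ • b) w = c⁻¹ * inner ℝ b w := by simp [inner_smul_left]
  rw [norm_sub_sq_real, real_inner_comm (c⁻¹ • b) w, h1, norm_smul, inner_smul_right,
    real_inner_self_eq_norm_sq, mul_pow, Real.norm_eq_abs, sq_abs]
  apply le_of_eq
  field_simp
  ring

/-- The estimating inequalities of the similar triangles method, with an error `η`. -/
def EstimateAt (F h : E → ℝ) (μ : ℝ) (u x₀ : E) (s : STMState E) (K η : ℝ) : Prop :=
  s.A * (F s.x + h s.x) ≤
    K + s.A * h s.z + (1 + s.A * μ) / 2 * ‖s.z‖ ^ 2 - inner ℝ s.b s.z + η ∧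
  K + s.A * h u + (1 + s.A * μ) / 2 * ‖u‖ ^ 2 - inner ℝ s.b u ≤
    s.A * (F u + h u) + 1 / 2 * ‖u - x₀‖ ^ 2

lemma estimateAt_init (F h : E → ℝ) (μ : ℝ) (u x₀ : E) :
    EstimateAt F h μ u x₀ ⟨0, x₀, x₀, x₀⟩ (1 / 2 * ‖x₀‖ ^ 2) 0 := by
  constructor
  · simp only [real_inner_self_eq_norm_sq]
    apply le_of_eq
    ring
  · simp only
    rw [norm_sub_sq_real, real_inner_comm]
    apply le_of_eq
    ring

/-- Let $\psi$ be the estimating function, whose constant term is $K$. The approximate minimality of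
the old `s.z` gives $\psi(z')\ge\psi(z)-e\|z'-z\|+\frac{1+A\mu}2\|z'-z\|^2$, and the quadratic pays
for the smoothness error of $F$ at the new point. The prox error of `s.z` is thus charged one step
later, and nothing is required here of $z'$. -/
lemma EstimateAt.step {F h : E → ℝ} {L μ α e K η : ℝ} {u x₀ g y z' : E} {s : STMState E}
    (hs : EstimateAt F h μ u x₀ s K η) (hμ : 0 ≤ μ) (hA : 0 ≤ s.A) (hα : 0 < α)
    (hrel : L * α ^ 2 = (s.A + α) * (1 + s.A * μ))
    (hy : y = (s.A / (s.A + α)) • s.x + (α / (s.A + α)) • s.z)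
    (hprox : IsApproxProx h s.A (1 + s.A * μ) s.b e s.z)
    (hlow : F y + inner ℝ g (s.x - y) ≤ F s.x)
    (hlowu : F y + inner ℝ g (u - y) + μ / 2 * ‖u - y‖ ^ 2 ≤ F u)
    (hup : ∀ w, F w ≤ F y + inner ℝ g (w - y) + L / 2 * ‖w - y‖ ^ 2)
    (hh : h ((s.A / (s.A + α)) • s.x + (α / (s.A + α)) • z') ≤
      s.A / (s.A + α) * h s.x + α / (s.A + α) * h z') :
    EstimateAt F h μ u x₀ ⟨s.A + α, s.b - α • (g - μ • y),
      (s.A / (s.A + α)) • s.x + (α / (s.A + α)) • z', z'⟩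
      (K + α * (F y - inner ℝ g y + μ / 2 * ‖y‖ ^ 2)) (η + e * ‖z' - s.z‖) := by
  obtain ⟨h1, h2⟩ := hs
  have hA' : 0 < s.A + α := by linarith
  have hinner (w : E) : inner ℝ (s.b - α • (g - μ • y)) w =
      inner ℝ s.b w - α * (inner ℝ g w - μ * inner ℝ y w) := by
    simp [inner_sub_left, inner_smul_left]
  constructor
  · dsimp only
    set x' := (s.A / (s.A + α)) • s.x + (α / (s.A + α)) • z' with hx'
    have e1 : x' - y = (α / (s.A + α)) • (z' - s.z) := by rw [hx', hy]; module
    have e2 : (s.A + α) • (x' - y) = s.A • (s.x - y) + α • (z' - y) := by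
      have : s.A • (s.x - y) + α • (z' - y) = s.A • s.x + α • z' - (s.A + α) • y := by module
      rw [this, smul_sub, hx', smul_add, smul_smul, smul_smul, mul_div_cancel₀ _ hA'.ne',
        mul_div_cancel₀ _ hA'.ne']
    have e3 : (s.A + α) * inner ℝ g (x' - y) =
        s.A * inner ℝ g (s.x - y) + α * inner ℝ g (z' - y) := by
      rw [← inner_smul_right, e2, inner_add_right, inner_smul_right, inner_smul_right]
    -- The equation for $\alpha$ is chosen to make this an equality.
    have e4 : (s.A + α) * (L / 2 * ‖x' - y‖ ^ 2) = (1 + s.A * μ) / 2 * ‖z' - s.z‖ ^ 2 := by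
      rw [e1, norm_smul, mul_pow, Real.norm_eq_abs, sq_abs, div_pow]
      have : (s.A + α) * (L / 2 * (α ^ 2 / (s.A + α) ^ 2 * ‖z' - s.z‖ ^ 2)) =
        L * α ^ 2 / (s.A + α) / 2 * ‖z' - s.z‖ ^ 2 := by field_simp
      rw [this, hrel, mul_div_cancel_left₀ _ hA'.ne']
    have f1 := mul_le_mul_of_nonneg_left (hup x') hA'.le
    have f2 := mul_le_mul_of_nonneg_left hh hA'.le
    have e5 : (s.A + α) * (s.A / (s.A + α) * h s.x + α / (s.A + α) * h z') =
        s.A * h s.x + α * h z' := by field_simp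
    have f3 := mul_le_mul_of_nonneg_left hlow hA
    have f4 := hprox z'
    have f5 : 0 ≤ α * (μ / 2 * ‖z' - y‖ ^ 2) := by positivity
    rw [hinner]
    rw [norm_sub_sq_real z' y, real_inner_comm y z'] at f5
    rw [inner_sub_right g z' y] at e3
    linarith
  · dsimp only
    rw [hinner]
    have f1 := mul_le_mul_of_nonneg_left hlowu hα.le
    rw [inner_sub_right, norm_sub_sq_real, real_inner_comm y u] at f1
    linarith

end Step

/-! ### The method with exact steps -/

section Runs

variable {m n : ℕ}

lemma stm_A (L μ : ℝ) (grad : Blocks m n → Run (Blocks m n))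
    (prox : ℝ → Blocks m n → Run (Blocks m n)) (x₀ : Blocks m n) (N : ℕ) :
    (stm L μ grad prox x₀ N).val.A = stmCoeff L μ N := by
  induction N with
  | zero => rfl
  | succ N ih => simp only [stm, run_bind_val, run_pure_val, stmCoeff, ih]

lemma stm_cost (L μ : ℝ) {grad : Blocks m n → Run (Blocks m n)}
    {prox : ℝ → Blocks m n → Run (Blocks m n)} {r₁ r₂ c₁ c₂ : ℕ}
    (hg : ∀ x, (grad x).rounds = r₁ ∧ (grad x).calls = c₁)
    (hp : ∀ A x, (prox A x).rounds = r₂ ∧ (prox A x).calls = c₂) (x₀ : Blocks m n) (N : ℕ) :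
    (stm L μ grad prox x₀ N).rounds = N * (r₁ + r₂) ∧
      (stm L μ grad prox x₀ N).calls = N * (c₁ + c₂) := by
  induction N with
  | zero => simp [stm]
  | succ N ih =>
    constructor
    · simp only [stm, run_bind_rounds, run_pure_rounds, ih.1, (hg _).1, (hp _ _).1]
      ring
    · simp only [stm, run_bind_calls, run_pure_calls, ih.2, (hg _).2, (hp _ _).2]
      ring

/-- Convergence of the similar triangles method with exact steps and without composite term; strong
convexity is needed only between the points of `S` and the point of comparison `u`, where `S` is
the affine subspace of the points with the same sum of blocks as `u`. -/
lemma stmPlain_spec {L μ : ℝ} (hL : 0 < L) (hμ : 0 ≤ μ) {F : Blocks m n → ℝ}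
    {grad : Blocks m n → Run (Blocks m n)} {u x₀ : Blocks m n}
    (hlow : ∀ x y, F y + inner ℝ (grad y).val (x - y) ≤ F x)
    (hlowu : ∀ y, ∑ i, y i = ∑ i, u i →
      F y + inner ℝ (grad y).val (u - y) + μ / 2 * ‖u - y‖ ^ 2 ≤ F u)
    (hup : ∀ x y, F x ≤ F y + inner ℝ (grad y).val (x - y) + L / 2 * ‖x - y‖ ^ 2)
    (hgrad : ∀ y, ∑ i, y i = ∑ i, u i → ∑ i, (grad y).val i = 0)
    (hx₀ : ∑ i, x₀ i = ∑ i, u i) (N : ℕ) :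
    stmCoeff L μ N * (F (stmPlain L μ grad x₀ N).val.x - F u) ≤ 1 / 2 * ‖u - x₀‖ ^ 2 := by
  -- The invariants on sums keep the iterates on the affine subspace where the strong convexity is
  -- available. Gradients there have zero block sum, so the sum of `b` is determined by $A_N$.
  have key : ∀ N : ℕ, (∃ K, EstimateAt F (fun _ => 0) μ u x₀ (stmPlain L μ grad x₀ N).val K 0) ∧
      (stmPlain L μ grad x₀ N).val.z = (1 + stmCoeff L μ N * μ)⁻¹ •
        (stmPlain L μ grad x₀ N).val.b ∧
      ∑ i, (stmPlain L μ grad x₀ N).val.x i = ∑ i, u i ∧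
      ∑ i, (stmPlain L μ grad x₀ N).val.b i = (1 + stmCoeff L μ N * μ) • ∑ i, u i := by
    intro N
    induction N with
    | zero =>
      refine ⟨⟨_, estimateAt_init F _ μ u x₀⟩, ?_, hx₀, ?_⟩
      · simp [stmPlain, stm, stmCoeff]
      · simp [stmPlain, stm, stmCoeff, hx₀]
    | succ N ih =>
      have hsA := stm_A L μ grad (fun A b => pure ((1 + A * μ)⁻¹ • b)) x₀ N
      change (stmPlain L μ grad x₀ N).val.A = _ at hsA
      have hA0 := stmCoeff_nonneg hL hμ N
      obtain ⟨⟨K, hK⟩, hz, hx, hb⟩ := ih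
      set s := (stmPlain L μ grad x₀ N).val with hs
      rw [← hsA] at hz hb hA0
      have hα := stmAlpha_pos hL hμ hA0
      have hrel := stmAlpha_rel hL hμ hA0
      have hcs : stmCoeff L μ (N + 1) = s.A + stmAlpha L μ s.A := by rw [hsA]; rfl
      set α := stmAlpha L μ s.A with hαd
      have hA' : 0 < s.A + α := by linarith
      have hc : 0 < 1 + s.A * μ := by positivity
      have hc' : 0 < 1 + (s.A + α) * μ := by positivity
      set y := (s.A / (s.A + α)) • s.x + (α / (s.A + α)) • s.z with hy
      set b' := s.b - α • ((grad y).val - μ • y) with hb'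
      set z' := (1 + (s.A + α) * μ)⁻¹ • b' with hz'
      have hval : (stmPlain L μ grad x₀ (N + 1)).val =
        ⟨s.A + α, b', (s.A / (s.A + α)) • s.x + (α / (s.A + α)) • z', z'⟩ := rfl
      have hsum (v w : Blocks m n) (r t : ℝ) :
          ∑ i, (r • v + t • w) i = r • ∑ i, v i + t • ∑ i, w i := by
        simp [Finset.sum_add_distrib, Finset.smul_sum]
      have hcomb : s.A / (s.A + α) + α / (s.A + α) = 1 := by field_simp
      have hsz : ∑ i, s.z i = ∑ i, u i := by
        rw [hz]
        simp only [PiLp.smul_apply, ← Finset.smul_sum]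
        rw [hb, smul_smul, inv_mul_cancel₀ hc.ne', one_smul]
      have hsy : ∑ i, y i = ∑ i, u i := by
        rw [hy, hsum, hx, hsz, ← add_smul, hcomb, one_smul]
      have hsb : ∑ i, b' i = (1 + (s.A + α) * μ) • ∑ i, u i := by
        have hg0 := hgrad y hsy
        rw [hb']
        simp only [PiLp.sub_apply, PiLp.smul_apply, Finset.sum_sub_distrib, ← Finset.smul_sum]
        rw [hg0, hsy, hb]
        module
      have hsz' : ∑ i, z' i = ∑ i, u i := by
        rw [hz']
        simp only [PiLp.smul_apply, ← Finset.smul_sum]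
        rw [hsb, smul_smul, inv_mul_cancel₀ hc'.ne', one_smul]
      rw [hval, hcs]
      refine ⟨⟨K + α * (F y - inner ℝ (grad y).val y + μ / 2 * ‖y‖ ^ 2), ?_⟩, rfl, ?_, hsb⟩
      · have hp : IsApproxProx (fun _ => 0) s.A (1 + s.A * μ) s.b 0 s.z := by
          rw [hz]; exact isApproxProx_zero hc.ne' _
        have := hK.step (z' := z') hμ hA0 hα hrel hy hp (hlow _ _) (hlowu y hsy)
          (fun w => hup w y) (by simp)
        rw [zero_mul, zero_add] at this
        exact this
      · dsimp only
        rw [hsum, hx, hsz', ← add_smul, hcomb, one_smul]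
  obtain ⟨⟨K, h1, h2⟩, hz, -, -⟩ := key N
  have hsA := stm_A L μ grad (fun A b => pure ((1 + A * μ)⁻¹ • b)) x₀ N
  change (stmPlain L μ grad x₀ N).val.A = _ at hsA
  have hA0 := stmCoeff_nonneg hL hμ N
  have hc : 0 < 1 + stmCoeff L μ N * μ := by positivity
  have hp := isApproxProx_zero (A := stmCoeff L μ N) hc.ne' (stmPlain L μ grad x₀ N).val.b u
  rw [← hz] at hp
  rw [hsA] at h1 h2
  have h3 : 0 ≤ (1 + stmCoeff L μ N * μ) / 2 * ‖u - (stmPlain L μ grad x₀ N).val.z‖ ^ 2 := by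
    positivity
  linarith

end Runs

/-! ### The method with inexact steps -/

section Inexact

/-- Apply the prox inequality to $w=u$ and chain the two estimates. As $u$ need not minimize $F+h$
exactly, a deficit of $\delta/4$ is allowed and is weighted by $A$. -/
lemma EstimateAt.dist_le {E : Type} [NormedAddCommGroup E] [InnerProductSpace ℝ E]
    {F h : E → ℝ} {μ K η e δ : ℝ} {u x₀ : E} {s : STMState E}
    (hs : EstimateAt F h μ u x₀ s K η) (hA : 0 ≤ s.A) (hμ : 0 ≤ μ)
    (hprox : IsApproxProx h s.A (1 + s.A * μ) s.b e s.z)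
    (hlb : F u + h u - δ / 4 ≤ F s.x + h s.x) :
    1 / 2 * ‖u - s.z‖ ^ 2 ≤ 1 / 2 * ‖u - x₀‖ ^ 2 + s.A * (δ / 4) + η + e * ‖u - s.z‖ := by
  obtain ⟨h1, h2⟩ := hs
  have h3 := hprox u
  have h4 := mul_le_mul_of_nonneg_left hlb hA
  have h5 : 0 ≤ s.A * μ / 2 * ‖u - s.z‖ ^ 2 := by positivity
  linarith

/-- If $d>D$, the right-hand side is at most
$\frac{D^2}{16}+\frac{D^2}8+\frac{Dd}8<\frac{5}{16}d^2$. -/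
lemma le_of_inexact_estimate {d D e k N : ℝ} (he0 : 0 < e) (he : e * (16 * (N + 1)) = D)
    (hkN : k + 1 ≤ N) (hk : 0 ≤ k) (hd0 : 0 ≤ d)
    (h : 1 / 2 * d ^ 2 ≤ D ^ 2 / 16 + (2 * k + 1) * (e * D) + 2 * e * d) : d ≤ D := by
  have hD0 : 0 < D := by rw [← he]; exact mul_pos he0 (by linarith)
  have g4 : (2 * k + 1) * (e * D) ≤ D ^ 2 / 8 := by
    have : (2 * k + 1) * (e * D) ≤ 2 * (N + 1) * (e * D) := by gcongr; linarith
    refine this.trans (le_of_eq ?_)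
    have : D ^ 2 = e * (16 * (N + 1)) * D := by rw [he]; ring
    rw [this]; ring
  have g5 : 16 * e ≤ D := by
    rw [← he]
    nlinarith
  by_contra! hlt
  have : 16 * e * d ≤ D * d := by gcongr
  nlinarith

variable {m n : ℕ}

set_option maxHeartbeats 1000000 in
/-- Convergence of the similar triangles method with inexact auxiliary solutions. -/
lemma stm_inexact_spec {L μ : ℝ} (hL : 0 < L) (hμ : 0 ≤ μ) {F h : Blocks m n → ℝ}
    {grad : Blocks m n → Run (Blocks m n)} {prox : ℝ → Blocks m n → Run (Blocks m n)}
    {u x₀ : Blocks m n} {N : ℕ} {D e δ R Γ : ℝ}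
    (hlow : ∀ x y, F y + inner ℝ (grad y).val (x - y) ≤ F x)
    (hlowu : ∀ y, F y + inner ℝ (grad y).val (u - y) + μ / 2 * ‖u - y‖ ^ 2 ≤ F u)
    (hup : ∀ x y, F x ≤ F y + inner ℝ (grad y).val (x - y) + L / 2 * ‖x - y‖ ^ 2)
    (hconv : ∀ a b (t : ℝ), 0 ≤ t → t ≤ 1 →
      h ((1 - t) • a + t • b) ≤ (1 - t) * h a + t * h b)
    (hlb : ∀ x, F u + h u - δ / 4 ≤ F x + h x) (hx₀ : ‖x₀ - u‖ ≤ R) (hδ : 0 ≤ δ)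
    (hD : 8 * R ^ 2 + 4 * stmCoeff L μ N * δ ≤ D ^ 2) (hD0 : 0 < D)
    (he : e * (16 * (N + 1)) = D)
    (hgrad : ∀ y, ‖y - u‖ ≤ D → ‖(grad y).val - μ • (y - u)‖ ≤ Γ)
    (hprox : ∀ A b, 0 ≤ A → A ≤ stmCoeff L μ N →
      ‖b - (1 + A * μ) • u‖ ≤ R + stmCoeff L μ N * Γ →
      IsApproxProx h A (1 + A * μ) b e (prox A b).val) :
    stmCoeff L μ N * (F (stm L μ grad prox x₀ N).val.x + h (stm L μ grad prox x₀ N).val.x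
      - (F u + h u)) ≤ 1 / 2 * R ^ 2 + 1 / 8 * D ^ 2 := by
  have hR0 : 0 ≤ R := (norm_nonneg _).trans hx₀
  have hN0 : (0 : ℝ) ≤ N := N.cast_nonneg
  have he0 : 0 < e := by
    by_contra! h
    have := mul_nonpos_of_nonpos_of_nonneg h (show (0 : ℝ) ≤ 16 * (N + 1) by positivity)
    linarith
  have hAN := stmCoeff_nonneg hL hμ N
  have hΓ : 0 ≤ Γ := (norm_nonneg _).trans (hgrad u (by simpa using hD0.le))
  have hRD : R ≤ D := by
    refine abs_le_of_sq_le_sq' ?_ hD0.le |>.2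
    have := mul_nonneg hAN hδ
    nlinarith [sq_nonneg R]
  -- The tolerance `e` is available only when $b$ is not too far from its reference point, so
  -- boundedness must be proved along with the estimate. As long as the iterates stay within $D$ of
  -- $u$, each step adds at most $2eD$ to the error, and $N$ steps of this size do not push them
  -- out.
  have key : ∀ k : ℕ, k ≤ N → (∃ K, EstimateAt F h μ u x₀ (stm L μ grad prox x₀ k).val K
      (2 * k * (e * D))) ∧
      IsApproxProx h (stm L μ grad prox x₀ k).val.A
        (1 + (stm L μ grad prox x₀ k).val.A * μ) (stm L μ grad prox x₀ k).val.b e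
        (stm L μ grad prox x₀ k).val.z ∧
      ‖(stm L μ grad prox x₀ k).val.z - u‖ ≤ D ∧ ‖(stm L μ grad prox x₀ k).val.x - u‖ ≤ D ∧
      ‖(stm L μ grad prox x₀ k).val.b - (1 + (stm L μ grad prox x₀ k).val.A * μ) • u‖ ≤
        R + (stm L μ grad prox x₀ k).val.A * Γ := by
    intro k
    induction k with
    | zero =>
      intro _
      refine ⟨⟨_, by simpa [stm] using estimateAt_init F h μ u x₀⟩, ?_, hx₀.trans hRD,
        hx₀.trans hRD, ?_⟩
      · intro w
        have h1 : 0 ≤ e * ‖w - x₀‖ := by positivity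
        simp only [stm, run_pure_val, zero_mul, add_zero, zero_add]
        rw [norm_sub_sq_real, real_inner_comm x₀ w, real_inner_self_eq_norm_sq]
        linarith
      · simpa [stm] using hx₀
    | succ k ih =>
      intro hkN
      have hsA := stm_A L μ grad prox x₀ k
      have hA0 := stmCoeff_nonneg hL hμ k
      have hmono : stmCoeff L μ (k + 1) ≤ stmCoeff L μ N := stmCoeff_mono hL hμ hkN
      obtain ⟨⟨K, hK⟩, hp, hz, hx, hb⟩ := ih (by omega)
      have hsucc : (stm L μ grad prox x₀ (k + 1)).val = _ := rfl
      conv_rhs at hsucc => simp only [stm, run_bind_val, run_pure_val]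
      rw [hsucc]
      set s := (stm L μ grad prox x₀ k).val with hs
      rw [← hsA] at hA0
      have hα := stmAlpha_pos hL hμ hA0
      have hrel := stmAlpha_rel hL hμ hA0
      have hcs : stmCoeff L μ (k + 1) = s.A + stmAlpha L μ s.A := by rw [hsA]; rfl
      rw [hcs] at hmono
      set α := stmAlpha L μ s.A with hαd
      have hA' : 0 < s.A + α := by linarith
      set y := (s.A / (s.A + α)) • s.x + (α / (s.A + α)) • s.z with hy
      set b' := s.b - α • ((grad y).val - μ • y) with hb'
      set z' := (prox (s.A + α) b').val with hz'
      dsimp only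
      have hcomb : s.A / (s.A + α) = 1 - α / (s.A + α) := by field_simp; ring
      have hball (v w : Blocks m n) (hv : ‖v - u‖ ≤ D) (hw : ‖w - u‖ ≤ D) :
          ‖(s.A / (s.A + α)) • v + (α / (s.A + α)) • w - u‖ ≤ D := by
        have hc1 : s.A / (s.A + α) + α / (s.A + α) = 1 := by rw [hcomb]; ring
        have := (convex_closedBall u D) (mem_closedBall_iff_norm.2 hv)
          (mem_closedBall_iff_norm.2 hw) (div_nonneg hA0 hA'.le) (div_nonneg hα.le hA'.le) hc1
        exact mem_closedBall_iff_norm.1 this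
      have hyD := hball _ _ hx hz
      rw [← hy] at hyD
      have hgy := hgrad y hyD
      have hb2 : ‖b' - (1 + (s.A + α) * μ) • u‖ ≤ R + (s.A + α) * Γ := by
        have e1 : b' - (1 + (s.A + α) * μ) • u =
            (s.b - (1 + s.A * μ) • u) - α • ((grad y).val - μ • (y - u)) := by
          rw [hb']; module
        rw [e1]
        refine (norm_sub_le _ _).trans ?_
        rw [norm_smul, Real.norm_eq_abs, abs_of_pos hα]
        have := mul_le_mul_of_nonneg_left hgy hα.le
        linarith
      have hp' : IsApproxProx h (s.A + α) (1 + (s.A + α) * μ) b' e z' := by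
        refine hprox _ _ hA'.le hmono (hb2.trans ?_)
        gcongr
      have hstep := hK.step (z' := z') hμ hA0 hα hrel hy hp (hlow _ _) (hlowu y)
        (fun w => hup w y) (by
          rw [hcomb]
          refine hconv _ _ _ (div_nonneg hα.le hA'.le) ?_
          rw [div_le_one hA']; linarith)
      have hdist := hstep.dist_le (δ := δ) hA'.le hμ hp' (hlb _)
      dsimp only at hdist
      have hux : ‖u - x₀‖ ^ 2 ≤ R ^ 2 := by
        rw [norm_sub_rev]; gcongr
      have htri : ‖z' - s.z‖ ≤ ‖u - z'‖ + D := by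
        have e1 : z' - s.z = (u - s.z) - (u - z') := by abel
        have := norm_sub_le (u - s.z) (u - z')
        rw [e1]
        rw [norm_sub_rev] at hz
        linarith
      have hkN' : (k : ℝ) + 1 ≤ N := by exact_mod_cast hkN
      -- The unknown $d$ also occurs in the error terms; $\frac12R^2+\frac14A_N\delta\le D^2/16$ and
      -- the smallness of $e$ close the bound.
      have hz'D : ‖u - z'‖ ≤ D := by
        set d := ‖u - z'‖ with hd
        have g1 : e * ‖z' - s.z‖ ≤ e * (d + D) := mul_le_mul_of_nonneg_left htri he0.le
        have g2 : (s.A + α) * (δ / 4) ≤ stmCoeff L μ N * (δ / 4) := by gcongr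
        exact le_of_inexact_estimate he0 he hkN' k.cast_nonneg (norm_nonneg _) (by linarith)
      refine ⟨⟨_, hstep.1.trans ?_, hstep.2⟩, hp', ?_, ?_, hb2⟩
      · dsimp only
        have g1 : e * ‖z' - s.z‖ ≤ e * (D + D) :=
          mul_le_mul_of_nonneg_left (htri.trans (by linarith)) he0.le
        push_cast
        linarith
      · rwa [norm_sub_rev]
      · exact hball _ _ hx (by rwa [norm_sub_rev])
  obtain ⟨⟨K, h1, h2⟩, hp, hz, -, -⟩ := key N le_rfl
  have h3 := hp u
  rw [norm_sub_rev] at hz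
  have hsA := stm_A L μ grad prox x₀ N
  rw [hsA] at h1 h2 h3
  have hux : ‖u - x₀‖ ^ 2 ≤ R ^ 2 := by
    rw [norm_sub_rev]; gcongr
  have h4 : 0 ≤ (1 + stmCoeff L μ N * μ) / 2 *
      ‖u - (stm L μ grad prox x₀ N).val.z‖ ^ 2 := by positivity
  have h5 : e * ‖u - (stm L μ grad prox x₀ N).val.z‖ ≤ e * D := by gcongr
  have h6 : 2 * N * (e * D) + e * D ≤ 1 / 8 * D ^ 2 := by
    have : D ^ 2 = e * (16 * (N + 1)) * D := by rw [he]; ring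
    rw [this]
    have : 0 ≤ e * D := by positivity
    linarith
  linarith

end Inexact

/-! ### The auxiliary problem -/

section Auxiliary

variable {m n : ℕ} {G : SimpleGraph (Fin m)} [DecidableRel G.Adj]

/-- The objective `a ⟪z, W z⟫ + c/2 ‖z‖² - ⟪b, z⟫` of the auxiliary problem. -/
def auxObj (G : SimpleGraph (Fin m)) [DecidableRel G.Adj] (a c : ℝ) (b z : Blocks m n) : ℝ :=
  a * ‖sqrtLapApply G z‖ ^ 2 + c / 2 * ‖z‖ ^ 2 - inner ℝ b z

/-- The gradient of the objective of the auxiliary problem. -/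
def auxGrad (G : SimpleGraph (Fin m)) [DecidableRel G.Adj] (a c : ℝ) (b z : Blocks m n) :
    Blocks m n :=
  c • z + (2 * a) • kronApply (G.lapMatrix ℝ) z - b

lemma auxObj_expand (a c : ℝ) (b y w : Blocks m n) :
    auxObj G a c b w = auxObj G a c b y + inner ℝ (auxGrad G a c b y) (w - y)
      + (c / 2 * ‖w - y‖ ^ 2 + a * ‖sqrtLapApply G (w - y)‖ ^ 2) := by
  have h1 := sqrtLap_sq_expand (G := G) y w
  have h2 : ‖w‖ ^ 2 = ‖y‖ ^ 2 + 2 * inner ℝ y (w - y) + ‖w - y‖ ^ 2 := by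
    have : w = y + (w - y) := by abel
    conv_lhs => rw [this]
    rw [norm_add_sq_real]
  have h3 : inner ℝ b w = inner ℝ b y + inner ℝ b (w - y) := by
    rw [← inner_add_right, add_sub_cancel]
  simp only [auxObj, auxGrad, inner_sub_left, inner_add_left, inner_smul_left, conj_trivial]
  rw [h1, h2, h3]
  ring

lemma isApproxProx_of_auxGrad {ρ A c e : ℝ} (hρ : 0 ≤ ρ) (hA : 0 ≤ A) {b z : Blocks m n}
    (h : ‖auxGrad G (ρ * A) c b z‖ ≤ e) :
    IsApproxProx (fun x => ρ * ‖sqrtLapApply G x‖ ^ 2) A c b e z := by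
  intro w
  have h1 := auxObj_expand (G := G) (ρ * A) c b z w
  have h2 := abs_le.1 (abs_real_inner_le_norm (auxGrad G (ρ * A) c b z) (w - z)) |>.1
  have h3 := mul_le_mul_of_nonneg_right h (norm_nonneg (w - z))
  have h4 : 0 ≤ ρ * A * ‖sqrtLapApply G (w - z)‖ ^ 2 := by positivity
  simp only [auxObj] at h1
  linarith

/-- $cI+2aW$ is positive definite, hence injective, hence surjective in finite dimension. -/
lemma exists_auxGrad_eq_zero {a c : ℝ} (ha : 0 ≤ a) (hc : 0 < c) (b : Blocks m n) :
    ∃ z, auxGrad G a c b z = 0 := by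
  let T : Blocks m n →ₗ[ℝ] Blocks m n :=
    c • LinearMap.id + (2 * a) • kronLin (G.lapMatrix ℝ)
  have hT (z : Blocks m n) : T z = c • z + (2 * a) • kronApply (G.lapMatrix ℝ) z := rfl
  have hinj : Function.Injective T := by
    rw [← LinearMap.ker_eq_bot, LinearMap.ker_eq_bot']
    intro z hz
    have h1 : inner ℝ z (T z) = 0 := by rw [hz, inner_zero_right]
    rw [hT, inner_add_right, inner_smul_right, inner_smul_right,
      real_inner_self_eq_norm_sq] at h1
    have h2 := mul_nonneg (show 0 ≤ 2 * a by linarith) (lap_inner_nonneg G z)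
    have h3 : c * ‖z‖ ^ 2 ≤ 0 := by linarith
    have h4 : ‖z‖ ^ 2 ≤ 0 := by
      by_contra! h
      have := mul_pos hc h
      linarith
    simpa using le_antisymm h4 (sq_nonneg _)
  obtain ⟨z, hz⟩ := (LinearMap.injective_iff_surjective.1 hinj) b
  exact ⟨z, by rw [auxGrad, ← hT, hz, sub_self]⟩

lemma sum_auxGrad (a c : ℝ) (b z : Blocks m n) :
    ∑ i, auxGrad G a c b z i = c • ∑ i, z i - ∑ i, b i := by
  have h := sum_kronApply_lap G z
  simp only [auxGrad, PiLp.sub_apply, PiLp.add_apply, PiLp.smul_apply, Finset.sum_sub_distrib,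
    Finset.sum_add_distrib, ← Finset.smul_sum, h, smul_zero, add_zero]

lemma auxSolve_cost (T : ℕ) (a c : ℝ) (b : Blocks m n) :
    (auxSolve G T a c b).rounds = T ∧ (auxSolve G T a c b).calls = 0 := by
  have := stm_cost (c + 2 * a * lamMax G) (c + 2 * a * lamMinPos G)
    (grad := fun z : Blocks m n => do
      let w ← gossip G z
      pure (c • z + (2 * a) • w - b))
    (prox := fun A b => pure ((1 + A * (c + 2 * a * lamMinPos G))⁻¹ • b))
    (r₁ := 1) (r₂ := 0) (c₁ := 0) (c₂ := 0) (by simp) (by simp) (c⁻¹ • b) T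
  simpa [auxSolve, stmPlain] using this

/-- The auxiliary solver converges linearly in the norm of the gradient. -/
lemma auxSolve_spec (hm : 2 ≤ m) (hG : G.Connected) {a c β : ℝ} (ha : 0 ≤ a) (hc : 1 ≤ c)
    (b : Blocks m n) (v : Vec n) (hb : ‖b - c • consensus m v‖ ≤ β) (τ : ℕ) :
    ‖auxGrad G a c b (auxSolve G (τ + 1) a c b).val‖ ^ 2 *
      (1 + √(1 / condNumber G) / 2) ^ (2 * τ) ≤ 4 * β ^ 2 * (c + 2 * a * lamMax G) ^ 3 := by
  have hc0 : 0 < c := by linarith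
  have hl := lamMinPos_pos hm hG
  have hll := lamMinPos_le_lamMax hm hG
  have hlm := lamMax_pos hm hG
  set Λ := c + 2 * a * lamMax G with hΛ
  set ν := c + 2 * a * lamMinPos G with hν
  have hΛ0 : 0 < Λ := by positivity
  have hν0 : 0 < ν := by positivity
  obtain ⟨z, hz⟩ := exists_auxGrad_eq_zero (G := G) ha hc0 b
  have hsumz : c • ∑ i, z i = ∑ i, b i := by
    have := sum_auxGrad (G := G) a c b z
    rw [hz] at this
    simpa [sub_eq_zero] using this.symm
  have hx₀ : ∑ i, (c⁻¹ • b) i = ∑ i, z i := by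
    simp only [PiLp.smul_apply, ← Finset.smul_sum]
    rw [← hsumz, smul_smul, inv_mul_cancel₀ hc0.ne', one_smul]
  have hpen (w : Blocks m n) : 0 ≤ a * ‖sqrtLapApply G w‖ ^ 2 := by positivity
  have hmain := stmPlain_spec (L := Λ) (μ := ν) (F := auxObj G a c b) (u := z)
    (x₀ := c⁻¹ • b) (grad := fun z => do
      let w ← gossip G z
      pure (c • z + (2 * a) • w - b)) hΛ0 hν0.le ?_ ?_ ?_ ?_ hx₀ (τ + 1)
  rotate_left
  · intro x y
    have h1 := auxObj_expand (G := G) a c b y x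
    have h2 := hpen (x - y)
    have h3 : 0 ≤ c / 2 * ‖x - y‖ ^ 2 := by positivity
    change _ + inner ℝ (auxGrad G a c b y) (x - y) ≤ _
    linarith
  · intro y hy
    have h1 := auxObj_expand (G := G) a c b y z
    have h2 := le_inner_lap_of_sum_eq_zero hm hG (z - y) (by
      simp only [PiLp.sub_apply, Finset.sum_sub_distrib, hy, sub_self])
    rw [← norm_sqrtLapApply_sq] at h2
    have h3 := mul_le_mul_of_nonneg_left h2 ha
    change _ + inner ℝ (auxGrad G a c b y) (z - y) + _ ≤ _
    have e : ν / 2 * ‖z - y‖ ^ 2 = c / 2 * ‖z - y‖ ^ 2 + a * (lamMinPos G * ‖z - y‖ ^ 2) := by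
      rw [hν]; ring
    linarith
  · intro x y
    have h1 := auxObj_expand (G := G) a c b y x
    have h3 := mul_le_mul_of_nonneg_left (sqrtLap_sq_le (G := G) (x - y)) ha
    change _ ≤ _ + inner ℝ (auxGrad G a c b y) (x - y) + _
    have e : Λ / 2 * ‖x - y‖ ^ 2 = c / 2 * ‖x - y‖ ^ 2 + a * (lamMax G * ‖x - y‖ ^ 2) := by
      rw [hΛ]; ring
    linarith
  · intro y hy
    change ∑ i, auxGrad G a c b y i = 0
    rw [sum_auxGrad, hy, hsumz, sub_self]
  change stmCoeff Λ ν (τ + 1) * (auxObj G a c b (auxSolve G (τ + 1) a c b).val - _) ≤ _ at hmain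
  set x := (auxSolve G (τ + 1) a c b).val with hx
  have hβ0 : 0 ≤ β := (norm_nonneg _).trans hb
  -- the distance between the starting point and the solution
  have hdist : ‖z - c⁻¹ • b‖ ≤ 2 * β := by
    -- $W$ kills the consensus vector, so $(cI+2aW)(z-\mathbf v)=b-c\mathbf v$, and $cI+2aW\ge I$.
    -- The bound does not depend on the penalty weight $a$.
    have h1 : ‖z - consensus m v‖ ≤ β := by
      set w := z - consensus m v with hw
      have e1 : c • w + (2 * a) • kronApply (G.lapMatrix ℝ) w = b - c • consensus m v := by
        have h2 : kronApply (G.lapMatrix ℝ) w = kronApply (G.lapMatrix ℝ) z := by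
          rw [hw, kronApply_eq, map_sub, ← kronApply_eq, ← kronApply_eq,
            kronApply_lap_consensus, sub_zero]
        have h3 : b = c • z + (2 * a) • kronApply (G.lapMatrix ℝ) z := by
          rw [auxGrad, sub_eq_zero] at hz
          exact hz.symm
        rw [h2, h3, hw]
        module
      have h2 : inner ℝ w (b - c • consensus m v) ≤ ‖w‖ * β :=
        (real_inner_le_norm _ _).trans (by gcongr)
      rw [← e1, inner_add_right, inner_smul_right, inner_smul_right,
        real_inner_self_eq_norm_sq] at h2
      have h3 := mul_nonneg (show 0 ≤ 2 * a by linarith) (lap_inner_nonneg G w)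
      rcases (norm_nonneg w).eq_or_lt with h0 | h0
      · rw [← h0]; exact hβ0
      · refine le_of_mul_le_mul_left ?_ h0
        nlinarith [sq_nonneg ‖w‖]
    have h2 : ‖consensus m v - c⁻¹ • b‖ ≤ β := by
      have e : consensus m v - c⁻¹ • b = -(c⁻¹ • (b - c • consensus m v)) := by
        rw [smul_sub, smul_smul, inv_mul_cancel₀ hc0.ne', one_smul]; abel
      rw [e, norm_neg, norm_smul, norm_inv, Real.norm_eq_abs, abs_of_pos hc0,
        inv_mul_le_iff₀ hc0]
      exact hb.trans (le_mul_of_one_le_left hβ0 hc)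
    have e : z - c⁻¹ • b = (z - consensus m v) + (consensus m v - c⁻¹ • b) := by abel
    rw [e]
    exact (norm_add_le _ _).trans (by linarith)
  -- the distance between the last iterate and the solution
  have hgap : 1 / 2 * ‖x - z‖ ^ 2 ≤ auxObj G a c b x - auxObj G a c b z := by
    have h1 := auxObj_expand (G := G) a c b z x
    rw [hz, inner_zero_left] at h1
    have h2 := hpen (x - z)
    have h3 : 1 / 2 * ‖x - z‖ ^ 2 ≤ c / 2 * ‖x - z‖ ^ 2 := by gcongr
    linarith
  have hA := stmCoeff_nonneg hΛ0 hν0.le (τ + 1)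
  have hfin : stmCoeff Λ ν (τ + 1) * ‖x - z‖ ^ 2 ≤ 4 * β ^ 2 := by
    have h1 := mul_le_mul_of_nonneg_left hgap hA
    have h2 : ‖z - c⁻¹ • b‖ ^ 2 ≤ (2 * β) ^ 2 := by gcongr
    linarith
  have hres : ‖auxGrad G a c b x‖ ≤ Λ * ‖x - z‖ := by
    have e1 : auxGrad G a c b x =
        c • (x - z) + (2 * a) • kronApply (G.lapMatrix ℝ) (x - z) := by
      have h2 : kronApply (G.lapMatrix ℝ) (x - z) =
          kronApply (G.lapMatrix ℝ) x - kronApply (G.lapMatrix ℝ) z := by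
        rw [kronApply_eq, map_sub]; rfl
      have h3 : b = c • z + (2 * a) • kronApply (G.lapMatrix ℝ) z := by
        rw [auxGrad, sub_eq_zero] at hz
        exact hz.symm
      rw [h2, auxGrad]
      nth_rewrite 1 [h3]
      module
    rw [e1]
    refine (norm_add_le _ _).trans ?_
    rw [norm_smul, norm_smul, Real.norm_eq_abs, Real.norm_eq_abs, abs_of_pos hc0,
      abs_of_nonneg (show 0 ≤ 2 * a by linarith)]
    have := mul_le_mul_of_nonneg_left (norm_lap_le hm hG (x - z)) (show 0 ≤ 2 * a by linarith)
    rw [hΛ]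
    linarith
  have hrate : (1 + √(1 / condNumber G) / 2) ^ (2 * τ) ≤ Λ * stmCoeff Λ ν (τ + 1) := by
    have h1 := pow_le_stmCoeff hΛ0 hν0.le τ
    rw [div_le_iff₀ hΛ0, mul_comm (stmCoeff Λ ν (τ + 1))] at h1
    -- Adding the same $c$ to $2a\lambda_{\min}^+$ and $2a\lambda_{\max}$ only improves the ratio,
    -- so the rate is uniform in $a$ and $c$.
    have hratio : 1 / condNumber G ≤ ν / Λ := by
      rw [condNumber, one_div_div, div_le_div_iff₀ hlm hΛ0, hΛ, hν]
      nlinarith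
    have hsqrt := Real.sqrt_le_sqrt hratio
    refine le_trans (pow_le_pow_left₀ (by positivity) ?_ _) h1
    linarith
  calc ‖auxGrad G a c b x‖ ^ 2 * (1 + √(1 / condNumber G) / 2) ^ (2 * τ)
      ≤ (Λ * ‖x - z‖) ^ 2 * (Λ * stmCoeff Λ ν (τ + 1)) := by gcongr
    _ = Λ ^ 3 * (stmCoeff Λ ν (τ + 1) * ‖x - z‖ ^ 2) := by ring
    _ ≤ Λ ^ 3 * (4 * β ^ 2) := by gcongr
    _ = 4 * β ^ 2 * Λ ^ 3 := by ring

end Auxiliary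

/-! ### Accuracy and complexity of PSTM -/

section PSTM

variable {m n : ℕ} {f : Fin m → Vec n → ℝ} {G : SimpleGraph (Fin m)} [DecidableRel G.Adj]

lemma pstm_cost (g : Fin m → Vec n → Vec n) (L μ ρ : ℝ) (N T : ℕ) (x₀ : Vec n) :
    (pstm G g L μ ρ N T x₀).rounds = N * T ∧ (pstm G g L μ ρ N T x₀).calls = N := by
  have := stm_cost (L / m) (μ / m) (grad := oracle g)
    (prox := fun A b => auxSolve G T (ρ * A) (1 + A * (μ / m)) b)
    (r₁ := 0) (r₂ := T) (c₁ := 1) (c₂ := 0) (fun _ => ⟨rfl, rfl⟩)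
    (fun _ _ => auxSolve_cost _ _ _ _) (consensus m x₀) N
  simpa [pstm] using this

/-- The penalized minimum can lie below $f(x^*)$, but by no more than
$\max_r(r-r^2/\delta)=\delta/4$. -/
lemma gap_lower_bound {M δ ρ : ℝ} (hδ : 0 < δ) (hρ : ρ = penaltyCoeff G M δ) {xs : Vec n}
    {x : Blocks m n} (hex : avg f xs ≤ avgBlocks f x + dualRadius G M * ‖sqrtLapApply G x‖) :
    avg f xs - δ / 4 ≤ penalized G f ρ x := by
  set r := dualRadius G M * ‖sqrtLapApply G x‖ with hr
  have h1 : penalized G f ρ x = avgBlocks f x + r ^ 2 / δ := by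
    rw [penalized, hρ, penaltyCoeff, hr]; ring
  have h2 : r - r ^ 2 / δ ≤ δ / 4 := by
    rw [sub_le_iff_le_add, ← sub_le_iff_le_add', le_div_iff₀ hδ]
    nlinarith [sq_nonneg (2 * r - δ)]
  linarith

/-- The accuracy of PSTM, when the number of inner steps is large enough. -/
lemma pstm_gap (hm : 2 ≤ m) (hG : G.Connected) {M L μ δ R : ℝ} (hM : 0 < M) (hL : 0 < L)
    (hμ : 0 ≤ μ) (hμL : μ ≤ L) (hδ : 0 < δ) (hR : 0 < R) {N τ : ℕ} {a D e Γ β Λ : ℝ}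
    (ha : a = stmCoeff (L / m) (μ / m) N) (haR : m * R ^ 2 / δ ≤ a)
    (hD : D = √(8 * (m * R ^ 2) + 4 * a * δ)) (he : e = D / (16 * (N + 1)))
    (hΓ : Γ = M / √m + 2 * (L / m) * D) (hβ : β = √m * R + a * Γ)
    (hΛ : Λ = 1 + a * (μ / m) + 2 * (penaltyCoeff G M δ * a) * lamMax G)
    (hτ : 4 * β ^ 2 * Λ ^ 3 ≤ e ^ 2 * (1 + √(1 / condNumber G) / 2) ^ (2 * τ))
    {x₀ xs : Vec n} (h : ∀ k, StronglyConvexWith μ Set.univ (f k) (gradient (f k)))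
    (hs : ∀ k, IsSmoothWith L (f k)) (hmin : IsMinOn (avg f) Set.univ xs)
    (hx : ‖x₀ - xs‖ ≤ R) (hg : ∀ k, ‖gradient (f k) xs‖ ≤ M) :
    penalized G f (penaltyCoeff G M δ)
      (pstm G (fun k => gradient (f k)) L μ (penaltyCoeff G M δ) N (τ + 1) x₀).val
        - avg f xs ≤ 2 * δ := by
  have hm' : (0 : ℝ) < m := by positivity
  have hχ := one_le_condNumber hm hG
  have hlm := lamMax_pos hm hG
  have h0 (k : Fin m) := (h k).mono hμ
  have hLm : 0 < L / m := by positivity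
  have hμm : 0 ≤ μ / m := by positivity
  have ha0 : 0 < a := lt_of_lt_of_le (by positivity) haR
  set ρ := penaltyCoeff G M δ with hρ
  have hρ0 : 0 ≤ ρ := by rw [hρ, penaltyCoeff]; positivity
  have hDsq : D ^ 2 = 8 * (m * R ^ 2) + 4 * a * δ := by
    rw [hD, Real.sq_sqrt (by positivity)]
  have hD0 : 0 < D := by rw [hD]; exact Real.sqrt_pos.2 (by positivity)
  have he0 : 0 < e := by rw [he]; positivity
  have hsm : √(m : ℝ) ^ 2 = m := Real.sq_sqrt hm'.le
  have hmain := stm_inexact_spec (L := L / m) (μ := μ / m) hLm hμm (F := avgBlocks f)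
    (h := fun x => ρ * ‖sqrtLapApply G x‖ ^ 2) (grad := oracle fun k => gradient (f k))
    (prox := fun A b => auxSolve G (τ + 1) (ρ * A) (1 + A * (μ / m)) b)
    (u := consensus m xs) (x₀ := consensus m x₀) (N := N) (D := D) (e := e) (δ := δ)
    (R := √m * R) (Γ := Γ) ?_ ?_ ?_ ?_ ?_ ?_ hδ.le ?_ hD0 ?_ ?_ ?_
  rotate_left
  · intro x y
    simpa using avgBlocks_lower h0 (x := y) (y := x) (fun _ => trivial) fun _ => trivial
  · intro y
    exact avgBlocks_lower h (fun _ => trivial) fun _ => trivial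
  · intro x y
    exact avgBlocks_upper hs y x
  · intro v w t ht ht1
    have := mul_le_mul_of_nonneg_left (sqrtLap_sq_convexCombo_le (G := G) v w ht ht1) hρ0
    linarith
  · intro x
    have h1 := gap_lower_bound (f := f) hδ hρ
      (exact_penalty_smooth hm hG hM h0 (fun k => (hs k).1) hmin hg x)
    rw [sqrtLapApply_consensus, avgBlocks_consensus]
    rw [penalized] at h1
    simpa using h1
  · rw [← consensus_sub]
    refine abs_le_of_sq_le_sq' ?_ (by positivity) |>.2
    rw [consensus_norm_sq, mul_pow, hsm]
    gcongr
  · rw [← ha, hDsq, mul_pow, hsm]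
  · rw [he]; field_simp
  · intro y hy
    have h1 := norm_oracle_sub_le (g := fun k => gradient (f k)) hL.le (fun k => (hs k).2) y
      (consensus m xs)
    have h2 : ‖(oracle (fun k => gradient (f k)) (consensus m xs)).val‖ ≤ M / √m :=
      norm_oracle_le hM.le hg
    have h3 : L / m * ‖y - consensus m xs‖ ≤ L / m * D := by gcongr
    -- By $\mu\le L$ this shift obeys the same bound as the change of the gradient, whence the
    -- factor $2$ in $\Gamma$.
    have h4 : ‖(μ / m) • (y - consensus m xs)‖ ≤ L / m * D := by
      rw [norm_smul, Real.norm_eq_abs, abs_of_nonneg hμm]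
      gcongr
    set d := (oracle (fun k => gradient (f k)) y).val
    set d' := (oracle (fun k => gradient (f k)) (consensus m xs)).val
    have e1 : d - (μ / m) • (y - consensus m xs) =
      d' + ((d - d') - (μ / m) • (y - consensus m xs)) := by abel
    rw [e1, hΓ]
    refine (norm_add_le _ _).trans ?_
    have := norm_sub_le (d - d') ((μ / m) • (y - consensus m xs))
    linarith
  · intro A b hA hAN hb
    rw [← ha] at hAN hb
    rw [← hβ] at hb
    refine isApproxProx_of_auxGrad hρ0 hA ?_
    have hc : 1 ≤ 1 + A * (μ / m) := by
      have := mul_nonneg hA hμm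
      linarith
    have h1 := auxSolve_spec hm hG (mul_nonneg hρ0 hA) hc b xs hb τ
    have h2 : 4 * β ^ 2 * (1 + A * (μ / m) + 2 * (ρ * A) * lamMax G) ^ 3 ≤
        4 * β ^ 2 * Λ ^ 3 := by
      rw [hΛ]
      have := mul_nonneg hρ0 hA
      gcongr
    have hr : 0 < (1 + √(1 / condNumber G) / 2) ^ (2 * τ) := by positivity
    refine abs_le_of_sq_le_sq' ?_ he0.le |>.2
    exact le_of_mul_le_mul_right (h1.trans (h2.trans hτ)) hr
  rw [← ha, sqrtLapApply_consensus, avgBlocks_consensus, norm_zero, hDsq, mul_pow, hsm] at hmain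
  change a * (penalized G f ρ (pstm G (fun k => gradient (f k)) L μ ρ N (τ + 1) x₀).val
    - _) ≤ _ at hmain
  -- The estimate gives $\frac12mR^2+\frac18D^2=\frac32mR^2+\frac12a\delta$, which is at most
  -- $2a\delta$.
  have h5 : m * R ^ 2 ≤ a * δ := by rwa [div_le_iff₀ hδ] at haR
  refine le_of_mul_le_mul_left ?_ ha0
  have e0 : avg f xs + ρ * 0 ^ 2 = avg f xs := by ring
  rw [e0] at hmain
  linarith

/-- The inner accuracy that suffices for PSTM, in terms of a bound `s` for all the ratios. -/
lemma inner_accuracy_bound {m' M L μ ε R χ s a D e Γ β Λ N ρl : ℝ} (hm : 0 < m') (hM : 0 < M)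
    (hL : 0 < L) (hμ : 0 ≤ μ) (hμL : μ ≤ L) (hε : 0 < ε) (hR : 0 < R) (hs : 3 ≤ s)
    (hκ : ε ≤ L * R ^ 2) (hMs : M * R / ε ≤ s) (hχ0 : 0 ≤ χ) (hχs : χ ≤ s)
    (hN0 : 0 ≤ N) (hN : N + 1 ≤ s ^ 5) (ha0 : 0 ≤ a) (ha : a * L / m' ≤ s ^ 20)
    (hD : D = √(8 * (m' * R ^ 2) + 4 * a * (ε / 2))) (he : e = D / (16 * (N + 1)))
    (hΓ : Γ = M / √m' + 2 * (L / m') * D) (hβ : β = √m' * R + a * Γ)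
    (hρl : ρl = M ^ 2 * χ / (m' * (ε / 2)))
    (hΛ : Λ = 1 + a * (μ / m') + 2 * a * ρl) :
    4 * β ^ 2 * Λ ^ 3 ≤ e ^ 2 * s ^ 137 := by
  have hs0 : 0 < s := by linarith
  have hsm : 0 < √m' := Real.sqrt_pos.2 hm
  have hsm2 : √m' * √m' = m' := Real.mul_self_sqrt hm.le
  have hDR : √m' * R ≤ D := by
    rw [hD]
    refine Real.le_sqrt_of_sq_le ?_
    rw [mul_pow, sq √m', hsm2]
    have : 0 ≤ m' * R ^ 2 := by positivity
    have : 0 ≤ a * ε := by positivity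
    linarith
  have hD0 : 0 < D := lt_of_lt_of_le (by positivity) hDR
  set α := a * L / m' with hα
  have hα0 : 0 ≤ α := by positivity
  have hML : M / L ≤ s * R := by
    have h1 : M * R ≤ s * ε := by rwa [div_le_iff₀ hε] at hMs
    rw [div_le_iff₀ hL]
    have h2 : M * R ≤ s * R * L * R := by nlinarith
    exact le_of_mul_le_mul_right h2 hR
  have hp1 : (1 : ℝ) ≤ s ^ 20 := one_le_pow₀ (by linarith)
  have h16 : (16 : ℝ) ≤ s ^ 3 := by
    have : (3 : ℝ) ^ 3 ≤ s ^ 3 := by gcongr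
    linarith
  have h9 : (9 : ℝ) ≤ s * s := by
    have : (3 : ℝ) * 3 ≤ s * s := by gcongr
    linarith
  have hβD : β ≤ s ^ 22 * D := by
    have e1 : a * (M / √m') = α * (√m' * (M / L)) := by
      rw [hα]
      have : m' = √m' * √m' := hsm2.symm
      rw [this]; field_simp; simp
    have e2 : a * (2 * (L / m') * D) = 2 * α * D := by rw [hα]; ring
    have h1 : α * (√m' * (M / L)) ≤ s ^ 20 * s * D := by
      calc α * (√m' * (M / L)) ≤ s ^ 20 * (√m' * (s * R)) := by gcongr
        _ = s ^ 20 * s * (√m' * R) := by ring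
        _ ≤ s ^ 20 * s * D := by gcongr
    have h2 : 2 * α * D ≤ 2 * s ^ 20 * D := by gcongr
    rw [hβ, hΓ, mul_add, e1, e2]
    have h3 : 1 + s ^ 20 * s + 2 * s ^ 20 ≤ s ^ 22 := by
      have : s ^ 22 = s ^ 20 * (s * s) := by ring
      rw [this]
      have h5 : 0 ≤ s * s - s - 3 := by nlinarith
      have := mul_nonneg (zero_le_one.trans hp1) h5
      linarith
    have h4 := mul_le_mul_of_nonneg_right h3 hD0.le
    linarith
  have hDe : D = 16 * (N + 1) * e := by rw [he]; field_simp
  have he0 : 0 < e := by rw [he]; positivity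
  have hβ0 : 0 ≤ β := by rw [hβ, hΓ]; positivity
  have hβe : β ≤ s ^ 30 * e := by
    calc β ≤ s ^ 22 * D := hβD
      _ = s ^ 22 * (16 * (N + 1) * e) := by rw [← hDe]
      _ ≤ s ^ 22 * (s ^ 3 * s ^ 5 * e) := by gcongr
      _ = s ^ 30 * e := by ring
  have hΛs : Λ ≤ s ^ 25 := by
    have h1 : a * (μ / m') ≤ s ^ 20 := by
      refine le_trans ?_ ha
      rw [hα, mul_div_assoc]
      gcongr
    -- Written in scale-free ratios, each of which is bounded by a power of $s$ or by $1$.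
    have h2 : 2 * a * ρl = 4 * α * χ * ((M * R / ε) ^ 2 * (ε / (L * R ^ 2))) := by
      rw [hρl, hα]; field_simp; ring
    have h3 : ε / (L * R ^ 2) ≤ 1 := (div_le_one (by positivity)).2 hκ
    have h4 : 2 * a * ρl ≤ 4 * s ^ 20 * s * (s ^ 2 * 1) := by
      rw [h2]; gcongr
    have e1 : s ^ 25 = s ^ 20 * (s ^ 3 * (s * s)) := by ring
    have h6 : (1 : ℝ) ≤ s ^ 3 := by linarith
    have h7 : s ^ 20 * (s ^ 3 * 6) ≤ s ^ 20 * (s ^ 3 * (s * s)) := by gcongr; linarith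
    have h8 : s ^ 20 * 1 ≤ s ^ 20 * s ^ 3 := by gcongr
    rw [hΛ, e1]
    linarith
  have hΛ0 : 0 ≤ Λ := by
    have : 0 ≤ ρl := by rw [hρl]; positivity
    rw [hΛ]; positivity
  -- $137=2+2\cdot30+3\cdot25$.
  calc 4 * β ^ 2 * Λ ^ 3 ≤ s ^ 2 * (s ^ 30 * e) ^ 2 * (s ^ 25) ^ 3 := by
        have : (4 : ℝ) ≤ s ^ 2 := by rw [sq]; linarith
        gcongr
    _ = e ^ 2 * s ^ 137 := by ring

/-- $\ln(1+x)\ge x/(1+x)\ge x/2$ on $[0,1]$. -/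
lemma exp_mul_le_pow {x : ℝ} (hx0 : 0 ≤ x) (hx1 : x ≤ 1) (k : ℕ) :
    Real.exp (k * x) ≤ (1 + x) ^ (2 * k) := by
  have h1 : x / 2 ≤ Real.log (1 + x) := by
    have h := Real.one_sub_inv_le_log_of_pos (show 0 < 1 + x by linarith)
    refine le_trans ?_ h
    have : 1 - (1 + x)⁻¹ = x / (1 + x) := by field_simp; ring
    rw [this]
    gcongr
    linarith
  rw [← Real.exp_log (show 0 < (1 + x) ^ (2 * k) by positivity), Real.log_pow]
  apply Real.exp_le_exp.2
  push_cast
  have := mul_le_mul_of_nonneg_left h1 (show (0 : ℝ) ≤ 2 * k by positivity)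
  linarith

lemma le_pow_five {x s : ℝ} (hs : 3 ≤ s) (hx : x ≤ 7 * (s * s)) : x ≤ s ^ 5 := by
  have h27 : (3 : ℝ) ^ 3 ≤ s ^ 3 := by gcongr
  calc x ≤ 7 * (s * s) := hx
    _ ≤ s ^ 3 * (s * s) := by gcongr; linarith
    _ = s ^ 5 := by ring

lemma sq_mul_pow_le {y s : ℝ} {N : ℕ} (hs : 3 ≤ s) (hy : 0 ≤ y) (hN : (N : ℝ) ≤ 6 * (s * s))
    (hNy : N * y ≤ 6 * Real.log s) : (N : ℝ) ^ 2 * (1 + y) ^ (2 * N) ≤ s ^ 20 := by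
  have hs0 : 0 < s := by linarith
  have h9 : (9 : ℝ) ≤ s * s := by
    have : (3 : ℝ) * 3 ≤ s * s := by gcongr
    linarith
  have h3 : (1 + y) ^ (2 * N) ≤ s ^ 12 := by
    have h4 : 1 + y ≤ Real.exp y := by linarith [Real.add_one_le_exp y]
    refine (pow_le_pow_left₀ (by positivity) h4 _).trans ?_
    rw [← Real.exp_nat_mul, ← Real.exp_log (show 0 < s ^ 12 by positivity), Real.log_pow]
    apply Real.exp_le_exp.2
    push_cast
    linarith
  have h6 : (N : ℝ) ^ 2 ≤ s ^ 8 := by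
    calc (N : ℝ) ^ 2 ≤ (6 * (s * s)) ^ 2 := by gcongr
      _ ≤ ((s * s) * (s * s)) ^ 2 := by gcongr; linarith
      _ = s ^ 8 := by ring
  calc (N : ℝ) ^ 2 * (1 + y) ^ (2 * N) ≤ s ^ 8 * s ^ 12 :=
        mul_le_mul h6 h3 (by positivity) (by positivity)
    _ = s ^ 20 := by ring

/-- The rate gains a factor $e^{1/(2\sqrt\chi)}$ per step, so $2\cdot137\sqrt\chi\ln s$ steps gain
$s^{137}$; rounding up and the extra first step account for $276$. -/
lemma exists_inner_steps {χ s : ℝ} (hχ : 1 ≤ χ) (hs : 3 ≤ s) :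
    ∃ τ : ℕ, s ^ 137 ≤ (1 + √(1 / χ) / 2) ^ (2 * τ) ∧
      ((τ + 1 : ℕ) : ℝ) ≤ 276 * (√χ * Real.log s) := by
  have hχ1 : 1 ≤ √χ := Real.one_le_sqrt.2 hχ
  have hl : 1 ≤ Real.log s := by
    rw [Real.le_log_iff_exp_le (by linarith)]
    linarith [Real.exp_one_lt_d9]
  have hl1 : 1 ≤ √χ * Real.log s := one_le_mul_of_one_le_of_one_le hχ1 hl
  have h1 := Nat.le_ceil (274 * (√χ * Real.log s))
  have h2 := Nat.ceil_lt_add_one (show 0 ≤ 274 * (√χ * Real.log s) by positivity)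
  refine ⟨⌈274 * (√χ * Real.log s)⌉₊, ?_, ?_⟩
  · set τ := ⌈274 * (√χ * Real.log s)⌉₊
    have e1 : √(1 / χ) = 1 / √χ := by rw [Real.sqrt_div zero_le_one, Real.sqrt_one]
    have hx1 : √(1 / χ) / 2 ≤ 1 := by
      have : 1 / √χ ≤ 1 := (div_le_one (by linarith)).2 hχ1
      rw [e1]; linarith
    refine le_trans ?_ (exp_mul_le_pow (by positivity) hx1 τ)
    rw [← Real.exp_log (show 0 < s ^ 137 by positivity), Real.log_pow]
    apply Real.exp_le_exp.2
    have h3 := mul_le_mul_of_nonneg_right h1 (show 0 ≤ √(1 / χ) / 2 by positivity)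
    refine le_trans (le_of_eq ?_) h3
    rw [e1]
    push_cast
    field_simp
    ring
  · push_cast
    linarith

/-- PSTM with a number of outer steps that is large enough, but polynomially bounded in `s`. -/
lemma pstm_achieves (hm : 2 ≤ m) (hG : G.Connected) {M L μ ε R s : ℝ} (hM : 0 < M) (hL : 0 < L)
    (hμ : 0 ≤ μ) (hμL : μ ≤ L) (hε : 0 < ε) (hR : 0 < R) (hs : 3 ≤ s)
    (hκ : ε ≤ L * R ^ 2) (hMs : M * R / ε ≤ s) (hχs : condNumber G ≤ s) {N : ℕ}
    (hN : (N : ℝ) + 1 ≤ s ^ 5) (hlow : 2 * (L * R ^ 2 / ε) ≤ stmCoeff (L / m) (μ / m) N * L / m)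
    (hhigh : stmCoeff (L / m) (μ / m) N * L / m ≤ s ^ 20) :
    ∃ T : ℕ, (T : ℝ) ≤ 276 * (√(condNumber G) * Real.log s) ∧
      ∀ (f : Fin m → Vec n → ℝ) (x₀ xs : Vec n),
        (∀ k, StronglyConvexWith μ Set.univ (f k) (gradient (f k))) →
        (∀ k, IsSmoothWith L (f k)) →
        IsMinOn (avg f) Set.univ xs → ‖x₀ - xs‖ ≤ R → (∀ k, ‖gradient (f k) xs‖ ≤ M) →
        Achieves (pstm G (fun k => gradient (f k)) L μ (penaltyCoeff G M (ε / 2)) N T x₀)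
          G Set.univ f M xs ε (N * T) N := by
  have hm' : (0 : ℝ) < m := by positivity
  have hχ := one_le_condNumber hm hG
  obtain ⟨τ, hτ, hT⟩ := exists_inner_steps hχ hs
  refine ⟨τ + 1, hT, ?_⟩
  intro f x₀ xs h hsm hmin hx hg
  have ha0 := stmCoeff_nonneg (show 0 < L / m by positivity) (show 0 ≤ μ / m by positivity) N
  have hgap := pstm_gap (x₀ := x₀) (τ := τ) hm hG hM hL hμ hμL (half_pos hε) hR
    (N := N) rfl ?_ rfl rfl rfl rfl rfl ?_ h hsm hmin hx hg
  · refine ⟨isEpsSolution_of_gap (dualRadius_pos hm hG hM) (half_pos hε) rfl (fun _ => trivial)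
      (exact_penalty_smooth hm hG hM (fun k => (h k).mono hμ) (fun k => (hsm k).1) hmin hg _)
      hgap (by linarith), ?_, ?_⟩
    · rw [(pstm_cost _ _ _ _ _ _ _).1]; push_cast; exact le_rfl
    · rw [(pstm_cost _ _ _ _ _ _ _).2]
  · have h1 := mul_le_mul_of_nonneg_right hlow (show 0 ≤ (m : ℝ) / L by positivity)
    have e1 : stmCoeff (L / m) (μ / m) N * L / m * (m / L) = stmCoeff (L / m) (μ / m) N := by
      field_simp
    rw [e1] at h1
    refine le_trans (le_of_eq ?_) h1
    field_simp
  · refine (inner_accuracy_bound hm' hM hL hμ hμL hε hR hs hκ hMs (by linarith) hχs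
      N.cast_nonneg hN ha0 hhigh rfl rfl rfl rfl rfl ?_).trans
      (mul_le_mul_of_nonneg_left hτ (sq_nonneg _))
    rw [← penaltyCoeff_mul_lamMax hm hG]
    ring

lemma pstm_zero_achieves (hm : 2 ≤ m) (hG : G.Connected) {M L μ ε δ r c : ℝ} (hM : 0 < M)
    (hε : 0 < ε) (hr : 0 ≤ r) (hc : 0 ≤ c) {x₀ xs : Vec n} (hgap : avg f x₀ - avg f xs ≤ ε) :
    Achieves (pstm G (fun k => gradient (f k)) L μ (penaltyCoeff G M δ) 0 0 x₀)
      G Set.univ f M xs ε r c := by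
  refine ⟨isEpsSolution_consensus (dualRadius_pos hm hG hM) hε.le trivial hgap, ?_, ?_⟩
  · rw [(pstm_cost _ _ _ _ _ _ _).1]; simpa using hr
  · rw [(pstm_cost _ _ _ _ _ _ _).2]; simpa using hc

theorem pstm_complexity_convex (hm : 2 ≤ m) (hG : G.Connected) {ε M L R : ℝ} (hε : 0 < ε)
    (hM : 0 < M) (hL : 0 < L) (hR : 0 < R) :
    ∃ (δ : ℝ) (N T : ℕ), 0 < δ ∧ δ ≤ ε ∧
      ∀ (f : Fin m → Vec n → ℝ) (x₀ xs : Vec n),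
        (∀ k, StronglyConvexWith 0 Set.univ (f k) (gradient (f k))) →
        (∀ k, IsSmoothWith L (f k)) →
        IsMinOn (avg f) Set.univ xs → ‖x₀ - xs‖ ≤ R → (∀ k, ‖gradient (f k) xs‖ ≤ M) →
        Achieves (pstm G (fun k => gradient (f k)) L 0 (penaltyCoeff G M δ) N T x₀)
          G Set.univ f M xs ε
          (20000 * √(L * R ^ 2 / ε * condNumber G) *
            Real.log (2 + L * R ^ 2 / ε + M * R / ε + condNumber G) ^ 2)
          (20000 * √(L * R ^ 2 / ε)) := by
  have hχ := one_le_condNumber hm hG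
  have hm' : (0 : ℝ) < m := by positivity
  set κ := L * R ^ 2 / ε with hκd
  have hκ0 : 0 < κ := by positivity
  have hMR : 0 < M * R / ε := by positivity
  set s := 2 + κ + M * R / ε + condNumber G with hsd
  have hs3 : 3 ≤ s := by linarith
  have hl : 1 ≤ Real.log s := by
    rw [Real.le_log_iff_exp_le (by linarith)]
    linarith [Real.exp_one_lt_d9]
  rcases le_total κ 1 with hκ | hκ
  · refine ⟨ε / 2, 0, 0, by linarith, by linarith, ?_⟩
    intro f x₀ xs h hsm hmin hx hg
    refine pstm_zero_achieves hm hG hM hε (by positivity) (by positivity) ?_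
    refine (avg_gap_le_of_smooth (by omega) hsm hmin x₀).trans ?_
    have h1 : L * R ^ 2 ≤ ε := by rwa [hκd, div_le_one hε] at hκ
    have h2 : L / 2 * ‖x₀ - xs‖ ^ 2 ≤ L / 2 * R ^ 2 := by gcongr
    linarith
  · have hs1 : 1 ≤ √κ := Real.one_le_sqrt.2 hκ
    have hκs : √κ ^ 2 = κ := Real.sq_sqrt hκ0.le
    -- $A_NL/m\ge N^2/4\ge\frac94\kappa$ exceeds the required $2\kappa$ without any logarithm in the
    -- number of oracle calls.
    have hN1 := Nat.le_ceil (3 * √κ)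
    have hN2 : (⌈3 * √κ⌉₊ : ℝ) ≤ 4 * √κ := by
      linarith [Nat.ceil_lt_add_one (show 0 ≤ 3 * √κ by linarith)]
    set N := ⌈3 * √κ⌉₊
    have hsκ : √κ ≤ s := by
      have := mul_le_mul_of_nonneg_left hs1 (Real.sqrt_nonneg κ)
      rw [← sq, hκs] at this
      linarith
    have h3s : 3 * s ≤ s * s := by gcongr
    have hs2 : 27 ≤ s ^ 3 := by
      have : (3 : ℝ) ^ 3 ≤ s ^ 3 := by gcongr
      linarith
    obtain ⟨T, hT, H⟩ := pstm_achieves (n := n) (s := s) (N := N) hm hG hM hL le_rfl hL.le hε hR hs3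
      (by rwa [hκd, one_le_div hε] at hκ) (by linarith) (by linarith)
      (le_pow_five hs3 (by linarith))
      (by
        have h1 := le_stmCoeff (show 0 < L / m by positivity) (show 0 ≤ (0 : ℝ) / m by simp) N
        have h2 := mul_le_mul_of_nonneg_right h1 (show 0 ≤ L / m by positivity)
        have e1 : (N : ℝ) ^ 2 / (4 * (L / m)) * (L / m) = N ^ 2 / 4 := by field_simp
        have h3 : (3 * √κ) ^ 2 ≤ (N : ℝ) ^ 2 := by gcongr
        rw [mul_pow, hκs] at h3
        rw [e1] at h2
        rw [mul_div_assoc (stmCoeff (L / m) (0 / m) N)]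
        linarith)
      (by
        have h1 := stmCoeff_le (show 0 < L / m by positivity) (show 0 ≤ (0 : ℝ) / m by simp) N
        have h2 := mul_le_mul_of_nonneg_right h1 (show 0 ≤ L / m by positivity)
        simp only [zero_div, Real.sqrt_zero, add_zero, one_pow, mul_one] at h2
        rw [div_mul_cancel₀ _ (by positivity : L / (m : ℝ) ≠ 0)] at h2
        have h3 : (N : ℝ) ^ 2 ≤ (4 * √κ) ^ 2 := by gcongr
        rw [mul_pow, hκs] at h3
        rw [mul_div_assoc, zero_div]
        refine h2.trans (h3.trans ?_)
        calc (4 : ℝ) ^ 2 * κ ≤ s ^ 3 * s := by gcongr <;> linarith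
          _ = s ^ 4 := by ring
          _ ≤ s ^ 20 := pow_le_pow_right₀ (by linarith) (by norm_num))
    refine ⟨ε / 2, N, T, by linarith, by linarith, ?_⟩
    intro f x₀ xs h hsm hmin hx hg
    obtain ⟨h1, h2, h3⟩ := H f x₀ xs h hsm hmin hx hg
    refine ⟨h1, h2.trans ?_, h3.trans (by linarith)⟩
    rw [Real.sqrt_mul hκ0.le]
    calc (N : ℝ) * T ≤ (4 * √κ) * (276 * (√(condNumber G) * Real.log s)) := by gcongr
      _ = 1104 * (√κ * √(condNumber G)) * Real.log s := by ring
      _ ≤ 20000 * (√κ * √(condNumber G)) * Real.log s ^ 2 := by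
        have : Real.log s ≤ Real.log s ^ 2 := le_self_pow₀ hl two_ne_zero
        gcongr
        norm_num

set_option maxHeartbeats 1000000 in
theorem pstm_complexity_stronglyConvex (hm : 2 ≤ m) (hG : G.Connected) {ε M μ L R : ℝ}
    (hε : 0 < ε) (hM : 0 < M) (hμ : 0 < μ) (hL : 0 < L) (hR : 0 < R) :
    ∃ (δ : ℝ) (N T : ℕ), 0 < δ ∧ δ ≤ ε ∧
      ∀ (f : Fin m → Vec n → ℝ) (x₀ xs : Vec n),
        (∀ k, StronglyConvexWith μ Set.univ (f k) (gradient (f k))) →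
        (∀ k, IsSmoothWith L (f k)) →
        IsMinOn (avg f) Set.univ xs → ‖x₀ - xs‖ ≤ R → (∀ k, ‖gradient (f k) xs‖ ≤ M) →
        Achieves (pstm G (fun k => gradient (f k)) L μ (penaltyCoeff G M δ) N T x₀)
          G Set.univ f M xs ε
          (20000 * √(L / μ * condNumber G) *
            Real.log (2 + L / μ + L * R ^ 2 / ε + M * R / ε + condNumber G) ^ 2)
          (20000 * √(L / μ) *
            Real.log (2 + L / μ + L * R ^ 2 / ε + M * R / ε + condNumber G) ^ 2) := by
  have hχ := one_le_condNumber hm hG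
  have hm' : (0 : ℝ) < m := by positivity
  set κ := L * R ^ 2 / ε with hκd
  have hκ0 : 0 < κ := by positivity
  have hMR : 0 < M * R / ε := by positivity
  set q := L / μ with hq
  have hq0 : 0 < q := by positivity
  set s := 2 + q + κ + M * R / ε + condNumber G with hsd
  have hs3 : 3 ≤ s := by linarith
  have hl : 1 ≤ Real.log s := by
    rw [Real.le_log_iff_exp_le (by linarith)]
    linarith [Real.exp_one_lt_d9]
  -- For $L<\mu$ the smoothness and growth bounds together force $x_0=x_s$, so zero steps suffice.
  rcases lt_or_ge L μ with hLμ | hμL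
  · refine ⟨ε / 2, 0, 0, by linarith, by linarith, ?_⟩
    intro f x₀ xs h hsm hmin hx hg
    refine pstm_zero_achieves hm hG hM hε (by positivity) (by positivity) ?_
    have h1 := avg_gap_le_of_smooth (by omega) hsm hmin x₀
    have h2 := avg_growth (by omega) convex_univ h trivial hmin (Set.mem_univ x₀)
    have h3 : (μ - L) / 2 * ‖x₀ - xs‖ ^ 2 ≤ 0 := by linarith
    have h4 : ‖x₀ - xs‖ ^ 2 ≤ 0 := by
      by_contra! h
      have := mul_pos (show 0 < (μ - L) / 2 by linarith) h
      linarith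
    have h5 : ‖x₀ - xs‖ ^ 2 = 0 := le_antisymm h4 (sq_nonneg _)
    rw [h5] at h1
    linarith
  rcases le_total κ 1 with hκ | hκ
  · refine ⟨ε / 2, 0, 0, by linarith, by linarith, ?_⟩
    intro f x₀ xs h hsm hmin hx hg
    refine pstm_zero_achieves hm hG hM hε (by positivity) (by positivity) ?_
    refine (avg_gap_le_of_smooth (by omega) hsm hmin x₀).trans ?_
    have h1 : L * R ^ 2 ≤ ε := by rwa [hκd, div_le_one hε] at hκ
    have h2 : L / 2 * ‖x₀ - xs‖ ^ 2 ≤ L / 2 * R ^ 2 := by gcongr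
    linarith
  · have hq1 : 1 ≤ q := (one_le_div hμ).2 hμL
    have hs1 : 1 ≤ √q := Real.one_le_sqrt.2 hq1
    have hqs : √q ^ 2 = q := Real.sq_sqrt hq0.le
    have hinv : √(μ / L) = 1 / √q := by
      rw [hq, ← one_div_div L μ, Real.sqrt_div zero_le_one, Real.sqrt_one]
    have hql : 1 ≤ √q * Real.log s := one_le_mul_of_one_le_of_one_le hs1 hl
    -- $A_{k+1}L/m\ge e^{k/(2\sqrt q)}\ge s^2\ge2\kappa$. Conversely $(k+1)\sqrt{\mu/L}\le6\ln s$
    -- keeps $A_{k+1}L/m$ below $s^{20}$.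
    have hk1 := Nat.le_ceil (4 * (√q * Real.log s))
    have hk2 : (⌈4 * (√q * Real.log s)⌉₊ : ℝ) + 1 ≤ 6 * (√q * Real.log s) := by
      linarith [Nat.ceil_lt_add_one (show 0 ≤ 4 * (√q * Real.log s) by positivity)]
    set k := ⌈4 * (√q * Real.log s)⌉₊
    have hsq : √q ≤ s := by
      have := mul_le_mul_of_nonneg_left hs1 (Real.sqrt_nonneg q)
      rw [← sq, hqs] at this
      linarith
    have h3s : 3 * s ≤ s * s := by gcongr
    have hls : Real.log s ≤ s := by
      linarith [Real.log_le_sub_one_of_pos (show 0 < s by linarith)]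
    have hNs : (k : ℝ) + 1 ≤ 6 * (s * s) := hk2.trans (by gcongr)
    have hratio : μ / m / (L / m) = μ / L := by field_simp
    obtain ⟨T, hT, H⟩ := pstm_achieves (n := n) (s := s) (N := k + 1) hm hG hM hL hμ.le hμL hε hR hs3
      (by rwa [hκd, one_le_div hε] at hκ) (by linarith) (by linarith)
      (le_pow_five hs3 (by push_cast; linarith))
      (by
        have h1 := pow_le_stmCoeff (show 0 < L / m by positivity)
          (show 0 ≤ μ / m by positivity) k
        rw [div_le_iff₀ (by positivity), hratio] at h1
        rw [mul_div_assoc (stmCoeff (L / m) (μ / m) (k + 1))]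
        refine le_trans ?_ h1
        have hx1 : √(μ / L) / 2 ≤ 1 := by
          have : 1 / √q ≤ 1 := (div_le_one (by linarith)).2 hs1
          rw [hinv]; linarith
        refine le_trans ?_ (exp_mul_le_pow (by positivity) hx1 k)
        have h2 : 2 * Real.log s ≤ k * (√(μ / L) / 2) := by
          have := mul_le_mul_of_nonneg_right hk1 (show 0 ≤ √(μ / L) / 2 by positivity)
          refine le_trans (le_of_eq ?_) this
          rw [hinv]; field_simp; ring
        have h3 := Real.exp_le_exp.2 h2
        have e2 : Real.exp (2 * Real.log s) = s ^ 2 := by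
          rw [two_mul, Real.exp_add, Real.exp_log (by linarith)]; ring
        rw [e2] at h3
        refine le_trans ?_ h3
        change 2 * κ ≤ s ^ 2
        rw [sq s]
        linarith)
      (by
        have h1 := stmCoeff_le (show 0 < L / m by positivity)
          (show 0 ≤ μ / m by positivity) (k + 1)
        rw [hratio] at h1
        have h2 := mul_le_mul_of_nonneg_right h1 (show 0 ≤ L / m by positivity)
        have e1 (X Y : ℝ) : X / (L / m) * Y * (L / m) = X * Y := by field_simp
        rw [e1] at h2
        rw [mul_div_assoc]
        refine h2.trans (sq_mul_pow_le hs3 (Real.sqrt_nonneg _) (by push_cast; exact hNs) ?_)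
        push_cast
        have := mul_le_mul_of_nonneg_right hk2 (Real.sqrt_nonneg (μ / L))
        refine this.trans (le_of_eq ?_)
        rw [hinv]; field_simp)
    refine ⟨ε / 2, k + 1, T, by linarith, by linarith, ?_⟩
    intro f x₀ xs h hsm hmin hx hg
    obtain ⟨h1, h2, h3⟩ := H f x₀ xs h hsm hmin hx hg
    refine ⟨h1, h2.trans ?_, h3.trans ?_⟩
    · rw [Real.sqrt_mul hq0.le]
      push_cast
      calc ((k : ℝ) + 1) * T ≤ (6 * (√q * Real.log s)) *
            (276 * (√(condNumber G) * Real.log s)) := by gcongr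
        _ = 1656 * (√q * √(condNumber G)) * Real.log s ^ 2 := by ring
        _ ≤ 20000 * (√q * √(condNumber G)) * Real.log s ^ 2 := by gcongr; norm_num
    · push_cast
      calc (k : ℝ) + 1 ≤ 6 * (√q * Real.log s) := hk2
        _ = 6 * √q * Real.log s := by ring
        _ ≤ 20000 * √q * Real.log s ^ 2 := by
          have : Real.log s ≤ Real.log s ^ 2 := le_self_pow₀ hl two_ne_zero
          gcongr
          norm_num

end PSTM

end Decentralized

end

/-! ### The four complexity bounds together -/

open Decentralized in
theorem mainTheorem1 :
    ∃ (C : ℝ) (p : ℕ), 0 < C ∧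
      ∀ (m n : ℕ) (G : SimpleGraph (Fin m)) [DecidableRel G.Adj], 2 ≤ m → G.Connected →
      ∀ ε M : ℝ, 0 < ε → 0 < M →
      -- strongly convex and smooth: PSTM on the whole space
      (∀ μ L R : ℝ, 0 < μ → 0 < L → 0 < R →
        ∃ (δ : ℝ) (N T : ℕ), 0 < δ ∧ δ ≤ ε ∧
          ∀ (f : Fin m → Vec n → ℝ) (x₀ xs : Vec n),
            (∀ k, StronglyConvexWith μ Set.univ (f k) (gradient (f k))) →
            (∀ k, IsSmoothWith L (f k)) →
            IsMinOn (avg f) Set.univ xs → ‖x₀ - xs‖ ≤ R → (∀ k, ‖gradient (f k) xs‖ ≤ M) →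
            Achieves (pstm G (fun k => gradient (f k)) L μ (penaltyCoeff G M δ) N T x₀)
              G Set.univ f M xs ε
              (C * √(L / μ * condNumber G) *
                Real.log (2 + L / μ + L * R ^ 2 / ε + M * R / ε + condNumber G) ^ p)
              (C * √(L / μ) *
                Real.log (2 + L / μ + L * R ^ 2 / ε + M * R / ε + condNumber G) ^ p)) ∧
      -- convex and smooth: PSTM on the whole space
      (∀ L R : ℝ, 0 < L → 0 < R →
        ∃ (δ : ℝ) (N T : ℕ), 0 < δ ∧ δ ≤ ε ∧
          ∀ (f : Fin m → Vec n → ℝ) (x₀ xs : Vec n),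
            (∀ k, StronglyConvexWith 0 Set.univ (f k) (gradient (f k))) →
            (∀ k, IsSmoothWith L (f k)) →
            IsMinOn (avg f) Set.univ xs → ‖x₀ - xs‖ ≤ R → (∀ k, ‖gradient (f k) xs‖ ≤ M) →
            Achieves (pstm G (fun k => gradient (f k)) L 0 (penaltyCoeff G M δ) N T x₀)
              G Set.univ f M xs ε
              (C * √(L * R ^ 2 / ε * condNumber G) *
                Real.log (2 + L * R ^ 2 / ε + M * R / ε + condNumber G) ^ p)
              (C * √(L * R ^ 2 / ε))) ∧
      -- strongly convex and Lipschitz: R-Sliding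
      (∀ μ : ℝ, 0 < μ →
        ∃ S : List Stage, (∀ s ∈ S, 0 < s.δ) ∧
          ∀ (Q : Set (Vec n)) (f : Fin m → Vec n → ℝ) (g : Fin m → Vec n → Vec n)
            (x₀ xs : Vec n),
            IsClosed Q → Convex ℝ Q →
            (∀ k, StronglyConvexWith μ Q (f k) (g k)) → (∀ k, ∀ x ∈ Q, ‖g k x‖ ≤ M) →
            x₀ ∈ Q → xs ∈ Q → IsMinOn (avg f) Q xs →
            Achieves (rSliding G Q g M S (consensus m x₀)) G Q f M xs ε
              (C * √(M ^ 2 / (μ * ε) * condNumber G))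
              (C * max (M ^ 2 / (μ * ε)) √(M ^ 2 / (μ * ε) * condNumber G))) ∧
      -- convex and Lipschitz: Sliding
      (∀ R : ℝ, 0 < R →
        ∃ (δ : ℝ) (N : ℕ) (T : ℕ → ℕ), 0 < δ ∧ δ ≤ ε ∧
          ∀ (Q : Set (Vec n)) (f : Fin m → Vec n → ℝ) (g : Fin m → Vec n → Vec n)
            (x₀ xs : Vec n),
            IsClosed Q → Convex ℝ Q →
            (∀ k, StronglyConvexWith 0 Q (f k) (g k)) → (∀ k, ∀ x ∈ Q, ‖g k x‖ ≤ M) →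
            x₀ ∈ Q → xs ∈ Q → IsMinOn (avg f) Q xs → ‖x₀ - xs‖ ≤ R →
            Achieves (sliding G Q g (penaltyCoeff G M δ) N T (consensus m x₀)) G Q f M xs ε
              (C * √(M ^ 2 * R ^ 2 / ε ^ 2 * condNumber G))
              (C * max (M ^ 2 * R ^ 2 / ε ^ 2)
                √(M ^ 2 * R ^ 2 / ε ^ 2 * condNumber G))) := by
  -- The largest constant comes from R-Sliding, $2\cdot(7680+32)=15424$. In the strongly convex
  -- smooth case the rounds carry one logarithm from the outer and one from the inner loop, hence
  -- $p=2$.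
  refine ⟨20000, 2, by norm_num, fun m n G _ hm hG ε M hε hM => ⟨?_, ?_, ?_, ?_⟩⟩
  · exact fun μ L R hμ hL hR => pstm_complexity_stronglyConvex hm hG hε hM hμ hL hR
  · exact fun L R hL hR => pstm_complexity_convex hm hG hε hM hL hR
  · exact fun μ hμ => rSliding_complexity hm hG hε hM hμ
  · exact fun R hR => sliding_complexity hm hG hε hM hR
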